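/- All rings are commutative with unit. A \emph{length function} on a ring $R$ is a map $\ell$ from the class of $R$-modules to $[0,\infty]$ such that $\ell(0)=0$, $\ell(M_2)=\ell(M_1)+\ell(M_3)$ for every short exact sequence $0\to M_1\to M_2\to M_3\to 0$, and $\ell(M)=\sup\{\ell(N)\mid N\subseteq M \text{ a finitely generated submodule}\}$ for every $R$-module $M$. Let $\mathcal{L}(R)$ be the set of length functions on $R$, ordered by $\ell_1\le\ell_2$ if and only if $\ell_1(M)\le\ell_2(M)$ for every $R$-module $M$. A \emph{Prüfer domain} is an integral domain $D$ such that $D_P$ is a valuation domain for every prime ideal $P$. Let $V$ be a valuation domain with maximal ideal $\mathfrak m$. Define the following functions on $V$-modules $M$: \begin{itemize} \item $t_{\mathfrak m}(M)=0$ if $M$ is a torsion $V/\mathfrak m$-module, and $t_{\mathfrak m}(M)=\infty$ otherwise; \item if $\mathfrak m$ is idempotent, $i_{\mathfrak m}(M)=0$ if $M$ is a $V/\mathfrak m$-module, and $i_{\mathfrak m}(M)=\infty$ otherwise; \item if $\mathfrak m$ is idempotent, $\mathrm{rk}_{\mathfrak m}(M)=\mathrm{rank}_{V/\mathfrak m}(M)$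 if $M$ is a $V/\mathfrak m$-module, and $\mathrm{rk}_{\mathfrak m}(M)=\infty$ otherwise; \item if among the prime ideals properly contained in $\mathfrak m$ there is a largest one $Q$, and $v$ is a real-valued (rank-one) valuation whose valuation ring is $V/Q$ (with $v(0)=\infty$; for $a\in V$ write $v(a)$ for the value of its class modulo $Q$), \[L_v(M)=\sup\sum_{i=1}^{s}\inf\{v(a)\mid a\in\mathrm{Ann}(E_i/E_{i-1})\},\] where the supremum is over all finite chains of submodules $0=E_0\subsetneq E_1\subsetneq\cdots\subsetneq E_s=M$. \end{itemize} For a length function $\ell$ on a Prüfer domain $D$ and a prime $P$ of $D$, let $\ell_{D_P}$ be the length function on $D_P$ given by $\ell_{D_P}(M)=\ell(M)$, with $M$ regarded as a $D$-module on the right. Let $\Sigma_t(\ell)$, $\Sigma_i(\ell)$, $\Sigma_r(\ell)$, $\Sigma_v(\ell)$ be the sets of primes $P$ of $D$ such that, respectively, $\ell_{D_P}=t_{PD_P}$; $PD_P$ is idempotent and $\ell_{D_P}=i_{PD_P}$; $PD_P$ is idempotent and $\ell_{D_P}=\alpha\,\mathrm{rk}_{PD_P}$ for some real $\alpha>0$;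 there is a largest prime $Q$ of $D_P$ properly contained in $PD_P$, and $\ell_{D_P}=L_v$ for some real-valued (rank-one) valuation $v$ with valuation ring $D_P/Q$. \textbf{Theorem.} Let $A$ and $B$ be Prüfer domains such that every ideal of $A$ and every ideal of $B$ has only finitely many minimal primes. Suppose that $\phi\colon\mathrm{Spec}(A)\to\mathrm{Spec}(B)$ is a homeomorphism (for the Zariski topologies) such that, for every prime ideal $P$ of $A$, $P$ is idempotent if and only if $\phi(P)$ is idempotent. Then there is an order isomorphism $\overline{\phi}\colon\mathcal{L}(A)\to\mathcal{L}(B)$ such that \[\phi(\Lambda(\ell))=\Lambda(\overline{\phi}(\ell))\] for every $\ell\in\mathcal{L}(A)$ and every $\Lambda\in\{\Sigma_t,\Sigma_i,\Sigma_r,\Sigma_v\}$. -/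

import Mathlib

open scoped ENNReal NNReal TensorProduct

universe u v

/-- A function assigning to every `R`-module an element of `[0, ∞]`. -/
abbrev ModuleFunction (R : Type u) [CommRing R] :=
  (M : Type u) → [AddCommGroup M] → [Module R M] → ℝ≥0∞

/-- A length function on `R`: it vanishes on zero modules, is additive on short exact sequences,
and is upper continuous. -/
structure LengthFunction (R : Type u) [CommRing R] where
  toFun : ModuleFunction R
  map_zero : ∀ (M : Type u) [AddCommGroup M] [Module R M], Subsingleton M → toFun M = 0
  additive : ∀ (M₁ M₂ M₃ : Type u) [AddCommGroup M₁] [AddCommGroup M₂] [AddCommGroup M₃]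
    [Module R M₁] [Module R M₂] [Module R M₃] (f : M₁ →ₗ[R] M₂) (g : M₂ →ₗ[R] M₃),
    Function.Injective f → Function.Exact f g → Function.Surjective g →
      toFun M₂ = toFun M₁ + toFun M₃
  upperContinuous : ∀ (M : Type u) [AddCommGroup M] [Module R M],
    toFun M = ⨆ (N : Submodule R M) (_ : N.FG), toFun N

namespace LengthFunction

/-- Length functions are ordered pointwise. -/
instance (R : Type u) [CommRing R] : PartialOrder (LengthFunction R) where
  le ℓ₁ ℓ₂ := ∀ (M : Type u) [AddCommGroup M] [Module R M], ℓ₁.toFun M ≤ ℓ₂.toFun M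
  le_refl _ _ _ _ := le_rfl
  le_trans _ _ _ h h' M _ _ := (h M).trans (h' M)
  le_antisymm := by
    rintro ⟨f, _, _, _⟩ ⟨g, _, _, _⟩ h h'
    have hfg : f = g := by
      funext M _ _
      exact le_antisymm (h M) (h' M)
    subst hfg
    rfl

/-- For a `D`-algebra `T`, the function `ℓ_T` on `T`-modules: `ℓ_T(M) = ℓ(M)`, where on the right
`M` is regarded as a `D`-module by restriction of scalars. -/
def restrict {D : Type u} [CommRing D] (ℓ : LengthFunction D) (T : Type u) [CommRing T]
    [Algebra D T] : ModuleFunction T :=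
  fun M _ _ =>
    letI : Module D M := Module.compHom M (algebraMap D T)
    ℓ.toFun M

end LengthFunction

/-- A Prüfer domain: an integral domain whose localization at every prime ideal is a valuation
domain. -/
def IsPruferDomain (D : Type u) [CommRing D] [IsDomain D] : Prop :=
  ∀ P : PrimeSpectrum D, ValuationRing (Localization.AtPrime P.asIdeal)

/-! ### The four classes of functions on the modules over a valuation domain `V` -/

section Classes

variable {V : Type u} [CommRing V]

open Classical in
/-- `t_P(M) = 0` if `M` is a torsion `V/P`-module, and `∞` otherwise. -/
noncomputable def torsionSingular (P : Ideal V) : ModuleFunction V :=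
  fun M _ _ =>
    if ∃ h : Module.IsTorsionBySet V M P,
      letI : Module (V ⧸ P) M := h.module
      Module.IsTorsion (V ⧸ P) M
    then 0 else ∞

open Classical in
/-- `i_P(M) = 0` if `M` is a `V/P`-module, and `∞` otherwise. -/
noncomputable def idempotentSingular (P : Ideal V) : ModuleFunction V :=
  fun M _ _ => if Module.IsTorsionBySet V M P then 0 else ∞

open Classical in
/-- `rk_P(M)` is the rank of `M` over `V/P` (the dimension of `Frac(V/P) ⊗ M`) if `M` is a
`V/P`-module, and `∞` otherwise. -/
noncomputable def rankFunction (P : Ideal V) [P.IsPrime] : ModuleFunction V :=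
  fun M _ _ =>
    if h : Module.IsTorsionBySet V M P then
      letI : Module (V ⧸ P) M := h.module
      ((Module.rank (FractionRing (V ⧸ P)) (FractionRing (V ⧸ P) ⊗[V ⧸ P] M)).toENat : ℝ≥0∞)
    else ∞

/-- The multiple `α f` of a function on modules by a constant. -/
noncomputable def scale (α : ℝ≥0) (f : ModuleFunction V) : ModuleFunction V :=
  fun M _ _ => (α : ℝ≥0∞) * f M

/-- The value in `[0, ∞]` at (the class of) `a ∈ V` of a real valuation `v` of `Frac(V/Q)` which is
nonnegative on `V/Q`. -/
noncomputable def valueAt {Q : Ideal V} [Q.IsPrime]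
    (v : AddValuation (FractionRing (V ⧸ Q)) (WithTop ℝ)) (a : V) : ℝ≥0∞ :=
  WithTop.map Real.toNNReal (v (algebraMap (V ⧸ Q) (FractionRing (V ⧸ Q)) (Ideal.Quotient.mk Q a)))

/-- The valuative function `L_v`: the supremum, over all finite chains of submodules
`0 = E₀ ⊊ E₁ ⊊ ⋯ ⊊ Eₛ = M`, of `∑ᵢ inf {v(a) | a ∈ Ann(Eᵢ / Eᵢ₋₁)}`. -/
noncomputable def valuativeFunction {Q : Ideal V} [Q.IsPrime]
    (v : AddValuation (FractionRing (V ⧸ Q)) (WithTop ℝ)) : ModuleFunction V :=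
  fun M _ _ =>
    ⨆ (s : ℕ) (E : Fin (s + 1) → Submodule V M)
      (_ : StrictMono E ∧ E 0 = ⊥ ∧ E (Fin.last s) = ⊤),
      ∑ i : Fin s,
        ⨅ a ∈ Module.annihilator V (E i.succ ⧸ (E i.castSucc).submoduleOf (E i.succ)), valueAt v a

end Classes

/-! ### The subsets of the spectrum attached to a length function

Here `D_P` is `Localization.AtPrime P`, and `P D_P` is its maximal ideal. -/

namespace LengthFunction

open IsLocalRing

variable {D : Type u} [CommRing D] (ℓ : LengthFunction D)

/-- `Σ_t(ℓ)`: the primes `P` with `ℓ_{D_P} = t_{P D_P}`. -/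
def sigmaT : Set (PrimeSpectrum D) :=
  {P | ℓ.restrict (Localization.AtPrime P.asIdeal) =
    torsionSingular (maximalIdeal (Localization.AtPrime P.asIdeal))}

/-- `Σ_i(ℓ)`: the primes `P` such that `P D_P` is idempotent and `ℓ_{D_P} = i_{P D_P}`. -/
def sigmaI : Set (PrimeSpectrum D) :=
  {P | IsIdempotentElem (maximalIdeal (Localization.AtPrime P.asIdeal)) ∧
    ℓ.restrict (Localization.AtPrime P.asIdeal) =
      idempotentSingular (maximalIdeal (Localization.AtPrime P.asIdeal))}

/-- `Σ_r(ℓ)`: the primes `P` such that `P D_P` is idempotent and `ℓ_{D_P} = α rk_{P D_P}` for some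
positive real number `α`. -/
def sigmaR : Set (PrimeSpectrum D) :=
  {P | IsIdempotentElem (maximalIdeal (Localization.AtPrime P.asIdeal)) ∧
    ∃ α : ℝ≥0, 0 < α ∧
      ℓ.restrict (Localization.AtPrime P.asIdeal) =
        scale α (rankFunction (maximalIdeal (Localization.AtPrime P.asIdeal)))}

/-- `Σ_v(ℓ)`: the primes `P` such that there is a largest prime `Q` of `D_P` properly contained in
`P D_P` (that is, `P` is nonzero and branched), and `ℓ_{D_P} = L_v` for some real valuation `v`
whose valuation ring is `D_P / Q`. -/
def sigmaV : Set (PrimeSpectrum D) :=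
  {P | ∃ (Q : Ideal (Localization.AtPrime P.asIdeal)) (_ : Q.IsPrime)
      (v : AddValuation (FractionRing (Localization.AtPrime P.asIdeal ⧸ Q)) (WithTop ℝ)),
    IsGreatest {Q' : Ideal (Localization.AtPrime P.asIdeal) |
      Q'.IsPrime ∧ Q' < maximalIdeal (Localization.AtPrime P.asIdeal)} Q ∧
    (∀ x, 0 ≤ v x ↔ x ∈ (algebraMap (Localization.AtPrime P.asIdeal ⧸ Q)
      (FractionRing (Localization.AtPrime P.asIdeal ⧸ Q))).range) ∧
    ℓ.restrict (Localization.AtPrime P.asIdeal) = valuativeFunction v}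

end LengthFunction

/-! A finitely generated module has a filtration with cyclic factors, so upper continuity makes a
length function, order included, determined by the values ℓ(D/I) (`le_iff_idx`). On a Prüfer domain
these values are governed by two numbers at each prime P. The residue length ρ(P) is ℓ(D/P). The
slope σ(P) is ℓ(D_P/aD_P), for a fixed a lying in P and in no smaller prime, when P is branched and
idempotent, and it is ρ(P) otherwise.

These numbers suffice, and they reflect the order (`le_of_forall_le`). Locally at P, two ideals with
radical PD_P are compared by counting powers of a small element, so one test ideal controls them all
(`idx_le_idx_of_radical`). Globally, an ideal with finitely many minimal primes is cut into pieces
having a least prime P (`exists_split`), and such a piece is compared with its saturation at P. The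
difference is null because vanishing slopes force vanishing length (`idx_eq_zero_of_slope`):
otherwise Spec would contain an infinite binary tree of primes, and hence an ideal with infinitely
many minimal primes.

The pairs (ρ, σ) that occur are exactly the admissible ones (`IsAdmissible`): σ = ∞ where P is
branched idempotent and ρ(P) ≠ 0, σ = ρ where P is not branched idempotent, and ρ(Q) = ∞ whenever Q
< P and σ(P) ≠ 0. Existence is obtained by summing over P the pullbacks of length functions on the
rings D_P (`exists_of_isAdmissible`). Each of these comes from a weight on ideals through suprema
over chains of submodules, and the weight is zero, concentrated at the maximal ideal, or given by a
real valuation (`exists_weight`).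

Admissibility mentions only the order on Spec and the idempotent primes, so it is carried along φ,
giving the order isomorphism. Membership in each of the four sets Σ is also a condition on (ρ, σ),
on the order and on idempotency (`mem_sigmaT_iff`, `mem_sigmaI_iff`, `mem_sigmaR_iff`,
`mem_sigmaV_iff`), so the sets correspond. -/

namespace LengthFunction

/-! ### Length functions and their values on cyclic modules -/

section Basic

variable {R : Type u} [CommRing R] (ℓ : LengthFunction R)
variable {M N : Type u} [AddCommGroup M] [AddCommGroup N] [Module R M] [Module R N]

theorem congr (e : M ≃ₗ[R] N) : ℓ.toFun M = ℓ.toFun N := by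
  have h := ℓ.additive M N PUnit.{u + 1} e.toLinearMap 0 e.injective
    (fun x => by simp) (fun x => ⟨0, Subsingleton.elim _ _⟩)
  rw [h, ℓ.map_zero PUnit.{u + 1} inferInstance, add_zero]

theorem eq_add_quotient (K : Submodule R M) : ℓ.toFun M = ℓ.toFun K + ℓ.toFun (M ⧸ K) :=
  ℓ.additive K M (M ⧸ K) K.subtype K.mkQ K.injective_subtype
    (LinearMap.exact_subtype_mkQ K) K.mkQ_surjective

theorem le_of_injective (f : M →ₗ[R] N) (hf : Function.Injective f) : ℓ.toFun M ≤ ℓ.toFun N := by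
  rw [ℓ.congr (LinearEquiv.ofInjective f hf), ℓ.eq_add_quotient (LinearMap.range f)]
  exact le_self_add

theorem le_of_surjective (f : M →ₗ[R] N) (hf : Function.Surjective f) :
    ℓ.toFun N ≤ ℓ.toFun M := by
  rw [← ℓ.congr (f.quotKerEquivOfSurjective hf), ℓ.eq_add_quotient (LinearMap.ker f)]
  exact le_add_self

theorem mono {K K' : Submodule R M} (h : K ≤ K') : ℓ.toFun K ≤ ℓ.toFun K' :=
  ℓ.le_of_injective (Submodule.inclusion h) (Submodule.inclusion_injective h)

theorem eq_add_map_mkQ {K K' : Submodule R M} (h : K ≤ K') :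
    ℓ.toFun K' = ℓ.toFun K + ℓ.toFun (K'.map K.mkQ) := by
  refine ℓ.additive K K' (K'.map K.mkQ) (Submodule.inclusion h) (K.mkQ.submoduleMap K')
    (Submodule.inclusion_injective h) ?_ (LinearMap.submoduleMap_surjective _ _)
  intro x
  constructor
  · intro hx
    have hx' : K.mkQ (x : M) = 0 := congrArg Subtype.val hx
    exact ⟨⟨x, by simpa using hx'⟩, rfl⟩
  · rintro ⟨y, rfl⟩
    apply Subtype.ext
    change K.mkQ (y : M) = 0
    simp

/-- The value of a length function on the cyclic module `R / I`. -/
def idx (I : Ideal R) : ℝ≥0∞ := ℓ.toFun (R ⧸ I)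

theorem idx_top : ℓ.idx ⊤ = 0 :=
  ℓ.map_zero _ (Ideal.Quotient.subsingleton_iff.2 rfl)

theorem idx_anti {I J : Ideal R} (h : I ≤ J) : ℓ.idx J ≤ ℓ.idx I :=
  ℓ.le_of_surjective (Submodule.factor h) (Submodule.factor_surjective h)

theorem span_singleton_eq_idx (x : M) :
    ℓ.toFun (Submodule.span R {x}) = ℓ.idx (Ideal.torsionOf R M x) :=
  (ℓ.congr (Ideal.quotTorsionOfEquivSpanSingleton R M x)).symm

theorem torsionOf_mk (I : Ideal R) (x : R) :
    Ideal.torsionOf R (R ⧸ I) (I.mkQ x) = I.colon {x} := by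
  ext r
  rw [Ideal.mem_torsionOf_iff, Submodule.mem_colon_singleton, ← map_smul]
  exact Submodule.Quotient.mk_eq_zero I

theorem torsionOf_mkQ (K : Submodule R M) (x : M) :
    Ideal.torsionOf R (M ⧸ K) (K.mkQ x) = K.colon {x} := by
  ext r
  rw [Ideal.mem_torsionOf_iff, Submodule.mem_colon_singleton, ← map_smul]
  exact Submodule.Quotient.mk_eq_zero K

theorem idx_eq_add_map {I J : Ideal R} (h : I ≤ J) :
    ℓ.idx I = ℓ.toFun (Submodule.map (Submodule.mkQ I) J) + ℓ.idx J := by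
  refine ℓ.additive _ (R ⧸ I) (R ⧸ J) (Submodule.subtype _) (Submodule.factor h)
    (Submodule.injective_subtype _) ?_ (Submodule.factor_surjective h)
  rw [LinearMap.exact_iff, Submodule.range_subtype]
  ext x
  obtain ⟨x, rfl⟩ := Submodule.mkQ_surjective I x
  rw [LinearMap.mem_ker]
  constructor
  · intro hx
    exact ⟨x, (Submodule.Quotient.mk_eq_zero J).1 hx, rfl⟩
  · rintro ⟨y, hy, hyx⟩
    rw [← hyx]
    exact (Submodule.Quotient.mk_eq_zero J).2 hy

/-- The kernel of R/I → R/(I + xR) is generated by the class of x, whose annihilator is I : x. This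
is the tool for cutting an ideal into simpler pieces. -/
theorem idx_eq_colon_add (I : Ideal R) (x : R) :
    ℓ.idx I = ℓ.idx (I.colon {x}) + ℓ.idx (I ⊔ Ideal.span {x}) := by
  rw [ℓ.idx_eq_add_map (le_sup_left : I ≤ I ⊔ Ideal.span {x})]
  congr 1
  rw [Submodule.map_sup, Ideal.span, Submodule.map_span, Set.image_singleton,
    ← torsionOf_mk, ← span_singleton_eq_idx]
  have : Submodule.map I.mkQ I = ⊥ := by
    rw [← LinearMap.le_ker_iff_map, Submodule.ker_mkQ]
  rw [this, bot_sup_eq]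

/-- Adjoining the generators one at a time filters the module with cyclic factors R/(K : x), on
which the two functions are compared by hypothesis. -/
theorem span_finset_le {ℓ₁ ℓ₂ : LengthFunction R}
    (h : ∀ (K : Submodule R M) (x : M), ℓ₁.idx (K.colon {x}) ≤ ℓ₂.idx (K.colon {x}))
    (s : Finset M) :
    ℓ₁.toFun (Submodule.span R (s : Set M)) ≤ ℓ₂.toFun (Submodule.span R (s : Set M)) := by
  classical
  induction s using Finset.induction_on with
  | empty =>
    rw [ℓ₁.map_zero _ (by
      rw [Finset.coe_empty, Submodule.span_empty]; infer_instance)]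
    exact zero_le
  | insert x s _ ih =>
    set K := Submodule.span R (s : Set M)
    have hle : K ≤ Submodule.span R ((insert x s : Finset M) : Set M) :=
      Submodule.span_mono (by simp)
    have hmap : (Submodule.span R ((insert x s : Finset M) : Set M)).map K.mkQ =
        Submodule.span R {K.mkQ x} := by
      rw [Finset.coe_insert, Submodule.span_insert, Submodule.map_sup, Submodule.map_span,
        Set.image_singleton]
      have : Submodule.map K.mkQ K = ⊥ := by
        rw [← LinearMap.le_ker_iff_map, Submodule.ker_mkQ]
      rw [this, sup_bot_eq]
    rw [ℓ₁.eq_add_map_mkQ hle, ℓ₂.eq_add_map_mkQ hle, hmap, span_singleton_eq_idx,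
      span_singleton_eq_idx, torsionOf_mkQ]
    exact add_le_add ih (h K x)

theorem toFun_le_of_idx {ℓ₁ ℓ₂ : LengthFunction R}
    (h : ∀ (K : Submodule R M) (x : M), ℓ₁.idx (K.colon {x}) ≤ ℓ₂.idx (K.colon {x})) :
    ℓ₁.toFun M ≤ ℓ₂.toFun M := by
  rw [ℓ₁.upperContinuous M, ℓ₂.upperContinuous M]
  refine iSup₂_mono fun K hK => ?_
  obtain ⟨s, rfl⟩ := hK
  exact span_finset_le h s

theorem le_iff_idx {ℓ₁ ℓ₂ : LengthFunction R} : ℓ₁ ≤ ℓ₂ ↔ ∀ I : Ideal R, ℓ₁.idx I ≤ ℓ₂.idx I :=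
  ⟨fun h _ => h _, fun h _ _ _ => toFun_le_of_idx fun _ _ => h _⟩

theorem ext_idx {ℓ₁ ℓ₂ : LengthFunction R} (h : ∀ I : Ideal R, ℓ₁.idx I = ℓ₂.idx I) : ℓ₁ = ℓ₂ :=
  le_antisymm (le_iff_idx.2 fun I => (h I).le) (le_iff_idx.2 fun I => (h I).ge)

/-- The zero length function. -/
instance : Zero (LengthFunction R) where
  zero :=
    { toFun := fun _ _ _ => 0
      map_zero := fun _ _ _ _ => rfl
      additive := by intros; simp
      upperContinuous := by intros; simp }

/-- Comparison with the zero length function: each K : x contains the annihilator of x, so its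
quotient is null as well. -/
theorem toFun_eq_zero (h : ∀ x : M, ℓ.idx (Ideal.torsionOf R M x) = 0) : ℓ.toFun M = 0 := by
  refine le_antisymm (toFun_le_of_idx (ℓ₁ := ℓ) (ℓ₂ := 0) fun K x => ?_) zero_le
  refine le_trans (ℓ.idx_anti ?_) (h x).le
  intro r hr
  rw [Ideal.mem_torsionOf_iff] at hr
  rw [Submodule.mem_colon_singleton, hr]
  exact K.zero_mem

theorem idx_eq_of_le {I J : Ideal R} (h : I ≤ J) (h0 : ∀ x ∈ J, ℓ.idx (I.colon {x}) = 0) :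
    ℓ.idx I = ℓ.idx J := by
  rw [ℓ.idx_eq_add_map h, ℓ.toFun_eq_zero, zero_add]
  rintro ⟨_, x, hx, rfl⟩
  rw [← h0 x hx, ← torsionOf_mk]
  congr 1
  ext r
  simp [Ideal.mem_torsionOf_iff, Subtype.ext_iff]

end Basic

/-! ### Sums of length functions -/

section Sum

variable {R : Type u} [CommRing R]

/-- The sum of a family of length functions. -/
noncomputable def tsum {ι : Type*} (ℓ : ι → LengthFunction R) : LengthFunction R where
  toFun M _ _ := ∑' i, (ℓ i).toFun M
  map_zero M _ _ h := by simp [(ℓ _).map_zero M h]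
  additive M₁ M₂ M₃ _ _ _ _ _ _ f g hf hfg hg := by
    rw [← ENNReal.tsum_add]
    exact tsum_congr fun i => (ℓ i).additive M₁ M₂ M₃ f g hf hfg hg
  upperContinuous M _ _ := by
    apply le_antisymm
    · rw [ENNReal.tsum_eq_iSup_sum]
      refine iSup_le fun s => ?_
      have hd : ∀ i, (ℓ i).toFun M = ⨆ N : {N : Submodule R M // N.FG}, (ℓ i).toFun N := fun i => by
        rw [(ℓ i).upperContinuous M, iSup_subtype]
      simp only [hd]
      have _ : Nonempty {N : Submodule R M // N.FG} := ⟨⟨⊥, Submodule.fg_bot⟩⟩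
      -- A finite sum commutes with these suprema because finitely generated submodules are directed
      -- under sums.
      rw [ENNReal.finsetSum_iSup]
      · refine iSup_le fun N => le_trans ?_ (le_iSup₂_of_le N.1 N.2 le_rfl)
        exact ENNReal.sum_le_tsum s
      · intro N N'
        exact ⟨⟨N.1 ⊔ N'.1, N.2.sup N'.2⟩, fun i =>
          ⟨(ℓ i).mono le_sup_left, (ℓ i).mono le_sup_right⟩⟩
    · exact iSup₂_le fun N _ => ENNReal.tsum_le_tsum fun i =>
        (ℓ i).le_of_injective N.subtype N.injective_subtype

theorem idx_tsum {ι : Type*} (ℓ : ι → LengthFunction R) (I : Ideal R) :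
    (tsum ℓ).idx I = ∑' i, (ℓ i).idx I := rfl

end Sum

/-! ### Restriction of scalars -/

section Restrict

variable {D : Type u} [CommRing D] (ℓ : LengthFunction D) (T : Type u) [CommRing T] [Algebra D T]

theorem restrict_eq (M : Type u) [AddCommGroup M] [Module T M] [Module D M]
    [IsScalarTower D T M] : ℓ.restrict T M = ℓ.toFun M := by
  unfold restrict
  congr 1
  apply Module.ext
  funext d x
  change algebraMap D T d • x = d • x
  rw [algebraMap_smul]

/-- The function `ℓ_T`, as a length function on `T`. -/
noncomputable def restrictScalars : LengthFunction T where
  toFun := ℓ.restrict T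
  map_zero M _ _ h := by
    let _ : Module D M := Module.compHom M (algebraMap D T)
    exact ℓ.map_zero M h
  additive M₁ M₂ M₃ _ _ _ _ _ _ f g hf hfg hg := by
    let _ : Module D M₁ := Module.compHom M₁ (algebraMap D T)
    let _ : Module D M₂ := Module.compHom M₂ (algebraMap D T)
    let _ : Module D M₃ := Module.compHom M₃ (algebraMap D T)
    have _ : IsScalarTower D T M₁ := .of_algebraMap_smul fun _ _ => rfl
    have _ : IsScalarTower D T M₂ := .of_algebraMap_smul fun _ _ => rfl
    have _ : IsScalarTower D T M₃ := .of_algebraMap_smul fun _ _ => rfl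
    exact ℓ.additive M₁ M₂ M₃ (f.restrictScalars D) (g.restrictScalars D) hf hfg hg
  upperContinuous M _ _ := by
    let _ : Module D M := Module.compHom M (algebraMap D T)
    have _ : IsScalarTower D T M := .of_algebraMap_smul fun _ _ => rfl
    simp only [ℓ.restrict_eq T]
    apply le_antisymm
    · rw [ℓ.upperContinuous M]
      refine iSup₂_le fun N hN => ?_
      obtain ⟨s, rfl⟩ := hN
      refine le_iSup₂_of_le (Submodule.span T (s : Set M)) ⟨s, rfl⟩ ?_
      have hle : Submodule.span D (s : Set M) ≤
          (Submodule.span T (s : Set M)).restrictScalars D :=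
        Submodule.span_le_restrictScalars D T _
      exact ℓ.mono hle
    · refine iSup₂_le fun N _ => ?_
      exact ℓ.le_of_injective (N.subtype.restrictScalars D) N.injective_subtype

theorem idx_restrictScalars (I : Ideal T) :
    (ℓ.restrictScalars T).idx I = ℓ.toFun (T ⧸ I) :=
  ℓ.restrict_eq T (T ⧸ I)

end Restrict

end LengthFunction

/-! ### Length functions defined by weights on ideals -/

/-- A function on the ideals of `R` which is the restriction to cyclic modules of a length
function computed by chains of submodules. -/
structure IsWeight {R : Type u} [CommRing R] (w : Ideal R → ℝ≥0∞) : Prop where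
  top : w ⊤ = 0
  anti : ∀ {I J : Ideal R}, I ≤ J → w J ≤ w I
  mul_le : ∀ I J : Ideal R, w (I * J) ≤ w I + w J
  colon_add_le : ∀ {I J : Ideal R}, J ≤ I → w (J.colon (I : Set R)) + w I ≤ w J
  iInf_le : ∀ {ι : Type u} (I : ι → Ideal R), w (⨅ i, I i) ≤ ⨆ i, w (I i)

section Chain

variable {R : Type u} [CommRing R]

/-- The supremum, over all finite chains of submodules from `0` to `M`, of the sum of the weights
of the annihilators of the factors. -/
noncomputable def chainFunction (w : Ideal R → ℝ≥0∞) : ModuleFunction R :=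
  fun M _ _ =>
    ⨆ (s : ℕ) (E : Fin (s + 1) → Submodule R M)
      (_ : StrictMono E ∧ E 0 = ⊥ ∧ E (Fin.last s) = ⊤),
      ∑ i : Fin s,
        w (Module.annihilator R (E i.succ ⧸ (E i.castSucc).submoduleOf (E i.succ)))

variable {M : Type u} [AddCommGroup M] [Module R M]

theorem annihilator_quotient_submoduleOf (K K' : Submodule R M) :
    Module.annihilator R (K' ⧸ K.submoduleOf K') = K.colon (K' : Set M) := by
  ext r
  rw [Module.mem_annihilator, Submodule.mem_colon]
  constructor
  · intro h x hx
    have := h (Submodule.Quotient.mk ⟨x, hx⟩)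
    rw [← Submodule.Quotient.mk_smul, Submodule.Quotient.mk_eq_zero] at this
    exact this
  · intro h x
    obtain ⟨⟨x, hx⟩, rfl⟩ := Submodule.Quotient.mk_surjective _ x
    rw [← Submodule.Quotient.mk_smul, Submodule.Quotient.mk_eq_zero]
    exact h x hx

/-- `ChainSum w K K' c` says that `c` is the sum of the weights along a weakly increasing chain of
submodules from `K` to `K'`. -/
inductive ChainSum (w : Ideal R → ℝ≥0∞) : Submodule R M → Submodule R M → ℝ≥0∞ → Prop
  | refl (K : Submodule R M) : ChainSum w K K 0
  | step {K K' K'' : Submodule R M} {c : ℝ≥0∞} : ChainSum w K K' c → K' ≤ K'' →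
      ChainSum w K K'' (c + w (K'.colon (K'' : Set M)))

namespace ChainSum

variable {w : Ideal R → ℝ≥0∞} {K K' K'' : Submodule R M} {c c' : ℝ≥0∞}

theorem single (h : K ≤ K') : ChainSum w K K' (w (K.colon (K' : Set M))) := by
  simpa using (refl K).step h

theorem le (h : ChainSum w K K' c) : K ≤ K' := by
  induction h with
  | refl => exact le_rfl
  | step _ h ih => exact ih.trans h

theorem trans (h : ChainSum w K K' c) (h' : ChainSum w K' K'' c') :
    ChainSum w K K'' (c + c') := by
  induction h' with
  | refl => simpa using h
  | step _ hle ih => rw [← add_assoc]; exact ih.step hle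

theorem of_fin {s : ℕ} (E : Fin (s + 1) → Submodule R M) (hE : Monotone E) :
    ChainSum w (E 0) (E (Fin.last s))
      (∑ i : Fin s, w ((E i.castSucc).colon (E i.succ : Set M))) := by
  induction s with
  | zero => simpa using refl (w := w) (E 0)
  | succ s ih =>
    rw [Fin.sum_univ_castSucc]
    exact (ih (fun i => E i.castSucc) (hE.comp Fin.strictMono_castSucc.monotone)).step
      (hE (Fin.le_last _))

theorem exists_fin (hw : w ⊤ = 0) (h : ChainSum w K K' c) :
    ∃ (s : ℕ) (E : Fin (s + 1) → Submodule R M), StrictMono E ∧ E 0 = K ∧ E (Fin.last s) = K' ∧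
      ∑ i : Fin s, w ((E i.castSucc).colon (E i.succ : Set M)) = c := by
  induction h with
  | refl => exact ⟨0, fun _ => K, fun i j hij => absurd hij (by omega), rfl, rfl, by simp⟩
  | @step K' K'' c _ hle ih =>
    obtain ⟨s, E, hE, h0, hs, hc⟩ := ih
    rcases hle.eq_or_lt with rfl | hlt
    · refine ⟨s, E, hE, h0, hs, ?_⟩
      have : K'.colon (K' : Set M) = ⊤ := by
        rw [Ideal.eq_top_iff_one, Submodule.mem_colon]
        intro x hx
        simpa using hx
      rw [this, hw, add_zero, hc]
    · refine ⟨s + 1, Fin.snoc (α := fun _ => Submodule R M) E K'', ?_, ?_, ?_, ?_⟩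
      · rw [Fin.strictMono_iff_lt_succ]
        intro i
        induction i using Fin.lastCases with
        | last => rw [Fin.succ_last, Fin.snoc_last, Fin.snoc_castSucc, hs]; exact hlt
        | cast i =>
          rw [← Fin.castSucc_succ, Fin.snoc_castSucc, Fin.snoc_castSucc]
          exact hE Fin.castSucc_lt_succ
      · rw [← Fin.castSucc_zero, Fin.snoc_castSucc, h0]
      · rw [Fin.snoc_last]
      · rw [Fin.sum_univ_castSucc, Fin.succ_last, Fin.snoc_last, Fin.snoc_castSucc, hs, ← hc]
        congr 1
        refine Finset.sum_congr rfl fun i _ => ?_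
        rw [← Fin.castSucc_succ, Fin.snoc_castSucc, Fin.snoc_castSucc]

end ChainSum

theorem chainFunction_eq {w : Ideal R → ℝ≥0∞} (hw : w ⊤ = 0) :
    chainFunction w M = ⨆ (c : ℝ≥0∞) (_ : ChainSum w (⊥ : Submodule R M) ⊤ c), c := by
  unfold chainFunction
  simp only [annihilator_quotient_submoduleOf]
  apply le_antisymm
  · refine iSup_le fun s => iSup_le fun E => iSup_le fun ⟨hE, h0, hs⟩ => ?_
    refine le_iSup₂_of_le _ ?_ le_rfl
    rw [← h0, ← hs]
    exact .of_fin E hE.monotone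
  · refine iSup₂_le fun c hc => ?_
    obtain ⟨s, E, hE, h0, hs, rfl⟩ := hc.exists_fin hw
    exact le_iSup_of_le s (le_iSup_of_le E (le_iSup_of_le ⟨hE, h0, hs⟩ le_rfl))

theorem ChainSum.le_chainFunction {w : Ideal R → ℝ≥0∞} (hw : w ⊤ = 0) {c : ℝ≥0∞}
    (h : ChainSum w (⊥ : Submodule R M) ⊤ c) : c ≤ chainFunction w M := by
  rw [chainFunction_eq hw]
  exact le_iSup₂_of_le c h le_rfl

theorem chainFunction_le {w : Ideal R → ℝ≥0∞} (hw : w ⊤ = 0) {a : ℝ≥0∞}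
    (h : ∀ c, ChainSum w (⊥ : Submodule R M) ⊤ c → c ≤ a) : chainFunction w M ≤ a := by
  rw [chainFunction_eq hw]
  exact iSup₂_le h

variable {N : Type u} [AddCommGroup N] [Module R N] {w : Ideal R → ℝ≥0∞}

theorem colon_map_of_injective (f : M →ₗ[R] N) (hf : Function.Injective f) (K K' : Submodule R M) :
    (K.map f).colon (K'.map f : Set N) = K.colon (K' : Set M) := by
  ext r
  simp only [Submodule.mem_colon, SetLike.mem_coe]
  constructor
  · intro h x hx
    obtain ⟨y, hy, hyx⟩ := h (f x) ⟨x, hx, rfl⟩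
    rw [← map_smul] at hyx
    rwa [← hf hyx]
  · rintro h _ ⟨x, hx, rfl⟩
    exact ⟨r • x, h x hx, map_smul f r x⟩

theorem colon_comap_of_surjective (f : M →ₗ[R] N) (hf : Function.Surjective f)
    (K K' : Submodule R N) :
    (K.comap f).colon (K'.comap f : Set M) = K.colon (K' : Set N) := by
  ext r
  simp only [Submodule.mem_colon, SetLike.mem_coe, Submodule.mem_comap, map_smul]
  constructor
  · intro h x hx
    obtain ⟨y, rfl⟩ := hf x
    exact h y hx
  · exact fun h x hx => h _ hx

theorem ChainSum.map (f : M →ₗ[R] N) (hf : Function.Injective f) {K K' : Submodule R M} {c : ℝ≥0∞}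
    (h : ChainSum w K K' c) : ChainSum w (K.map f) (K'.map f) c := by
  induction h with
  | refl => exact .refl _
  | step _ hle ih =>
    rw [← colon_map_of_injective f hf]
    exact ih.step (Submodule.map_mono hle)

theorem ChainSum.comap (f : M →ₗ[R] N) (hf : Function.Surjective f) {K K' : Submodule R N}
    {c : ℝ≥0∞} (h : ChainSum w K K' c) : ChainSum w (K.comap f) (K'.comap f) c := by
  induction h with
  | refl => exact .refl _
  | step _ hle ih =>
    rw [← colon_comap_of_surjective f hf]
    exact ih.step (Submodule.comap_mono hle)

theorem ChainSum.comap_subtype (L : Submodule R M) {K K' : Submodule R M} {c : ℝ≥0∞}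
    (h : ChainSum w K K' c) (hL : K' ≤ L) :
    ChainSum w (K.comap L.subtype) (K'.comap L.subtype) c := by
  induction h with
  | refl => exact .refl _
  | @step K' K'' c hc hle ih =>
    have e : K'.colon (K'' : Set M) =
        (K'.comap L.subtype).colon (K''.comap L.subtype : Set L) := by
      rw [← colon_map_of_injective L.subtype L.injective_subtype, Submodule.map_comap_subtype,
        Submodule.map_comap_subtype, inf_eq_right.2 hL, inf_eq_right.2 (hle.trans hL)]
    rw [e]
    exact (ih (hle.trans hL)).step (Submodule.comap_mono hle)

/-- For one step of the chain, if a kills the factor traced on M₁ and b kills its image in M₃, then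
ab kills the factor itself. Hence `mul_le` bounds its weight by the sum of the other two. -/
theorem ChainSum.exists_add (hw : IsWeight w) {M₁ M₃ : Type u} [AddCommGroup M₁] [AddCommGroup M₃]
    [Module R M₁] [Module R M₃] (f : M₁ →ₗ[R] M) (g : M →ₗ[R] M₃) (hfg : Function.Exact f g)
    {K K' : Submodule R M} {c : ℝ≥0∞} (h : ChainSum w K K' c) :
    ∃ c₁ c₃, ChainSum w (K.comap f) (K'.comap f) c₁ ∧ ChainSum w (K.map g) (K'.map g) c₃ ∧
      c ≤ c₁ + c₃ := by
  induction h with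
  | refl => exact ⟨0, 0, .refl _, .refl _, zero_le⟩
  | @step K' K'' c _ hle ih =>
    obtain ⟨c₁, c₃, h₁, h₃, hc⟩ := ih
    refine ⟨_, _, h₁.step (Submodule.comap_mono hle), h₃.step (Submodule.map_mono hle), ?_⟩
    rw [add_add_add_comm]
    refine add_le_add hc ((hw.anti ?_).trans (hw.mul_le _ _))
    rw [Ideal.mul_le]
    intro a ha b hb
    rw [Submodule.mem_colon] at ha hb ⊢
    intro x hx
    obtain ⟨y, hy, hyx⟩ := hb (g x) ⟨x, hx, rfl⟩
    rw [← map_smul] at hyx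
    have hk : g (b • x - y) = 0 := by rw [map_sub, hyx, sub_self]
    obtain ⟨z, hz⟩ := (hfg _).1 hk
    have hz' : z ∈ K''.comap f := by
      rw [Submodule.mem_comap, hz]
      exact K''.sub_mem (K''.smul_mem b hx) (hle hy)
    have := ha z hz'
    change f (a • z) ∈ K' at this
    rw [map_smul, hz, smul_sub] at this
    rw [mul_smul]
    exact (K'.sub_mem_iff_left (K'.smul_mem a hy)).1 this

/-- K' : K'' is the intersection of the ideals K' : x, so by `iInf_le` a single x in K'' nearly
attains the weight of the step. A chain has finitely many steps, and cutting it with any F' that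
contains the chosen elements keeps the sum above r. -/
theorem ChainSum.exists_fg (hw : IsWeight w) {K K' : Submodule R M} {c : ℝ≥0∞}
    (h : ChainSum w K K' c) : ∀ r < c, ∃ F : Submodule R M, F.FG ∧ ∀ F' : Submodule R M, F ≤ F' →
      ∃ c' > r, ChainSum w (K ⊓ F') (K' ⊓ F') c' := by
  induction h with
  | refl => exact fun r hr => absurd hr not_lt_zero
  | @step K' K'' c _ hle ih =>
    have key : ∀ r < w (K'.colon (K'' : Set M)), ∃ F : Submodule R M, F.FG ∧
        ∀ F' : Submodule R M, F ≤ F' → r < w ((K' ⊓ F').colon ((K'' ⊓ F' : Submodule R M) : Set M))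
        := by
      intro r hr
      have e : K'.colon (K'' : Set M) = ⨅ x : K'', K'.colon {(x : M)} := by
        ext a
        simp [Submodule.mem_iInf, Submodule.mem_colon]
      rw [e] at hr
      obtain ⟨x, hx⟩ := lt_iSup_iff.1 (hr.trans_le (hw.iInf_le _))
      refine ⟨Submodule.span R {(x : M)}, Submodule.fg_span_singleton _, fun F' hF' => ?_⟩
      refine hx.trans_le (hw.anti fun a ha => ?_)
      rw [Submodule.mem_colon] at ha
      rw [Submodule.mem_colon_singleton]
      exact (ha x ⟨x.2, hF' (Submodule.mem_span_singleton_self _)⟩).1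
    intro r hr
    -- Splitting `r` strictly between the two summands requires both of them to be nonzero, so the
    -- degenerate cases are treated separately.
    by_cases hc0 : c = 0
    · rw [hc0, zero_add] at hr
      obtain ⟨F, hF, h⟩ := key r hr
      by_cases hr0 : (0 : ℝ≥0∞) < c
      · exact absurd hc0 hr0.ne'
      · refine ⟨F, hF, fun F' hF' => ?_⟩
        have hKK' : ∃ c', ChainSum w (K ⊓ F') (K' ⊓ F') c' :=
          ⟨_, .single (inf_le_inf_right _ (ChainSum.le ‹_›))⟩
        obtain ⟨c', hc'⟩ := hKK'
        exact ⟨_, (h F' hF').trans_le le_add_self, hc'.step (inf_le_inf_right _ hle)⟩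
    by_cases hw0 : w (K'.colon (K'' : Set M)) = 0
    · rw [hw0, add_zero] at hr
      obtain ⟨F, hF, h⟩ := ih r hr
      refine ⟨F, hF, fun F' hF' => ?_⟩
      obtain ⟨c', hrc, hc'⟩ := h F' hF'
      exact ⟨_, hrc.trans_le le_self_add, hc'.step (inf_le_inf_right _ hle)⟩
    obtain ⟨r₁, hr₁, r₂, hr₂, hr⟩ := ENNReal.exists_lt_add_of_lt_add hr hc0 hw0
    obtain ⟨F₁, hF₁, h₁⟩ := ih r₁ hr₁
    obtain ⟨F₂, hF₂, h₂⟩ := key r₂ hr₂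
    refine ⟨F₁ ⊔ F₂, hF₁.sup hF₂, fun F' hF' => ?_⟩
    obtain ⟨c', hrc, hc'⟩ := h₁ F' (le_sup_left.trans hF')
    exact ⟨_, hr.trans (ENNReal.add_lt_add hrc (h₂ F' (le_sup_right.trans hF'))),
      hc'.step (inf_le_inf_right _ hle)⟩

/-- The length function given by a weight. -/
noncomputable def IsWeight.lengthFunction (hw : IsWeight w) : LengthFunction R where
  toFun := chainFunction w
  map_zero M _ _ h := by
    refine le_antisymm (chainFunction_le hw.top fun c hc => ?_) zero_le
    have : ∀ {K K' : Submodule R M} {c : ℝ≥0∞}, ChainSum w K K' c → c = 0 := by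
      intro K K' c hc
      induction hc with
      | refl => rfl
      | @step K' K'' _ _ _ ih =>
        have e : K'.colon (K'' : Set M) = ⊤ := by
          rw [Ideal.eq_top_iff_one, Submodule.mem_colon]
          intro x _
          rw [Subsingleton.elim ((1 : R) • x) 0]
          exact K'.zero_mem
        rw [ih, e, hw.top, add_zero]
    exact (this hc).le
  additive M₁ M₂ M₃ _ _ _ _ _ _ f g hf hfg hg := by
    apply le_antisymm
    · refine chainFunction_le hw.top fun c hc => ?_
      obtain ⟨c₁, c₃, h₁, h₃, h⟩ := hc.exists_add hw f g hfg
      refine h.trans (add_le_add ?_ ?_)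
      · refine ChainSum.le_chainFunction hw.top ?_
        rwa [Submodule.comap_bot, LinearMap.ker_eq_bot.2 hf, Submodule.comap_top] at h₁
      · refine ChainSum.le_chainFunction hw.top ?_
        rwa [Submodule.map_bot, Submodule.map_top, LinearMap.range_eq_top.2 hg] at h₃
    · rw [chainFunction_eq hw.top (M := M₁), chainFunction_eq hw.top (M := M₃)]
      refine ENNReal.biSup_add_biSup_le' ⟨_, .single bot_le⟩ ⟨_, .single bot_le⟩ ?_
      intro c₁ h₁ c₃ h₃
      refine ChainSum.le_chainFunction hw.top ?_
      have h₁' := h₁.map f hf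
      have h₃' := h₃.comap g hg
      rw [Submodule.map_bot, Submodule.map_top] at h₁'
      rw [Submodule.comap_bot, Submodule.comap_top, (LinearMap.exact_iff).1 hfg] at h₃'
      exact h₁'.trans h₃'
  upperContinuous M _ _ := by
    apply le_antisymm
    · refine chainFunction_le hw.top fun c hc => le_of_forall_lt fun r hr => ?_
      obtain ⟨F, hF, h⟩ := hc.exists_fg hw r hr
      obtain ⟨c', hrc, hc'⟩ := h F le_rfl
      refine hrc.trans_le (le_iSup₂_of_le F hF (ChainSum.le_chainFunction hw.top ?_))
      simpa using hc'.comap_subtype F inf_le_right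
    · refine iSup₂_le fun F _ => chainFunction_le hw.top fun c hc => ?_
      have := (hc.map F.subtype F.injective_subtype).trans
        (.single (w := w) (K' := ⊤) le_top)
      rw [Submodule.map_bot] at this
      exact le_self_add.trans (this.le_chainFunction hw.top)

/-- By `colon_add_le` the weights telescope along any chain of ideals from I to R, so no chain
exceeds w(I). The one-step chain reaches it. -/
theorem IsWeight.idx_lengthFunction (hw : IsWeight w) (I : Ideal R) :
    hw.lengthFunction.idx I = w I := by
  apply le_antisymm
  · refine chainFunction_le hw.top fun c hc => ?_
    have key : ∀ {K K' : Submodule R R} {c : ℝ≥0∞}, ChainSum w K K' c → c + w K' ≤ w K := by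
      intro K K' c h
      induction h with
      | refl => simp
      | @step K' K'' c _ hle ih =>
        refine le_trans ?_ ih
        rw [add_assoc]
        exact add_le_add le_rfl (hw.colon_add_le hle)
    have := key (hc.comap I.mkQ I.mkQ_surjective)
    rw [Submodule.comap_bot, Submodule.ker_mkQ] at this
    exact le_self_add.trans this
  · refine le_trans ?_ (ChainSum.le_chainFunction hw.top (.single (w := w) bot_le))
    refine hw.anti fun a ha => ?_
    rw [Submodule.mem_colon] at ha
    have := ha (I.mkQ 1) trivial
    rw [← map_smul, Submodule.mem_bot] at this
    simpa using (Submodule.Quotient.mk_eq_zero I).1 this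

/-- Turns each equality of module functions in the definitions of the sets Σ into a condition on
ideals. -/
theorem IsWeight.toFun_eq_iff (hw : IsWeight w) (ℓ : LengthFunction R) :
    ℓ.toFun = chainFunction w ↔ ∀ I : Ideal R, ℓ.idx I = w I := by
  constructor
  · intro h I
    rw [← hw.idx_lengthFunction I]
    change ℓ.toFun (R ⧸ I) = chainFunction w (R ⧸ I)
    rw [h]
  · intro h
    have : ℓ = hw.lengthFunction :=
      LengthFunction.ext_idx fun I => (h I).trans (hw.idx_lengthFunction I).symm
    rw [this]
    rfl

end Chain

/-! ### Valuation domains: measuring ideals by powers of an element -/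

namespace LengthFunction

variable {R : Type u} [CommRing R] [IsDomain R] (ℓ : LengthFunction R)

theorem idx_span_mul {x : R} (hx : x ≠ 0) (y : R) :
    ℓ.idx (Ideal.span {x * y}) = ℓ.idx (Ideal.span {x}) + ℓ.idx (Ideal.span {y}) := by
  rw [ℓ.idx_eq_colon_add _ x, add_comm]
  congr 2
  · rw [sup_eq_right, Ideal.span_singleton_le_span_singleton]
    exact dvd_mul_right x y
  · ext r
    rw [Submodule.mem_colon_singleton, smul_eq_mul, mul_comm r x, Ideal.mem_span_singleton,
      Ideal.mem_span_singleton, mul_dvd_mul_iff_left hx]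

theorem idx_span_pow {x : R} (hx : x ≠ 0) (n : ℕ) :
    ℓ.idx (Ideal.span {x ^ n}) = n * ℓ.idx (Ideal.span {x}) := by
  induction n with
  | zero => simp [ℓ.idx_top]
  | succ n ih => rw [pow_succ, idx_span_mul ℓ (pow_ne_zero n hx), ih]; push_cast; ring

theorem idx_le_of_pow_mem {I : Ideal R} {c : R} (hc : c ≠ 0) {n : ℕ} (h : c ^ n ∈ I) :
    ℓ.idx I ≤ n * ℓ.idx (Ideal.span {c}) := by
  rw [← idx_span_pow ℓ hc]
  exact ℓ.idx_anti ((Ideal.span_singleton_le_iff_mem I).2 h)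

end LengthFunction

section Valuation

open IsLocalRing

variable {V : Type u} [CommRing V] [IsDomain V] [ValuationRing V]

theorem le_span_singleton_of_notMem {I : Ideal V} {x : V} (hx : x ∉ I) : I ≤ Ideal.span {x} := by
  intro y hy
  rw [Ideal.mem_span_singleton]
  rcases ValuationRing.dvd_total x y with h | h
  · exact h
  · exact absurd (I.mem_of_dvd h hy) hx

theorem ideal_le_total (I J : Ideal V) : I ≤ J ∨ J ≤ I := by
  by_contra! h
  obtain ⟨x, hxI, hxJ⟩ := SetLike.not_le_iff_exists.1 h.1
  exact h.2 ((le_span_singleton_of_notMem hxJ).trans ((Ideal.span_singleton_le_iff_mem _).2 hxI))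

theorem Ideal.exists_pow_mem_boundary {R : Type u} [CommRing R] {I : Ideal R} (hI : I ≠ ⊤) {c : R}
    {k : ℕ} (h : c ^ k ∈ I) : ∃ n, c ^ n ∉ I ∧ c ^ (n + 1) ∈ I := by
  classical
  have hex : ∃ k, c ^ k ∈ I := ⟨k, h⟩
  have h0 : Nat.find hex ≠ 0 := by
    intro h0
    have := Nat.find_spec hex
    rw [h0, pow_zero] at this
    exact hI ((Ideal.eq_top_iff_one I).2 this)
  obtain ⟨n, hn⟩ := Nat.exists_eq_succ_of_ne_zero h0
  refine ⟨n, Nat.find_min hex (by omega), ?_⟩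
  have := Nat.find_spec hex
  rwa [hn] at this

theorem exists_maximalIdeal_eq_span (h : ¬ IsIdempotentElem (maximalIdeal V)) :
    ∃ π : V, π ≠ 0 ∧ maximalIdeal V = Ideal.span {π} := by
  have hlt : ¬ maximalIdeal V ≤ maximalIdeal V * maximalIdeal V :=
    fun hle => h (le_antisymm Ideal.mul_le_left hle)
  obtain ⟨π, hπ, hπ2⟩ := SetLike.not_le_iff_exists.1 hlt
  refine ⟨π, fun h0 => hπ2 (h0 ▸ zero_mem _), le_antisymm (fun y hy => ?_)
    ((Ideal.span_singleton_le_iff_mem _).2 hπ)⟩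
  rw [Ideal.mem_span_singleton]
  rcases ValuationRing.dvd_total π y with h | ⟨z, rfl⟩
  · exact h
  · by_cases hz : z ∈ maximalIdeal V
    · exact absurd (Ideal.mul_mem_mul hy hz) hπ2
    · rw [mem_maximalIdeal, mem_nonunits_iff, not_not] at hz
      obtain ⟨u, rfl⟩ := hz
      exact (Units.mul_right_dvd).2 dvd_rfl

theorem eq_span_pow_of_pow_mem {I : Ideal V} {π : V} (hπ : maximalIdeal V = Ideal.span {π}) {n : ℕ}
    (h : π ^ n ∉ I) (h' : π ^ (n + 1) ∈ I) : I = Ideal.span {π ^ (n + 1)} := by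
  refine le_antisymm (fun y hy => ?_) ((Ideal.span_singleton_le_iff_mem _).2 h')
  obtain ⟨z, rfl⟩ := Ideal.mem_span_singleton.1 (le_span_singleton_of_notMem h hy)
  have hz : z ∈ maximalIdeal V := by
    by_contra hz
    rw [mem_maximalIdeal, mem_nonunits_iff, not_not] at hz
    exact h ((Ideal.mul_unit_mem_iff_mem I hz).1 hy)
  rw [hπ, Ideal.mem_span_singleton] at hz
  rw [Ideal.mem_span_singleton, pow_succ]
  exact mul_dvd_mul_left _ hz

theorem exists_sq_dvd {a : V} (ha : a ∈ maximalIdeal V * maximalIdeal V) :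
    ∃ x ∈ maximalIdeal V, x ^ 2 ∣ a := by
  induction ha using Submodule.mul_induction_on' with
  | mem_mul_mem x hx y hy =>
    rcases ValuationRing.dvd_total x y with h | h
    · exact ⟨x, hx, by rw [sq]; exact mul_dvd_mul_left x h⟩
    · exact ⟨y, hy, by rw [sq]; exact mul_dvd_mul_right h y⟩
  | add a _ b _ iha ihb =>
    obtain ⟨x, hx, hxa⟩ := iha
    obtain ⟨y, hy, hyb⟩ := ihb
    rcases ValuationRing.dvd_total x y with h | h
    · exact ⟨x, hx, dvd_add hxa ((pow_dvd_pow_of_dvd h 2).trans hyb)⟩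
    · exact ⟨y, hy, dvd_add ((pow_dvd_pow_of_dvd h 2).trans hxa) hyb⟩

/-- When 𝔪 = 𝔪², each element of 𝔪 is divisible by the square of an element of 𝔪. Iterating on some
a in 𝔪 outside J gives c with c^(2^N) dividing a, and N < 2^N. -/
theorem exists_pow_notMem (hm : IsIdempotentElem (maximalIdeal V)) {J : Ideal V}
    (hJ : J < maximalIdeal V) (N : ℕ) : ∃ c ∈ maximalIdeal V, c ^ N ∉ J := by
  have key : ∀ (k : ℕ), ∀ a ∈ maximalIdeal V, ∃ c ∈ maximalIdeal V, c ^ (2 ^ k) ∣ a := by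
    intro k
    induction k with
    | zero => exact fun a ha => ⟨a, ha, by simp⟩
    | succ k ih =>
      intro a ha
      rw [← hm.eq] at ha
      obtain ⟨x, hx, hxa⟩ := exists_sq_dvd ha
      obtain ⟨c, hc, hcx⟩ := ih x hx
      refine ⟨c, hc, ?_⟩
      rw [pow_succ, pow_mul]
      exact (pow_dvd_pow_of_dvd hcx 2).trans hxa
  obtain ⟨a, ha, haJ⟩ := SetLike.exists_of_lt hJ
  obtain ⟨c, hc, hca⟩ := key N a ha
  exact ⟨c, hc, fun h => haJ (J.mem_of_dvd ((pow_dvd_pow c Nat.lt_two_pow_self.le).trans hca) h)⟩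

/-- The ratio (1 + 1/n)(1 + 1/k) tends to 1 as n and k grow. -/
theorem ENNReal.le_of_forall_nat_mul_le {a b : ℝ≥0∞}
    (h : ∀ N : ℕ, ∃ n k : ℕ, N ≤ n ∧ N ≤ k ∧
      (n : ℝ≥0∞) * k * a ≤ ((n : ℝ≥0∞) + 1) * ((k : ℝ≥0∞) + 1) * b) : a ≤ b := by
  by_cases hb : b = ⊤
  · simp [hb]
  lift b to ℝ≥0 using hb
  have ha : a ≠ ⊤ := by
    rintro rfl
    obtain ⟨n, k, hn, hk, h⟩ := h 1
    rw [ENNReal.mul_top (by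
      have : n * k ≠ 0 := Nat.mul_ne_zero (by omega) (by omega)
      exact_mod_cast this)] at h
    exact (ENNReal.mul_lt_top (ENNReal.mul_lt_top (by finiteness) (by finiteness))
      (by finiteness)).ne (top_le_iff.1 h)
  lift a to ℝ≥0 using ha
  rw [ENNReal.coe_le_coe]
  by_contra! hlt
  have hlt' : (b : ℝ) < a := hlt
  -- The 3 bounds `(N + 1) * (n + k + 1)` by `3 * (n * k)`. Combined with `n * k * (a - b) ≤ (n + k
  -- + 1) * b`, it yields `(N + 1) * (a - b) ≤ 3 * b`, which this choice of `N` contradicts.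
  obtain ⟨N, hN⟩ := exists_nat_gt (3 * (b : ℝ) / (a - b))
  rw [div_lt_iff₀ (by linarith)] at hN
  obtain ⟨n, k, hn, hk, h⟩ := h (N + 1)
  have h' : (n : ℝ) * k * a ≤ ((n : ℝ) + 1) * (k + 1) * b := by
    have : (n : ℝ≥0) * k * a ≤ ((n : ℝ≥0) + 1) * (k + 1) * b := by exact_mod_cast h
    exact_mod_cast this
  have hn' : (N : ℝ) + 1 ≤ n := by exact_mod_cast hn
  have hk' : (N : ℝ) + 1 ≤ k := by exact_mod_cast hk
  have hN0 : (0 : ℝ) ≤ N := Nat.cast_nonneg N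
  have hb0 : (0 : ℝ) ≤ b := b.2
  have e1 : ((N : ℝ) + 1) * n ≤ n * k := by nlinarith
  have e2 : ((N : ℝ) + 1) * k ≤ n * k := by nlinarith
  have e3 : ((N : ℝ) + 1) * 1 ≤ n * k := by nlinarith
  have e4 : ((N : ℝ) + 1) * (n + k + 1) ≤ 3 * (n * k) := by linarith
  have e5 : (n : ℝ) * k * (a - b) ≤ (n + k + 1) * b := by nlinarith
  have e6 : ((N : ℝ) + 1) * (n * k * (a - b)) ≤ 3 * (n * k) * b := by
    calc ((N : ℝ) + 1) * (n * k * (a - b)) ≤ ((N : ℝ) + 1) * ((n + k + 1) * b) := by gcongr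
      _ = ((N : ℝ) + 1) * (n + k + 1) * b := by ring
      _ ≤ 3 * (n * k) * b := by gcongr
  have hnk : (0 : ℝ) < n * k := by nlinarith
  have e7 : ((N : ℝ) + 1) * (a - b) ≤ 3 * b := by
    refine le_of_mul_le_mul_left ?_ hnk
    linarith
  linarith

namespace LengthFunction

theorem le_idx_of_pow_notMem (ℓ : LengthFunction V) {I : Ideal V} {c : V} {n : ℕ}
    (h : c ^ n ∉ I) : n * ℓ.idx (Ideal.span {c}) ≤ ℓ.idx I := by
  by_cases hc : c = 0
  · rcases eq_or_ne n 0 with rfl | hn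
    · simp
    · rw [hc, zero_pow hn] at h
      exact absurd I.zero_mem h
  rw [← idx_span_pow ℓ hc]
  exact ℓ.idx_anti (le_span_singleton_of_notMem h)

/-- If c^n ∉ I and c^(n+1) ∈ I, then ℓ(V/I) lies between n and n + 1 times ℓ(V/c). For idempotent 𝔪,
taking c smaller and smaller compares I with the test ideal a to any precision, with exponents that
do not depend on ℓ. For non-idempotent 𝔪, the ideal I is a power of 𝔪 = (π). -/
theorem idx_le_idx_of_radical {ℓ₁ ℓ₂ : LengthFunction V} {I : Ideal V} (hI : I ≤ maximalIdeal V)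
    (hrad : ∀ x ∈ maximalIdeal V, ∃ n, x ^ n ∈ I)
    (hm : ℓ₁.idx (maximalIdeal V) ≤ ℓ₂.idx (maximalIdeal V))
    (ha : I < maximalIdeal V → IsIdempotentElem (maximalIdeal V) →
      ∃ a < maximalIdeal V, (∀ x ∈ maximalIdeal V, ∃ n, x ^ n ∈ a) ∧ ℓ₁.idx a ≤ ℓ₂.idx a) :
    ℓ₁.idx I ≤ ℓ₂.idx I := by
  have hne : ∀ {J : Ideal V}, J ≤ maximalIdeal V → J ≠ ⊤ := fun h h' =>
    (maximalIdeal.isMaximal V).ne_top (top_le_iff.1 (h' ▸ h))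
  rcases hI.eq_or_lt with rfl | hlt
  · exact hm
  by_cases hid : IsIdempotentElem (maximalIdeal V)
  · obtain ⟨a, ham, harad, ha⟩ := ha hlt hid
    refine ENNReal.le_of_forall_nat_mul_le fun N => ?_
    have hJ : I ⊔ a < maximalIdeal V := by
      rcases ideal_le_total I a with h | h
      · rwa [sup_eq_right.2 h]
      · rwa [sup_eq_left.2 h]
    -- `c` is small with respect to `I` and `a` at once. The exponent `N + 1` makes `c` nonzero even
    -- when `N = 0`.
    obtain ⟨c, hc, hcJ⟩ := exists_pow_notMem hid hJ (N + 1)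
    have hc0 : c ≠ 0 := by
      rintro rfl
      rw [zero_pow (by omega)] at hcJ
      exact hcJ (zero_mem _)
    obtain ⟨_, hcI⟩ := hrad c hc
    obtain ⟨_, hca⟩ := harad c hc
    obtain ⟨n, hn, hn'⟩ := Ideal.exists_pow_mem_boundary (hne hI) hcI
    obtain ⟨k, hk, hk'⟩ := Ideal.exists_pow_mem_boundary (hne ham.le) hca
    refine ⟨n, k, ?_, ?_, ?_⟩
    · by_contra! hlt
      exact hcJ (le_sup_left (a := I) (I.pow_mem_of_pow_mem hn' (by omega)))
    · by_contra! hlt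
      exact hcJ (le_sup_right (b := a) (a.pow_mem_of_pow_mem hk' (by omega)))
    have e1 := ℓ₁.idx_le_of_pow_mem hc0 hn'
    have e2 := ℓ₂.le_idx_of_pow_notMem hn
    have e3 := ℓ₁.le_idx_of_pow_notMem hk
    have e4 := ℓ₂.idx_le_of_pow_mem hc0 hk'
    push_cast at e1 e4
    calc (n : ℝ≥0∞) * k * ℓ₁.idx I
        ≤ n * k * ((n + 1) * ℓ₁.idx (Ideal.span {c})) := by gcongr
      _ = n * (n + 1) * (k * ℓ₁.idx (Ideal.span {c})) := by ring
      _ ≤ n * (n + 1) * ((k + 1) * ℓ₂.idx (Ideal.span {c})) := by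
          exact mul_le_mul_right (e3.trans (ha.trans e4)) _
      _ = (n + 1) * (k + 1) * (n * ℓ₂.idx (Ideal.span {c})) := by ring
      _ ≤ (n + 1) * (k + 1) * ℓ₂.idx I := by gcongr
  · obtain ⟨π, hπ0, hπ⟩ := exists_maximalIdeal_eq_span hid
    obtain ⟨_, hk⟩ := hrad π (hπ ▸ Ideal.mem_span_singleton_self π)
    obtain ⟨n, hn, hn'⟩ := Ideal.exists_pow_mem_boundary (hne hI) hk
    rw [eq_span_pow_of_pow_mem hπ hn hn', idx_span_pow _ hπ0, idx_span_pow _ hπ0, ← hπ]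
    gcongr

/-- The elements x with x = 0 or ℓ(V/x) ≠ 0 form a prime ideal P, by additivity on products. If the
radical of J is not inside P, a power of a null element lies in J. If J = P, the first hypothesis
applies. Otherwise J ⊆ (y) for some y in P. The ideal K, meant to be the saturation of (y) at its
radical, then contradicts the definition of P: if P lies in that radical, K/(y) is null and so is
V/(y); if not, some z in P satisfies K ⊆ (z). -/
theorem idx_eq_zero_of_primes (ℓ : LengthFunction V) {J : Ideal V}
    (h₁ : ∀ p : Ideal V, p.IsPrime → J ≤ p → ℓ.idx p = 0)
    (h₂ : ∀ y : V, y ≠ 0 → ¬ IsUnit y → J ≤ (Ideal.span {y}).radical →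
      ∃ K : Ideal V, Ideal.span {y} ≤ K ∧ K ≤ (Ideal.span {y}).radical ∧ ℓ.idx K = 0 ∧
        ∀ x ∈ K, ∃ t ∉ (Ideal.span {y}).radical, t * x ∈ Ideal.span {y}) :
    ℓ.idx J = 0 := by
  let P : Ideal V :=
    { carrier := {x | x = 0 ∨ ℓ.idx (Ideal.span {x}) ≠ 0}
      zero_mem' := Or.inl rfl
      add_mem' := by
        have key : ∀ {a b : V}, a ∣ b → (a = 0 ∨ ℓ.idx (Ideal.span {a}) ≠ 0) →
            (a + b = 0 ∨ ℓ.idx (Ideal.span {a + b}) ≠ 0) := by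
          rintro a b hab (rfl | ha)
          · rw [zero_dvd_iff] at hab
            exact Or.inl (by rw [hab, add_zero])
          · refine Or.inr fun h0 => ha (le_antisymm (h0 ▸ ℓ.idx_anti ?_) zero_le)
            rw [Ideal.span_singleton_le_span_singleton]
            exact dvd_add dvd_rfl hab
        intro a b ha hb
        rcases ValuationRing.dvd_total a b with h | h
        · exact key h ha
        · rw [add_comm]
          exact key h hb
      smul_mem' := by
        rintro c x (rfl | hx)
        · exact Or.inl (smul_zero c)
        · refine Or.inr fun h0 => hx (le_antisymm (h0 ▸ ℓ.idx_anti ?_) zero_le)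
          rw [Ideal.span_singleton_le_span_singleton]
          exact dvd_mul_left x c }
  have hP : ∀ {x : V}, x ∈ P ↔ x = 0 ∨ ℓ.idx (Ideal.span {x}) ≠ 0 := Iff.rfl
  have hprime : P.IsPrime := by
    refine ⟨fun h => ?_, fun {x y} hxy => ?_⟩
    · rcases hP.1 ((Ideal.eq_top_iff_one P).1 h) with h | h
      · exact one_ne_zero h
      · rw [Ideal.span_singleton_one] at h
        exact h ℓ.idx_top
    · rcases eq_or_ne x 0 with hx | hx
      · exact Or.inl (Or.inl hx)
      rcases hP.1 hxy with h | h
      · exact Or.inr (Or.inl ((mul_eq_zero.1 h).resolve_left hx))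
      · rw [ℓ.idx_span_mul hx] at h
        by_cases h0 : ℓ.idx (Ideal.span {x}) = 0
        · rw [h0, zero_add] at h
          exact Or.inr (Or.inr h)
        · exact Or.inl (Or.inr h0)
  have hP0 : ∀ {x : V}, x ∉ P → x ≠ 0 ∧ ℓ.idx (Ideal.span {x}) = 0 := by
    intro x hx
    rw [hP] at hx
    push Not at hx
    exact hx
  by_cases h : J.radical ≤ P
  swap
  · obtain ⟨x, ⟨n, hxn⟩, hxP⟩ := SetLike.not_le_iff_exists.1 h
    obtain ⟨hx0, hx⟩ := hP0 hxP
    have := ℓ.idx_le_of_pow_mem hx0 hxn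
    rw [hx, mul_zero] at this
    exact le_antisymm this zero_le
  by_cases hPJ : P ≤ J
  · exact h₁ J (le_antisymm (Ideal.le_radical.trans h) hPJ ▸ hprime) le_rfl
  obtain ⟨y, hyP, hyJ⟩ := SetLike.not_le_iff_exists.1 hPJ
  have hy0 : y ≠ 0 := fun h => hyJ (h ▸ J.zero_mem)
  have hyu : ¬ IsUnit y := fun hu => hprime.ne_top (Ideal.eq_top_of_isUnit_mem P hyP hu)
  obtain ⟨K, hyK, hKy, hK, hKt⟩ := h₂ y hy0 hyu
    ((le_span_singleton_of_notMem hyJ).trans Ideal.le_radical)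
  exfalso
  by_cases hle : P ≤ (Ideal.span {y}).radical
  · refine (hP.1 hyP).elim hy0 fun hne => hne ?_
    rw [ℓ.idx_eq_of_le hyK, hK]
    intro x hx
    obtain ⟨t, ht, htx⟩ := hKt x hx
    obtain ⟨_, ht0⟩ := hP0 fun h => ht (hle h)
    refine le_antisymm (ht0 ▸ ℓ.idx_anti ?_) zero_le
    rw [Ideal.span_singleton_le_iff_mem, Submodule.mem_colon_singleton]
    exact htx
  · obtain ⟨z, hzP, hz⟩ := SetLike.not_le_iff_exists.1 hle
    refine (hP.1 hzP).elim (fun h => hz (h ▸ zero_mem _)) fun hne => hne ?_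
    exact le_antisymm (hK ▸ ℓ.idx_anti (hKy.trans (le_span_singleton_of_notMem hz))) zero_le

end LengthFunction

end Valuation

/-! ### Localization: restriction to S⁻¹D and pullback from it -/

namespace LengthFunction

variable {D : Type u} [CommRing D] (ℓ : LengthFunction D) (S : Submonoid D)

/-- A finitely generated submodule of M has a common denominator in S, and multiplication by it
embeds that submodule into the image of N. -/
theorem toFun_eq_of_denominators {M N : Type u} [AddCommGroup M] [Module D M] [AddCommGroup N]
    [Module D N] (f : N →ₗ[D] M) (hf : Function.Injective f)
    (hS : ∀ s ∈ S, ∀ x : M, s • x = 0 → x = 0) (h : ∀ x : M, ∃ s ∈ S, s • x ∈ LinearMap.range f) :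
    ℓ.toFun M = ℓ.toFun N := by
  classical
  refine le_antisymm ?_ (ℓ.le_of_injective f hf)
  rw [ℓ.upperContinuous M]
  refine iSup₂_le fun F hF => ?_
  obtain ⟨t, rfl⟩ := hF
  have key : ∃ s ∈ S, ∀ x ∈ Submodule.span D (t : Set M), s • x ∈ LinearMap.range f := by
    suffices ∃ s ∈ S, ∀ x ∈ t, s • x ∈ LinearMap.range f by
      obtain ⟨s, hs, h⟩ := this
      refine ⟨s, hs, fun x hx => ?_⟩
      exact (Submodule.span_le (p := (LinearMap.range f).comap (LinearMap.lsmul D M s))).2 h hx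
    induction t using Finset.induction_on with
    | empty => exact ⟨1, S.one_mem, by simp⟩
    | insert a t _ ih =>
      obtain ⟨s, hs, hst⟩ := ih
      obtain ⟨s', hs', hsa⟩ := h a
      refine ⟨s * s', S.mul_mem hs hs', fun x hx => ?_⟩
      rcases Finset.mem_insert.1 hx with rfl | hx
      · rw [mul_smul]
        exact Submodule.smul_mem _ _ hsa
      · rw [mul_comm, mul_smul]
        exact Submodule.smul_mem _ _ (hst x hx)
  obtain ⟨s, hs, hst⟩ := key
  rw [ℓ.congr (LinearEquiv.ofInjective f hf)]
  refine ℓ.le_of_injective (((LinearMap.lsmul D M s).comp (Submodule.subtype _)).codRestrict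
    (LinearMap.range f) fun x => hst x x.2) ?_
  rw [← LinearMap.ker_eq_bot, LinearMap.ker_eq_bot']
  intro x hx
  exact Subtype.ext (hS s hs x (congrArg Subtype.val hx))

theorem idx_restrictScalars_localization (T : Type u) [CommRing T] [Algebra D T]
    [IsLocalization S T] (J : Ideal T) : (ℓ.restrictScalars T).idx J = ℓ.idx (J.under D) := by
  rw [idx_restrictScalars]
  let g : D →ₗ[D] T ⧸ J := (J.mkQ.restrictScalars D).comp (Algebra.linearMap D T)
  have hg : LinearMap.ker g = J.under D := by
    ext x
    exact Submodule.Quotient.mk_eq_zero J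
  refine ℓ.toFun_eq_of_denominators S ((J.under D).liftQ g hg.ge) ?_ ?_ ?_
  · rw [← LinearMap.ker_eq_bot, Submodule.ker_liftQ_eq_bot _ _ _ hg.le]
  · intro s hs x hx
    obtain ⟨x, rfl⟩ := J.mkQ_surjective x
    have hx' : s • x ∈ J := (Submodule.Quotient.mk_eq_zero J).1 hx
    refine (Submodule.Quotient.mk_eq_zero J).2 ?_
    rw [Algebra.smul_def] at hx'
    exact (Ideal.unit_mul_mem_iff_mem J (IsLocalization.map_units T ⟨s, hs⟩)).1 hx'
  · intro x
    obtain ⟨x, rfl⟩ := J.mkQ_surjective x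
    obtain ⟨r, s, rfl⟩ := IsLocalization.exists_mk'_eq S x
    refine ⟨s, s.2, ?_⟩
    rw [Submodule.range_liftQ]
    refine ⟨r, ?_⟩
    change J.mkQ (algebraMap D T r) = J.mkQ ((s : D) • _)
    rw [Algebra.smul_def, IsLocalization.mk'_spec']

variable {S}

/-- The length function `M ↦ ℓ (S⁻¹M)`. -/
noncomputable def pullback (ℓ : LengthFunction (Localization S)) : LengthFunction D where
  toFun M _ _ := ℓ.toFun (LocalizedModule S M)
  map_zero M _ _ h := ℓ.map_zero _ ⟨fun a b => by
    induction a with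
    | _ m s =>
    induction b with
    | _ m' s' => rw [LocalizedModule.mk_eq]; exact ⟨1, Subsingleton.elim _ _⟩⟩
  additive M₁ M₂ M₃ _ _ _ _ _ _ f g hf hfg hg :=
    ℓ.additive _ _ _ (LocalizedModule.map S f) (LocalizedModule.map S g)
      (LocalizedModule.map_injective S f hf) (LocalizedModule.map_exact S f g hfg)
      (LocalizedModule.map_surjective S g hg)
  upperContinuous M _ _ := by
    apply le_antisymm
    · rw [ℓ.upperContinuous (LocalizedModule S M)]
      refine iSup₂_le fun F hF => ?_
      obtain ⟨t, rfl⟩ := hF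
      classical
      choose num den hnd using fun x : LocalizedModule S M =>
        show ∃ (m : M) (s : S), LocalizedModule.mk m s = x by
          induction x with
          | _ m s => exact ⟨m, s, rfl⟩
      let N : Submodule D M := Submodule.span D (t.image num : Finset M)
      refine le_iSup₂_of_le N ⟨t.image num, rfl⟩ ?_
      rw [ℓ.congr (LinearEquiv.ofInjective (LocalizedModule.map S N.subtype)
        (LocalizedModule.map_injective S _ N.injective_subtype))]
      refine ℓ.mono (Submodule.span_le.2 fun x hx => ?_)
      refine ⟨LocalizedModule.mk ⟨num x, Submodule.subset_span ?_⟩ (den x), ?_⟩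
      · exact Finset.mem_coe.2 (Finset.mem_image_of_mem num hx)
      · rw [LocalizedModule.map_mk]
        exact hnd x
    · exact iSup₂_le fun F _ => ℓ.le_of_injective (LocalizedModule.map S F.subtype)
        (LocalizedModule.map_injective S _ F.injective_subtype)

theorem idx_pullback (ℓ : LengthFunction (Localization S)) (I : Ideal D) :
    ℓ.pullback.idx I = ℓ.idx (I.map (algebraMap D (Localization S))) := by
  let e : LocalizedModule S (D ⧸ I) := LocalizedModule.mk (Submodule.mkQ I (1 : D)) 1
  let g : Localization S →ₗ[Localization S] LocalizedModule S (D ⧸ I) :=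
    LinearMap.toSpanSingleton _ _ e
  have hg : ∀ (r : D) (s : S), g (Localization.mk r s) = LocalizedModule.mk (Submodule.mkQ I r) s := by
    intro r s
    change Localization.mk r s • e = _
    rw [show e = LocalizedModule.mk (Submodule.mkQ I (1 : D)) 1 from rfl, LocalizedModule.mk_smul_mk, mul_one, ← map_smul, smul_eq_mul, mul_one]
  have hsurj : Function.Surjective g := by
    intro x
    induction x with
    | _ m s =>
    obtain ⟨r, rfl⟩ := I.mkQ_surjective m
    exact ⟨_, hg r s⟩
  have hker : LinearMap.ker g = I.map (algebraMap D (Localization S)) := by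
    ext x
    obtain ⟨r, s, rfl⟩ := IsLocalization.exists_mk'_eq S x
    rw [LinearMap.mem_ker, IsLocalization.mk'_mem_map_algebraMap_iff, ← Localization.mk_eq_mk', hg,
      ← LocalizedModule.zero_mk 1, LocalizedModule.mk_eq]
    simp only [smul_zero, one_smul]
    constructor
    · rintro ⟨u, hu⟩
      exact ⟨u, u.2, (Submodule.Quotient.mk_eq_zero I).1 hu⟩
    · rintro ⟨u, hu, h⟩
      exact ⟨⟨u, hu⟩, (Submodule.Quotient.mk_eq_zero I).2 h⟩
  have := ℓ.congr (g.quotKerEquivOfSurjective hsurj)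
  rw [hker] at this
  exact this.symm

end LengthFunction

theorem Ideal.mem_under_map_atPrime {D : Type u} [CommRing D] (P : Ideal D) [P.IsPrime]
    (I : Ideal D) (x : D) :
    x ∈ (I.map (algebraMap D (Localization.AtPrime P))).under D ↔ ∃ t ∉ P, t * x ∈ I :=
  IsLocalization.algebraMap_mem_map_algebraMap_iff P.primeCompl (Localization.AtPrime P) I x

/-! ### Primes of a Prüfer domain: saturation, branched and idempotent primes -/

section

open IsLocalRing

namespace PrimeSpectrum

variable {D : Type u} [CommRing D]

/-- The ideal `I D_P ∩ D`. -/
noncomputable def sat (P : PrimeSpectrum D) (I : Ideal D) : Ideal D :=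
  (I.map (algebraMap D (Localization.AtPrime P.asIdeal))).under D

theorem mem_sat {P : PrimeSpectrum D} {I : Ideal D} {x : D} :
    x ∈ P.sat I ↔ ∃ t ∉ P.asIdeal, t * x ∈ I :=
  Ideal.mem_under_map_atPrime P.asIdeal I x

theorem le_sat (P : PrimeSpectrum D) (I : Ideal D) : I ≤ P.sat I := Ideal.le_comap_map

theorem sat_mono (P : PrimeSpectrum D) {I J : Ideal D} (h : I ≤ J) : P.sat I ≤ P.sat J :=
  Ideal.comap_mono (Ideal.map_mono h)

theorem sat_of_le {P Q : PrimeSpectrum D} (h : Q ≤ P) : P.sat Q.asIdeal = Q.asIdeal := by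
  refine le_antisymm (fun x hx => ?_) (P.le_sat _)
  obtain ⟨t, ht, htx⟩ := mem_sat.1 hx
  exact (Q.2.mem_or_mem htx).resolve_left fun htQ => ht (h htQ)

theorem sat_le {P : PrimeSpectrum D} {I : Ideal D} (h : I ≤ P.asIdeal) : P.sat I ≤ P.asIdeal :=
  (P.sat_mono h).trans (sat_of_le le_rfl).le

/-- There is a largest prime ideal properly contained in `P`. -/
def Branched (P : PrimeSpectrum D) : Prop := ∃ Q, IsGreatest (Set.Iio P) Q

/-- `P` is branched and idempotent. -/
def BranchedIdempotent (P : PrimeSpectrum D) : Prop :=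
  P.Branched ∧ IsIdempotentElem P.asIdeal

theorem Branched.exists_mem {P : PrimeSpectrum D} (h : P.Branched) :
    ∃ a ∈ P.asIdeal, ∀ Q < P, a ∉ Q.asIdeal := by
  obtain ⟨Q, hQ, hle⟩ := h
  obtain ⟨a, haP, haQ⟩ := SetLike.exists_of_lt (show Q.asIdeal < P.asIdeal from hQ)
  exact ⟨a, haP, fun Q' hQ' haQ' => haQ (hle hQ' haQ')⟩

open Classical in
/-- An element of `P` which lies in no smaller prime ideal, if there is one. -/
noncomputable def pivot (P : PrimeSpectrum D) : D :=
  if h : P.Branched then h.exists_mem.choose else 0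

theorem Branched.pivot_mem {P : PrimeSpectrum D} (h : P.Branched) : P.pivot ∈ P.asIdeal := by
  rw [pivot, dif_pos h]
  exact h.exists_mem.choose_spec.1

theorem Branched.pivot_notMem {P : PrimeSpectrum D} (h : P.Branched) {Q : PrimeSpectrum D}
    (hQ : Q < P) : P.pivot ∉ Q.asIdeal := by
  rw [pivot, dif_pos h]
  exact h.exists_mem.choose_spec.2 Q hQ

/-- `P` is the smallest prime ideal which contains `I` and is contained in `P`. -/
def IsMinimalOver (P : PrimeSpectrum D) (I : Ideal D) : Prop :=
  I ≤ P.asIdeal ∧ ∀ Q ≤ P, I ≤ Q.asIdeal → P ≤ Q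

/-- A prime of D_P containing I contracts to a prime between I and P, hence to P. So the radical of
I D_P is the maximal ideal. -/
theorem IsMinimalOver.exists_pow_mem {P : PrimeSpectrum D} {I : Ideal D} (h : P.IsMinimalOver I)
    (x : Localization.AtPrime P.asIdeal) (hx : x ∈ maximalIdeal (Localization.AtPrime P.asIdeal)) :
    ∃ n, x ^ n ∈ I.map (algebraMap D (Localization.AtPrime P.asIdeal)) := by
  change x ∈ Ideal.radical _
  rw [Ideal.radical_eq_sInf, Ideal.mem_sInf]
  rintro q ⟨hIq, hq⟩
  have hle : q.under D ≤ P.asIdeal := by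
    exact (Ideal.comap_mono (le_maximalIdeal hq.ne_top)).trans
      (Localization.AtPrime.under_maximalIdeal (I := P.asIdeal)).le
  have hPq := h.2 ⟨q.under D, inferInstance⟩ hle (Ideal.map_le_iff_le_comap.1 hIq)
  have : maximalIdeal (Localization.AtPrime P.asIdeal) ≤ q := by
    rw [← Localization.AtPrime.map_eq_maximalIdeal]
    exact Ideal.map_le_iff_le_comap.2 hPq
  exact this hx

theorem Branched.isMinimalOver_pivot {P : PrimeSpectrum D} (h : P.Branched) :
    P.IsMinimalOver (Ideal.span {P.pivot}) := by
  refine ⟨(Ideal.span_singleton_le_iff_mem _).2 h.pivot_mem, fun Q hQ hpQ => ?_⟩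
  rcases hQ.eq_or_lt with rfl | hlt
  · exact le_rfl
  · exact absurd ((Ideal.span_singleton_le_iff_mem _).1 hpQ) (h.pivot_notMem hlt)

theorem exists_union {C : Set (PrimeSpectrum D)} (hne : C.Nonempty) (hdir : DirectedOn (· ≤ ·) C) :
    ∃ Q : PrimeSpectrum D, ∀ x, x ∈ Q.asIdeal ↔ ∃ P ∈ C, x ∈ P.asIdeal := by
  have hmem : ∀ {x : D}, x ∈ sSup (asIdeal '' C) ↔ ∃ P ∈ C, x ∈ P.asIdeal := by
    intro x
    rw [Submodule.mem_sSup_of_directed (hne.image _)]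
    · simp
    · rintro _ ⟨P, hP, rfl⟩ _ ⟨Q, hQ, rfl⟩
      obtain ⟨M, hM, h₁, h₂⟩ := hdir P hP Q hQ
      exact ⟨_, ⟨M, hM, rfl⟩, h₁, h₂⟩
  refine ⟨⟨sSup (asIdeal '' C), fun htop => ?_, fun {x z} hxz => ?_⟩, fun x => hmem⟩
  · obtain ⟨Q, _, h1⟩ := hmem.1 ((Ideal.eq_top_iff_one _).1 htop)
    exact Q.2.ne_top ((Ideal.eq_top_iff_one _).2 h1)
  · obtain ⟨Q, hQ, hq⟩ := hmem.1 hxz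
    exact (Q.2.mem_or_mem hq).imp (fun h => hmem.2 ⟨Q, hQ, h⟩) fun h => hmem.2 ⟨Q, hQ, h⟩

theorem map_le_maximalIdeal {P : PrimeSpectrum D} {I : Ideal D} (h : I ≤ P.asIdeal) :
    I.map (algebraMap D (Localization.AtPrime P.asIdeal)) ≤
      maximalIdeal (Localization.AtPrime P.asIdeal) := by
  rw [← Localization.AtPrime.map_eq_maximalIdeal]
  exact Ideal.map_mono h

end PrimeSpectrum

namespace IsPruferDomain

variable {D : Type u} [CommRing D] [IsDomain D] (hD : IsPruferDomain D)
include hD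

theorem exists_dvd (P : PrimeSpectrum D) (x y : D) :
    (∃ t ∉ P.asIdeal, x ∣ t * y) ∨ ∃ t ∉ P.asIdeal, y ∣ t * x := by
  have := hD P
  have key : ∀ a b : D, algebraMap D (Localization.AtPrime P.asIdeal) a ∣
      algebraMap D (Localization.AtPrime P.asIdeal) b → ∃ t ∉ P.asIdeal, a ∣ t * b := by
    intro a b h
    rw [← Ideal.mem_span_singleton, ← Set.image_singleton, ← Ideal.map_span] at h
    obtain ⟨t, ht, h⟩ := PrimeSpectrum.mem_sat.1 h
    exact ⟨t, ht, Ideal.mem_span_singleton.1 h⟩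
  exact (ValuationRing.dvd_total _ _).imp (key x y) (key y x)

theorem le_total_of_le {P Q M : PrimeSpectrum D} (hP : P ≤ M) (hQ : Q ≤ M) : P ≤ Q ∨ Q ≤ P := by
  by_contra! h
  obtain ⟨x, hxP, hxQ⟩ := SetLike.not_le_iff_exists.1 (show ¬ P.asIdeal ≤ Q.asIdeal from h.1)
  obtain ⟨y, hyQ, hyP⟩ := SetLike.not_le_iff_exists.1 (show ¬ Q.asIdeal ≤ P.asIdeal from h.2)
  rcases hD.exists_dvd M x y with ⟨t, ht, h⟩ | ⟨t, ht, h⟩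
  · exact (P.2.mem_or_mem (P.asIdeal.mem_of_dvd h hxP)).elim (fun h => ht (hP h)) hyP
  · exact (Q.2.mem_or_mem (Q.asIdeal.mem_of_dvd h hyQ)).elim (fun h => ht (hQ h)) hxQ

theorem sup_eq_top {P Q : PrimeSpectrum D} (h : ¬ P ≤ Q) (h' : ¬ Q ≤ P) :
    P.asIdeal ⊔ Q.asIdeal = ⊤ := by
  by_contra hne
  obtain ⟨M, hM, hle⟩ := Ideal.exists_le_maximal _ hne
  exact (hD.le_total_of_le (M := ⟨M, hM.isPrime⟩) (le_sup_left.trans hle)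
    (le_sup_right.trans hle)).elim h h'

/-- The primes strictly below P form a chain. Their union is a prime that misses y, so it is the
largest of them. -/
theorem branched_of_mem {P : PrimeSpectrum D} {y : D} (hy0 : y ≠ 0) (hy : y ∈ P.asIdeal)
    (h : ∀ Q < P, y ∉ Q.asIdeal) : P.Branched := by
  have hlt : (⊥ : PrimeSpectrum D) < P := by
    refine lt_of_le_of_ne bot_le ?_
    rintro rfl
    exact hy0 hy
  obtain ⟨Q, hQ⟩ := PrimeSpectrum.exists_union (C := Set.Iio P) ⟨_, hlt⟩ fun Q₁ h₁ Q₂ h₂ =>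
    (hD.le_total_of_le (le_of_lt h₁) (le_of_lt h₂)).elim (fun h => ⟨Q₂, h₂, h, le_rfl⟩)
      fun h => ⟨Q₁, h₁, le_rfl, h⟩
  refine ⟨Q, Set.mem_Iio.2 (lt_of_le_of_ne (fun x hx => ?_) ?_), fun Q' hQ' x hx => (hQ x).2
    ⟨Q', hQ', hx⟩⟩
  · obtain ⟨Q', hQ', hx⟩ := (hQ x).1 hx
    exact (show Q' ≤ P from le_of_lt hQ') hx
  · rintro rfl
    obtain ⟨Q', hQ', hx⟩ := (hQ y).1 hy
    exact h Q' hQ' hx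

/-- An element r of P outside I D_P generates an ideal of the valuation ring D_P that contains I. A
prime Q < P containing r would then contain I, against minimality. -/
theorem branched_of_isMinimalOver {P : PrimeSpectrum D} {I : Ideal D} (h : P.IsMinimalOver I)
    (hlt : I.map (algebraMap D (Localization.AtPrime P.asIdeal)) <
      maximalIdeal (Localization.AtPrime P.asIdeal)) : P.Branched := by
  have := hD P
  obtain ⟨x, hx, hxI⟩ := SetLike.exists_of_lt hlt
  obtain ⟨r, s, rfl⟩ := IsLocalization.exists_mk'_eq P.asIdeal.primeCompl x
  rw [IsLocalization.mk'_mem_map_algebraMap_iff] at hxI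
  have hrP : r ∈ P.asIdeal :=
    (Localization.AtPrime.under_maximalIdeal (I := P.asIdeal)).le
      (IsLocalization.mk'_mem_iff.1 hx)
  refine hD.branched_of_mem (y := r) ?_ hrP fun Q hQ hrQ => ?_
  · rintro rfl
    exact hxI ⟨1, one_mem _, by simp⟩
  · refine not_le_of_gt hQ (h.2 Q hQ.le fun y hy => ?_)
    rcases hD.exists_dvd P r y with ⟨t, ht, htr⟩ | ⟨t, ht, htr⟩
    · exact (Q.2.mem_or_mem (Q.asIdeal.mem_of_dvd htr hrQ)).resolve_left fun htQ => ht (hQ.le htQ)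
    · exact absurd ⟨t, ht, I.mem_of_dvd htr hy⟩ hxI

/-- The substantial direction passes from D_P to D. For x in P outside P², take a maximal ideal M
above P² : x; it contains P. Some t ∉ P has tx ∈ P². In D_M such a t divides every element of P with
quotient in P, so it can be cancelled at the cost of a factor u ∉ M. Then ux ∈ P², which is absurd.
-/
theorem isIdempotentElem_maximalIdeal_iff (P : PrimeSpectrum D) :
    IsIdempotentElem (maximalIdeal (Localization.AtPrime P.asIdeal)) ↔
      IsIdempotentElem P.asIdeal := by
  constructor
  · intro h
    refine le_antisymm Ideal.mul_le_left fun x hx => ?_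
    by_contra hx2
    have hne : (P.asIdeal * P.asIdeal).colon {x} ≠ ⊤ := by
      intro htop
      have := (Ideal.eq_top_iff_one _).1 htop
      rw [Submodule.mem_colon_singleton, one_smul] at this
      exact hx2 this
    obtain ⟨M, hM, hle⟩ := Ideal.exists_le_maximal _ hne
    have hPM : P.asIdeal ≤ M := fun p hp => hle (by
      rw [Submodule.mem_colon_singleton]
      exact Ideal.mul_mem_mul hp hx)
    have hxP : x ∈ P.sat (P.asIdeal * P.asIdeal) := by
      change algebraMap D (Localization.AtPrime P.asIdeal) x ∈ Ideal.map _ _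
      rw [Ideal.map_mul, Localization.AtPrime.map_eq_maximalIdeal, h.eq,
        ← Localization.AtPrime.map_eq_maximalIdeal]
      exact Ideal.mem_map_of_mem _ hx
    obtain ⟨t, ht, htx⟩ := PrimeSpectrum.mem_sat.1 hxP
    have key : ∀ z ∈ P.asIdeal * P.asIdeal, ∃ u ∉ M, ∃ z' ∈ P.asIdeal * P.asIdeal,
        u * z = t * z' := by
      intro z hz
      induction hz using Submodule.mul_induction_on' with
      | mem_mul_mem p hp q hq =>
        rcases hD.exists_dvd ⟨M, hM.isPrime⟩ t p with ⟨u, hu, r, hr⟩ | ⟨u, hu, hr⟩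
        · have hrP : r ∈ P.asIdeal := by
            refine (P.2.mem_or_mem (x := t) (y := r) ?_).resolve_left ht
            rw [← hr]
            exact P.asIdeal.mul_mem_left u hp
          exact ⟨u, hu, r * q, Ideal.mul_mem_mul hrP hq, by rw [← mul_assoc, hr, mul_assoc]⟩
        · exact absurd ((P.2.mem_or_mem (P.asIdeal.mem_of_dvd hr hp)).resolve_right ht)
            fun h => hu (hPM h)
      | add a _ b _ iha ihb =>
        obtain ⟨u, hu, a', ha', hua⟩ := iha
        obtain ⟨w, hw, b', hb', hwb⟩ := ihb
        refine ⟨u * w, fun h => (hM.isPrime.mem_or_mem h).elim hu hw, w * a' + u * b',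
          add_mem (Ideal.mul_mem_left _ _ ha') (Ideal.mul_mem_left _ _ hb'), ?_⟩
        linear_combination w * hua + u * hwb
    obtain ⟨u, hu, z', hz', h⟩ := key _ htx
    have ht0 : t ≠ 0 := fun h0 => ht (h0 ▸ zero_mem _)
    refine hu (hle ?_)
    rw [Submodule.mem_colon_singleton, smul_eq_mul]
    have : u * x = z' := mul_left_cancel₀ ht0 (by linear_combination h)
    rwa [this]
  · intro h
    rw [← Localization.AtPrime.map_eq_maximalIdeal]
    change _ * _ = _
    rw [← Ideal.map_mul, h.eq]

omit [IsDomain D] hD in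
theorem _root_.IsIdempotentElem.eq_zero_of_maximalIdeal_eq_span {V : Type u} [CommRing V]
    [IsDomain V] [IsLocalRing V] {a : V} (h : IsIdempotentElem (maximalIdeal V))
    (ha : maximalIdeal V = Ideal.span {a}) : a = 0 := by
  have hmem : a ∈ maximalIdeal V := ha ▸ Ideal.mem_span_singleton_self a
  rw [ha] at h
  have : a ∈ Ideal.span {a} * Ideal.span {a} := by
    rw [h.eq]
    exact Ideal.mem_span_singleton_self a
  rw [Ideal.span_singleton_mul_span_singleton, Ideal.mem_span_singleton] at this
  obtain ⟨c, hc⟩ := this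
  by_contra h0
  have hu : a * c = 1 := mul_left_cancel₀ h0 (by linear_combination -hc)
  exact (mem_nonunits_iff.1 ((mem_maximalIdeal a).1 hmem)) (.of_mul_eq_one c hu)

/-- Equality would make an idempotent maximal ideal principal, hence zero, while the pivot is
nonzero. -/
theorem map_pivot_lt {P : PrimeSpectrum D} (h : P.BranchedIdempotent) :
    (Ideal.span {P.pivot}).map (algebraMap D (Localization.AtPrime P.asIdeal)) <
      maximalIdeal (Localization.AtPrime P.asIdeal) := by
  refine lt_of_le_of_ne (PrimeSpectrum.map_le_maximalIdeal h.1.isMinimalOver_pivot.1) fun heq => ?_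
  rw [Ideal.map_span, Set.image_singleton] at heq
  have h0 := ((hD.isIdempotentElem_maximalIdeal_iff P).2 h.2).eq_zero_of_maximalIdeal_eq_span
    heq.symm
  rw [IsLocalization.to_map_eq_zero_iff (M := P.asIdeal.primeCompl) _
    P.asIdeal.primeCompl_le_nonZeroDivisors] at h0
  obtain ⟨Q, hQ, _⟩ := h.1
  exact h.1.pivot_notMem hQ (h0 ▸ zero_mem _)

end IsPruferDomain

end

/-! ### Residue lengths and slopes; vanishing in a single localization -/

section

open IsLocalRing PrimeSpectrum

namespace LengthFunction

section Data

variable {D : Type u} [CommRing D] (ℓ : LengthFunction D) (P : PrimeSpectrum D)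

/-- The length of the residue field at `P`. -/
noncomputable def residueLength : ℝ≥0∞ := ℓ.idx P.asIdeal

open Classical in
/-- The length of `D_P / a D_P`, where `a` is an element of `P` lying in no smaller prime, if `P` is
branched and idempotent, and the length of the residue field at `P` otherwise. -/
noncomputable def slope : ℝ≥0∞ :=
  if P.BranchedIdempotent then ℓ.idx (P.sat (Ideal.span {P.pivot})) else ℓ.residueLength P

/-- The length function induced on the localization at `P`. -/
noncomputable abbrev atPrime : LengthFunction (Localization.AtPrime P.asIdeal) :=
  ℓ.restrictScalars (Localization.AtPrime P.asIdeal)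

theorem idx_atPrime (J : Ideal (Localization.AtPrime P.asIdeal)) :
    (ℓ.atPrime P).idx J = ℓ.idx (J.under D) :=
  ℓ.idx_restrictScalars_localization P.asIdeal.primeCompl _ J

theorem idx_atPrime_map (I : Ideal D) :
    (ℓ.atPrime P).idx (I.map (algebraMap D (Localization.AtPrime P.asIdeal))) = ℓ.idx (P.sat I) :=
  ℓ.idx_atPrime P _

theorem idx_atPrime_maximalIdeal :
    (ℓ.atPrime P).idx (maximalIdeal (Localization.AtPrime P.asIdeal)) = ℓ.residueLength P := by
  rw [idx_atPrime, Localization.AtPrime.under_maximalIdeal]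
  rfl

variable {ℓ P}

theorem residueLength_mono {ℓ' : LengthFunction D} (h : ℓ ≤ ℓ') :
    ℓ.residueLength P ≤ ℓ'.residueLength P :=
  le_iff_idx.1 h _

theorem slope_mono {ℓ' : LengthFunction D} (h : ℓ ≤ ℓ') : ℓ.slope P ≤ ℓ'.slope P := by
  unfold slope
  split_ifs
  · exact le_iff_idx.1 h _
  · exact residueLength_mono h

theorem residueLength_le_slope : ℓ.residueLength P ≤ ℓ.slope P := by
  unfold slope
  split_ifs with h
  · exact ℓ.idx_anti (sat_le h.1.isMinimalOver_pivot.1)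
  · exact le_rfl

end Data

variable {D : Type u} [CommRing D] [IsDomain D]

section Prufer

variable (hD : IsPruferDomain D)
include hD

theorem idx_sat_le {ℓ₁ ℓ₂ : LengthFunction D} {P : PrimeSpectrum D} {I : Ideal D}
    (hI : P.IsMinimalOver I) (hr : ℓ₁.residueLength P ≤ ℓ₂.residueLength P)
    (hs : ℓ₁.slope P ≤ ℓ₂.slope P) : ℓ₁.idx (P.sat I) ≤ ℓ₂.idx (P.sat I) := by
  have := hD P
  rw [← idx_atPrime_map, ← idx_atPrime_map]
  refine idx_le_idx_of_radical (map_le_maximalIdeal hI.1) hI.exists_pow_mem ?_ fun hlt hid => ?_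
  · rwa [idx_atPrime_maximalIdeal, idx_atPrime_maximalIdeal]
  · have hb : P.BranchedIdempotent :=
      ⟨hD.branched_of_isMinimalOver hI hlt, (hD.isIdempotentElem_maximalIdeal_iff P).1 hid⟩
    refine ⟨_, hD.map_pivot_lt hb, hb.1.isMinimalOver_pivot.exists_pow_mem, ?_⟩
    rw [idx_atPrime_map, idx_atPrime_map]
    rwa [slope, slope, if_pos hb, if_pos hb] at hs

theorem idx_sat_eq_zero {ℓ : LengthFunction D} {P : PrimeSpectrum D} {I : Ideal D}
    (hI : P.IsMinimalOver I) (hs : ℓ.slope P = 0) : ℓ.idx (P.sat I) = 0 := by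
  have h := idx_sat_le hD (ℓ₂ := 0) hI (residueLength_le_slope.trans (hs.le.trans zero_le))
    (hs.le.trans zero_le)
  exact le_antisymm h zero_le

/-- By idempotency some c in PD_P has c^N outside the ideal of the pivot. Then σ(P) ≥ N ℓ(D_P/c) ≥ N
ρ(P), for every N. -/
theorem slope_eq_top {ℓ : LengthFunction D} {P : PrimeSpectrum D} (hb : P.BranchedIdempotent)
    (h : ℓ.residueLength P ≠ 0) : ℓ.slope P = ⊤ := by
  have := hD P
  rw [slope, if_pos hb, ← idx_atPrime_map]
  by_contra hne
  obtain ⟨N, hN⟩ := ENNReal.exists_nat_mul_gt h hne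
  obtain ⟨c, hc, hcN⟩ := exists_pow_notMem ((hD.isIdempotentElem_maximalIdeal_iff P).2 hb.2)
    (hD.map_pivot_lt hb) N
  refine absurd hN (not_lt.2 (le_trans ?_ ((ℓ.atPrime P).le_idx_of_pow_notMem hcN)))
  rw [← idx_atPrime_maximalIdeal]
  gcongr
  exact (ℓ.atPrime P).idx_anti ((Ideal.span_singleton_le_iff_mem _).2 hc)

/-- Some c in D_P outside Q has ℓ(D_P/c) ≠ 0. No power of c lies in Q, so ρ(Q) ≥ N ℓ(D_P/c) for
every N. -/
theorem residueLength_eq_top {ℓ : LengthFunction D} {P Q : PrimeSpectrum D} (hlt : Q < P)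
    (h : ℓ.slope P ≠ 0) : ℓ.residueLength Q = ⊤ := by
  have := hD P
  have key : ∃ c : Localization.AtPrime P.asIdeal, c ∉ Q.asIdeal.map (algebraMap D _) ∧
      (ℓ.atPrime P).idx (Ideal.span {c}) ≠ 0 := by
    have hmem : ∀ {x : D}, algebraMap D (Localization.AtPrime P.asIdeal) x ∈
        Q.asIdeal.map (algebraMap D _) ↔ x ∈ Q.asIdeal := by
      intro x
      conv_rhs => rw [← sat_of_le hlt.le]
      rfl
    by_cases hb : P.BranchedIdempotent
    · rw [slope, if_pos hb, ← idx_atPrime_map, Ideal.map_span, Set.image_singleton] at h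
      exact ⟨_, fun hc => hb.1.pivot_notMem hlt (hmem.1 hc), h⟩
    · rw [slope, if_neg hb] at h
      obtain ⟨c, hcP, hcQ⟩ := SetLike.exists_of_lt (show Q.asIdeal < P.asIdeal from hlt)
      refine ⟨_, fun hc => hcQ (hmem.1 hc), fun h0 => h ?_⟩
      rw [← idx_atPrime_maximalIdeal]
      refine le_antisymm (h0 ▸ (ℓ.atPrime P).idx_anti ?_) zero_le
      rw [Ideal.span_singleton_le_iff_mem, ← Localization.AtPrime.map_eq_maximalIdeal]
      exact Ideal.mem_map_of_mem _ hcP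
  obtain ⟨c, hcQ, hc⟩ := key
  have hprime : (Q.asIdeal.map (algebraMap D (Localization.AtPrime P.asIdeal))).IsPrime :=
    IsLocalization.isPrime_of_isPrime_disjoint P.asIdeal.primeCompl _ _ Q.2
      (Set.disjoint_left.2 fun _ hx hxQ => hx (hlt.le hxQ))
  by_contra hne
  obtain ⟨N, hN⟩ := ENNReal.exists_nat_mul_gt hc hne
  have h1 := (ℓ.atPrime P).le_idx_of_pow_notMem (n := N)
    fun h => hcQ (hprime.mem_of_pow_mem N h)
  rw [idx_atPrime_map, sat_of_le hlt.le] at h1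
  exact absurd hN (not_lt.2 h1)

/-- An application of `idx_eq_zero_of_primes` in D_Q. The radical of a proper principal ideal there
is prime and contracts to a prime P ≤ Q, at which the slope is zero. -/
theorem idx_sat_eq_zero_of_forall {ℓ : LengthFunction D} {Q : PrimeSpectrum D} {J : Ideal D}
    (h : ∀ P ≤ Q, J ≤ P.asIdeal → ℓ.slope P = 0) : ℓ.idx (Q.sat J) = 0 := by
  have := hD Q
  rw [← idx_atPrime_map]
  have hle : ∀ p : Ideal (Localization.AtPrime Q.asIdeal), p.IsPrime → p.under D ≤ Q.asIdeal :=
    fun p hp => (Ideal.comap_mono (le_maximalIdeal hp.ne_top)).trans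
      (Localization.AtPrime.under_maximalIdeal (I := Q.asIdeal)).le
  refine idx_eq_zero_of_primes _ (fun p hp hJp => ?_) fun y hy0 hyu hJy => ?_
  · have h0 := h ⟨p.under D, inferInstance⟩ (hle p hp) (Ideal.map_le_iff_le_comap.1 hJp)
    have h1 : ℓ.residueLength ⟨p.under D, inferInstance⟩ ≤ 0 :=
      residueLength_le_slope.trans h0.le
    rw [idx_atPrime]
    exact le_antisymm h1 zero_le
  · set p := (Ideal.span {y}).radical with hp_def
    have hp : p.IsPrime := by
      refine ⟨fun htop => ?_, fun {x z} hxz => ?_⟩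
      · rw [hp_def, Ideal.radical_eq_top, Ideal.span_singleton_eq_top] at htop
        exact hyu htop
      · rcases ValuationRing.dvd_total x z with hd | hd
        · right
          refine (Ideal.radical_isRadical _) ⟨2, ?_⟩
          rw [sq]
          exact Ideal.mem_of_dvd _ (mul_dvd_mul_right hd z) hxz
        · left
          refine (Ideal.radical_isRadical _) ⟨2, ?_⟩
          rw [sq]
          exact Ideal.mem_of_dvd _ (mul_dvd_mul_left x hd) hxz
    obtain ⟨r, s, hrs⟩ := IsLocalization.exists_mk'_eq Q.asIdeal.primeCompl y
    have hspan : Ideal.span {y} =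
        (Ideal.span {r}).map (algebraMap D (Localization.AtPrime Q.asIdeal)) := by
      rw [Ideal.map_span, Set.image_singleton, Ideal.span_singleton_eq_span_singleton,
        ← IsLocalization.mk'_spec (Localization.AtPrime Q.asIdeal) r s, hrs]
      obtain ⟨w, hw⟩ := IsLocalization.map_units (Localization.AtPrime Q.asIdeal) s
      exact ⟨w, by rw [hw]⟩
    let P : PrimeSpectrum D := ⟨p.under D, inferInstance⟩
    have hPQ : P ≤ Q := hle p hp
    have hPmap : P.asIdeal.map (algebraMap D (Localization.AtPrime Q.asIdeal)) = p :=
      IsLocalization.map_under Q.asIdeal.primeCompl _ p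
    have hrP : r ∈ P.asIdeal := by
      change algebraMap D _ r ∈ p
      refine Ideal.le_radical ?_
      rw [hspan]
      exact Ideal.mem_map_of_mem _ (Ideal.mem_span_singleton_self r)
    have hmin : P.IsMinimalOver (Ideal.span {r}) := by
      refine ⟨(Ideal.span_singleton_le_iff_mem _).2 hrP, fun Q' hQ' hrQ' x hx => ?_⟩
      obtain ⟨n, hn⟩ := (show algebraMap D _ x ∈ p from hx)
      rw [hspan, ← map_pow] at hn
      obtain ⟨t, ht, htx⟩ := mem_sat.1 (show x ^ n ∈ Q.sat (Ideal.span {r}) from hn)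
      have hx' := (Q'.2.mem_or_mem (hrQ' htx)).resolve_left fun htQ => ht (hPQ (hQ' htQ))
      exact Q'.2.mem_of_pow_mem n hx'
    have hJP : J ≤ P.asIdeal := Ideal.map_le_iff_le_comap.1 hJy
    -- `K` is the extension of the saturation of `(r)` at `P`. It is null by `idx_sat_eq_zero`, and
    -- elements outside `P` carry it into `(y)`.
    refine ⟨(P.sat (Ideal.span {r})).map (algebraMap D (Localization.AtPrime Q.asIdeal)),
      ?_, ?_, ?_, ?_⟩
    · rw [hspan]
      exact Ideal.map_mono (P.le_sat _)
    · rw [← hPmap]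
      exact Ideal.map_mono (sat_le hmin.1)
    · have hsat : Q.sat (P.sat (Ideal.span {r})) = P.sat (Ideal.span {r}) := by
        refine le_antisymm (fun x hx => ?_) (Q.le_sat _)
        obtain ⟨t, ht, htx⟩ := mem_sat.1 hx
        obtain ⟨t', ht', htx'⟩ := mem_sat.1 htx
        refine mem_sat.2 ⟨t' * t, fun h => ?_, by rwa [mul_assoc]⟩
        exact (P.2.mem_or_mem h).elim ht' fun h => ht (hPQ h)
      rw [idx_atPrime_map, hsat]
      exact idx_sat_eq_zero hD hmin (h P hPQ hJP)
    · intro x hx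
      obtain ⟨z, w, rfl⟩ := IsLocalization.exists_mk'_eq Q.asIdeal.primeCompl x
      rw [IsLocalization.mk'_mem_map_algebraMap_iff] at hx
      obtain ⟨t, ht, htz⟩ := hx
      obtain ⟨t', ht', htz'⟩ := mem_sat.1 htz
      refine ⟨algebraMap D _ (t' * t), fun h => ?_, ?_⟩
      · exact (P.2.mem_or_mem (x := t') (y := t) h).elim ht' fun h => ht (hPQ h)
      · rw [hspan, IsLocalization.mul_mk'_eq_mk'_of_mul, IsLocalization.mk'_mem_map_algebraMap_iff]
        exact ⟨1, one_mem _, by rwa [one_mul, mul_assoc]⟩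

end Prufer

end LengthFunction

end

/-! ### From local to global: ideals with finitely many minimal primes -/

section

open IsLocalRing PrimeSpectrum

variable {D : Type u} [CommRing D] [IsDomain D]

namespace IsPruferDomain

/-- Incomparable primes are comaximal, so 1 = p + q with p in P and q in all other minimal primes,
and (pq)^k ∈ I for some k. Take e = q^(k+1). A prime over I : e contains p, so it misses q and lies
over P. A prime over I + (e) contains q, so it lies over another minimal prime. -/
theorem exists_split (hD : IsPruferDomain D) {I : Ideal D} (hfin : I.minimalPrimes.Finite)
    {P : PrimeSpectrum D} (hP : P.asIdeal ∈ I.minimalPrimes) :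
    ∃ e ∉ P.asIdeal, (∀ Q : PrimeSpectrum D, I.colon {e} ≤ Q.asIdeal → P ≤ Q) ∧
      (I ⊔ Ideal.span {e}).minimalPrimes ⊆ I.minimalPrimes \ {P.asIdeal} := by
  classical
  have htop : P.asIdeal ⊔ ⨅ q ∈ hfin.toFinset.erase P.asIdeal, q = ⊤ := by
    refine Ideal.sup_iInf_eq_top fun q hq => ?_
    obtain ⟨hne, hq⟩ := Finset.mem_erase.1 hq
    rw [Set.Finite.mem_toFinset] at hq
    refine hD.sup_eq_top (Q := ⟨q, hq.1.1⟩) (fun h => hne ?_) (fun h => hne ?_)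
    · exact le_antisymm (hq.2 hP.1 h) h
    · exact le_antisymm h (hP.2 hq.1 h)
  obtain ⟨p, hp, q, hq, hpq⟩ := Submodule.mem_sup.1 ((Ideal.eq_top_iff_one _).1 htop)
  have hq' : ∀ Q ∈ I.minimalPrimes, Q ≠ P.asIdeal → q ∈ Q := by
    intro Q hQ hne
    simp only [Submodule.mem_iInf] at hq
    exact hq Q (Finset.mem_erase.2 ⟨hne, hfin.mem_toFinset.2 hQ⟩)
  have hone : ∀ Q : PrimeSpectrum D, p ∈ Q.asIdeal → q ∉ Q.asIdeal := fun Q h h' =>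
    Q.2.ne_top ((Ideal.eq_top_iff_one _).2 (hpq ▸ add_mem h h'))
  have hrad : p * q ∈ I.radical := by
    rw [← Ideal.sInf_minimalPrimes, Ideal.mem_sInf]
    intro Q hQ
    by_cases h : Q = P.asIdeal
    · exact h ▸ Ideal.mul_mem_right _ _ hp
    · exact Ideal.mul_mem_left _ _ (hq' Q hQ h)
  obtain ⟨k, hk⟩ := hrad
  refine ⟨q ^ (k + 1), fun h => hone P hp (P.2.mem_of_pow_mem _ h), fun Q hQ => ?_, ?_⟩
  · have hpQ : p ∈ Q.asIdeal := by
      refine Q.2.mem_of_pow_mem (k + 1) (hQ ?_)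
      rw [Submodule.mem_colon_singleton, smul_eq_mul, ← mul_pow]
      exact I.pow_mem_of_pow_mem hk (Nat.le_succ k)
    have hIQ : I ≤ Q.asIdeal := fun x hx => hQ (by
      rw [Submodule.mem_colon_singleton]
      exact I.mul_mem_right _ hx)
    obtain ⟨Q', hQ', hle⟩ := Ideal.exists_minimalPrimes_le hIQ
    by_cases h : Q' = P.asIdeal
    · exact (show P.asIdeal ≤ Q.asIdeal from h ▸ hle)
    · exact absurd (hle (hq' Q' hQ' h)) (hone Q hpQ)
  · intro Q hQ
    have hQp := hQ.1.1
    obtain ⟨Q', hQ', hle⟩ := Ideal.exists_minimalPrimes_le (le_sup_left.trans hQ.1.2)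
    have hne : Q' ≠ P.asIdeal := by
      rintro rfl
      refine hone ⟨Q, hQp⟩ (hle hp) (hQp.mem_of_pow_mem (k + 1) (hQ.1.2 ?_))
      exact le_sup_right (a := I) (Ideal.mem_span_singleton_self _)
    have hQQ' : Q = Q' := by
      refine le_antisymm (hQ.2 ⟨hQ'.1.1, sup_le hQ'.1.2 ?_⟩ hle) hle
      rw [Ideal.span_singleton_le_iff_mem]
      exact Ideal.pow_mem_of_mem _ (hq' Q' hQ' hne) _ (Nat.succ_pos k)
    rw [hQQ']
    exact ⟨hQ', hne⟩

/-- A nonempty S contains a binary tree of primes in which distinct nodes of one level have no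
common upper bound. Let I k be the intersection of level k and J the union of the I k. Above each
node of level k runs a branch whose union contains J, hence contains a minimal prime of J. That
minimal prime lies over this node and no other of its level. So J has at least 2^k minimal primes
for every k. -/
theorem eq_empty_of_forall_exists_incomparable (hD : IsPruferDomain D)
    (hmin : ∀ I : Ideal D, I.minimalPrimes.Finite) (S : Set (PrimeSpectrum D))
    (hS : ∀ P ∈ S, ∃ P₁ ∈ S, ∃ P₂ ∈ S, P ≤ P₁ ∧ P ≤ P₂ ∧ ¬ P₁ ≤ P₂ ∧ ¬ P₂ ≤ P₁) : S = ∅ := by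
  by_contra hne
  obtain ⟨P₀, hP₀⟩ := Set.nonempty_iff_ne_empty.2 hne
  have hS' : ∀ P : S, ∃ c : Bool → S, (∀ b, P ≤ c b) ∧ ¬ c true ≤ c false ∧ ¬ c false ≤ c true := by
    rintro ⟨P, hP⟩
    obtain ⟨P₁, h₁, P₂, h₂, h⟩ := hS P hP
    exact ⟨fun b => if b then ⟨P₁, h₁⟩ else ⟨P₂, h₂⟩, by rintro (_ | _) <;> simp [h], h.2.2⟩
  choose c hc hc₁ hc₂ using hS'
  let node : List Bool → S := fun l => l.foldr (fun b P => c P b) ⟨P₀, hP₀⟩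
  have hnode : ∀ b l, node l ≤ node (b :: l) := fun b l => hc _ b
  have huniq : ∀ (l l' : List Bool), l.length = l'.length → ∀ M : PrimeSpectrum D,
      (node l : PrimeSpectrum D) ≤ M → (node l' : PrimeSpectrum D) ≤ M → l = l' := by
    intro l
    induction l with
    | nil => exact fun l' h _ _ _ => (List.length_eq_zero_iff.1 h.symm).symm
    | cons b l ih =>
      rintro (_ | ⟨b', l'⟩) hlen M h h'
      · simp at hlen
      obtain rfl := ih l' (by simpa using hlen) M
        (le_trans (hnode b l) h) (le_trans (hnode b' l') h')
      have ht := hD.le_total_of_le h h'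
      congr 1
      cases b <;> cases b'
      · rfl
      · exact (ht.elim (hc₂ _) (hc₁ _)).elim
      · exact (ht.elim (hc₁ _) (hc₂ _)).elim
      · rfl
  let I : ℕ → Ideal D := fun k =>
    Finset.univ.inf fun l : List.Vector Bool k => (node l.1 : PrimeSpectrum D).asIdeal
  have hI : ∀ l : List Bool, I l.length ≤ (node l : PrimeSpectrum D).asIdeal := fun l =>
    Finset.inf_le (f := fun l' : List.Vector Bool l.length => (node l'.1 : PrimeSpectrum D).asIdeal)
      (Finset.mem_univ ⟨l, rfl⟩)
  have hImono : Monotone I := by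
    refine monotone_nat_of_le_succ fun k => Finset.le_inf fun l _ => ?_
    obtain ⟨_ | ⟨b, l⟩, hl⟩ := l
    · simp at hl
    · have hlen : l.length = k := by simpa using hl
      exact (hlen ▸ hI l).trans (hnode b l)
  let J : Ideal D := ⨆ k, I k
  have hJ : ∀ {x : D}, x ∈ J ↔ ∃ k, x ∈ I k := fun {x} =>
    Submodule.mem_iSup_of_directed _ hImono.directed_le
  have hfin := hmin J
  have hcount : ∀ k, 2 ^ k ≤ hfin.toFinset.card := by
    intro k
    have hB : ∀ l : List.Vector Bool k, ∃ B ∈ hfin.toFinset,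
        (node l.1 : PrimeSpectrum D).asIdeal ≤ B := by
      rintro ⟨l, rfl⟩
      -- Any branch through `l` serves; this one always takes the `true` child.
      let seq : ℕ → PrimeSpectrum D := fun n => node (List.replicate n true ++ l)
      have hseq : Monotone seq := monotone_nat_of_le_succ fun n => hnode _ _
      obtain ⟨Q, hQ⟩ := PrimeSpectrum.exists_union (Set.range_nonempty seq)
        (directedOn_range.2 hseq.directed_le)
      have hJQ : J ≤ Q.asIdeal := by
        intro x hx
        obtain ⟨j, hj⟩ := hJ.1 hx
        refine (hQ x).2 ⟨seq j, ⟨j, rfl⟩, ?_⟩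
        have h1 := hI (List.replicate j true ++ l)
        rw [List.length_append, List.length_replicate] at h1
        exact h1 (hImono (Nat.le_add_right j l.length) hj)
      obtain ⟨B, hB, hBQ⟩ := Ideal.exists_minimalPrimes_le hJQ
      refine ⟨B, hfin.mem_toFinset.2 hB, ?_⟩
      obtain ⟨l', _, hl'⟩ := (Ideal.IsPrime.inf_le' hB.1.1).1
        ((le_iSup I l.length).trans hB.1.2)
      have hlQ : (node l : PrimeSpectrum D) ≤ Q := fun x hx => (hQ x).2 ⟨seq 0, ⟨0, rfl⟩, hx⟩
      have := huniq l'.1 l l'.2 Q (show _ ≤ Q.asIdeal from hl'.trans hBQ) hlQ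
      rwa [← this]
    choose B hBmem hB using hB
    have hinj : Function.Injective B := by
      intro l l' h
      have hp : (B l').IsPrime := (hfin.mem_toFinset.1 (hBmem l')).1.1
      exact Subtype.ext (huniq l.1 l'.1 (l.2.trans l'.2.symm) ⟨B l', hp⟩
        (show _ ≤ B l' from h ▸ hB l) (hB l'))
    have := Finset.card_le_card_of_injOn (s := Finset.univ) (t := hfin.toFinset) B
      (fun l _ => hBmem l) hinj.injOn
    rwa [Finset.card_univ, card_vector, Fintype.card_bool] at this
  exact absurd (hcount hfin.toFinset.card) (not_le.2 Nat.lt_two_pow_self)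

end IsPruferDomain

namespace LengthFunction

theorem colon_singleton_colon_singleton {R : Type u} [CommRing R] (I : Ideal R) (x y : R) :
    (I.colon {x}).colon {y} = I.colon {x * y} := by
  ext r
  simp only [Submodule.mem_colon_singleton, smul_eq_mul]
  rw [mul_comm x y, mul_assoc]

theorem le_colon_singleton {R : Type u} [CommRing R] (I : Ideal R) (x : R) : I ≤ I.colon {x} := by
  intro r hr
  rw [Submodule.mem_colon_singleton]
  exact I.mul_mem_right x hr

/-- The largest ideal `J` containing `I` such that `J / I` has length zero. -/
noncomputable def nullIdeal {R : Type u} [CommRing R] (ℓ : LengthFunction R) (I : Ideal R) :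
    Ideal R where
  carrier := {x | ℓ.idx (I.colon {x}) = 0}
  zero_mem' := by
    have : I.colon {(0 : R)} = ⊤ := by
      rw [Ideal.eq_top_iff_one, Submodule.mem_colon_singleton, smul_zero]
      exact I.zero_mem
    rw [Set.mem_ofPred_eq, this, ℓ.idx_top]
  add_mem' {x y} hx hy := by
    rw [Set.mem_ofPred_eq] at *
    have h : ℓ.idx (I.colon {x} ⊓ I.colon {y}) = ℓ.idx (I.colon {x}) := by
      refine ℓ.idx_eq_of_le inf_le_left fun z hz => ?_
      refine le_antisymm (hy ▸ ℓ.idx_anti fun r hr => ?_) zero_le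
      rw [Submodule.mem_colon_singleton, smul_eq_mul]
      exact ⟨Ideal.mul_mem_left _ _ hz, Ideal.mul_mem_right _ _ hr⟩
    refine le_antisymm (hx ▸ h ▸ ℓ.idx_anti fun r hr => ?_) zero_le
    rw [Submodule.mem_colon_singleton, smul_add]
    exact add_mem (Submodule.mem_colon_singleton.1 hr.1) (Submodule.mem_colon_singleton.1 hr.2)
  smul_mem' c x hx := by
    rw [Set.mem_ofPred_eq] at *
    refine le_antisymm (hx ▸ ℓ.idx_anti fun r hr => ?_) zero_le
    rw [Submodule.mem_colon_singleton] at hr ⊢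
    rw [smul_comm]
    exact Submodule.smul_mem _ _ hr

theorem mem_nullIdeal {R : Type u} [CommRing R] {ℓ : LengthFunction R} {I : Ideal R} {x : R} :
    x ∈ ℓ.nullIdeal I ↔ ℓ.idx (I.colon {x}) = 0 := Iff.rfl

theorem le_nullIdeal {R : Type u} [CommRing R] (ℓ : LengthFunction R) (I : Ideal R) :
    I ≤ ℓ.nullIdeal I := by
  intro x hx
  have : I.colon {x} = ⊤ := by
    rw [Ideal.eq_top_iff_one, Submodule.mem_colon_singleton, one_smul]
    exact hx
  rw [mem_nullIdeal, this, ℓ.idx_top]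

theorem idx_nullIdeal {R : Type u} [CommRing R] (ℓ : LengthFunction R) (I : Ideal R) :
    ℓ.idx (ℓ.nullIdeal I) = ℓ.idx I :=
  (ℓ.idx_eq_of_le (ℓ.le_nullIdeal I) fun _ hx => hx).symm

theorem idx_nullIdeal_colon {R : Type u} [CommRing R] (ℓ : LengthFunction R) (I : Ideal R) (x : R) :
    ℓ.idx ((ℓ.nullIdeal I).colon {x}) = ℓ.idx (I.colon {x}) := by
  refine (ℓ.idx_eq_of_le (fun r hr => ?_) fun y hy => ?_).symm
  · rw [Submodule.mem_colon_singleton] at hr ⊢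
    exact ℓ.le_nullIdeal I hr
  · rw [colon_singleton_colon_singleton, mul_comm]
    exact Submodule.mem_colon_singleton.1 hy

/-- Pass to the null ideal N of J, so that D/N has no nonzero null cyclic submodule, and let S be
the set of primes that are least over some N : x. If the members of S above such a P formed a chain
with union Q, then `hup` would give N : xy not inside Q. But a minimal prime of N : xy belongs to S
and lies above P, hence inside Q. So S branches everywhere and is empty, whereas a proper N would
give it an element. -/
theorem idx_eq_zero_of_slope (hD : IsPruferDomain D) (hmin : ∀ I : Ideal D, I.minimalPrimes.Finite)
    {ℓ : LengthFunction D} {J : Ideal D}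
    (h : ∀ P : PrimeSpectrum D, J ≤ P.asIdeal → ℓ.slope P = 0) : ℓ.idx J = 0 := by
  rw [← idx_nullIdeal]
  set N := ℓ.nullIdeal J with hN
  by_contra hne
  have hNtop : (1 : D) ∉ N := fun h1 =>
    hne ((Ideal.eq_top_iff_one N).2 h1 ▸ ℓ.idx_top)
  have hcolon : ∀ x ∉ N, ℓ.idx (N.colon {x}) ≠ 0 := by
    intro x hx h0
    rw [hN, idx_nullIdeal_colon] at h0
    exact hx h0
  have hcolon_le : ∀ {x : D} {P : PrimeSpectrum D}, N.colon {x} ≤ P.asIdeal → x ∉ N := by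
    intro x P hle hx
    refine P.2.ne_top ((Ideal.eq_top_iff_one _).2 (hle ?_))
    rwa [Submodule.mem_colon_singleton, one_smul]
  -- If every such colon ideal stayed inside `Q`, then `N.colon {x}` would be saturated at `Q`,
  -- hence null by the local result.
  have hup : ∀ x ∉ N, ∀ Q : PrimeSpectrum D, N.colon {x} ≤ Q.asIdeal →
      ∃ y, x * y ∉ N ∧ ¬ N.colon {x * y} ≤ Q.asIdeal := by
    intro x hx Q hQ
    by_contra! hall
    refine hcolon x hx ?_
    have hsat : Q.sat (N.colon {x}) = N.colon {x} := by
      refine le_antisymm (fun y hy => ?_) (Q.le_sat _)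
      obtain ⟨t, ht, hty⟩ := mem_sat.1 hy
      rw [Submodule.mem_colon_singleton, smul_eq_mul, mul_comm]
      by_contra hxy
      refine ht (hall y hxy ?_)
      rw [Submodule.mem_colon_singleton, smul_eq_mul] at hty ⊢
      rwa [mul_comm x y, ← mul_assoc]
    rw [← hsat]
    refine idx_sat_eq_zero_of_forall hD fun P _ hP => h P ?_
    exact (ℓ.le_nullIdeal J).trans ((le_colon_singleton N x).trans hP)
  let S : Set (PrimeSpectrum D) := {P | ∃ x, N.colon {x} ≤ P.asIdeal ∧
    ∀ Q : PrimeSpectrum D, N.colon {x} ≤ Q.asIdeal → P ≤ Q}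
  have hmem : ∀ (x : D) (P : PrimeSpectrum D), P.asIdeal ∈ (N.colon {x}).minimalPrimes →
      P ∈ S := by
    intro x P hP
    obtain ⟨e, he, heP, _⟩ := hD.exists_split (hmin _) hP
    rw [colon_singleton_colon_singleton] at heP
    refine ⟨x * e, fun r hr => ?_, heP⟩
    rw [← colon_singleton_colon_singleton, Submodule.mem_colon_singleton] at hr
    exact (P.2.mem_or_mem (hP.1.2 hr)).resolve_right he
  have hex : ∀ x ∉ N, ∃ P : PrimeSpectrum D, P.asIdeal ∈ (N.colon {x}).minimalPrimes := by
    intro x hx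
    have : N.colon {x} ≠ ⊤ := by
      intro htop
      have h1 := (Ideal.eq_top_iff_one _).1 htop
      rw [Submodule.mem_colon_singleton, one_smul] at h1
      exact hx h1
    obtain ⟨P, hP⟩ := Ideal.nonempty_minimalPrimes this
    exact ⟨⟨P, hP.1.1⟩, hP⟩
  have hS : S = ∅ := by
    refine hD.eq_empty_of_forall_exists_incomparable hmin S ?_
    rintro P ⟨x, hxP, hx⟩
    by_contra! hall
    let C : Set (PrimeSpectrum D) := {P' | P' ∈ S ∧ P ≤ P'}
    have hPC : P ∈ C := ⟨⟨x, hxP, hx⟩, le_rfl⟩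
    obtain ⟨Q, hQ⟩ := PrimeSpectrum.exists_union (C := C) ⟨P, hPC⟩ fun P₁ h₁ P₂ h₂ => by
      by_cases hle : P₁ ≤ P₂
      · exact ⟨P₂, h₂, hle, le_rfl⟩
      · exact ⟨P₁, h₁, le_rfl, hall P₁ h₁.1 P₂ h₂.1 h₁.2 h₂.2 hle⟩
    have hCQ : ∀ P' ∈ C, P' ≤ Q := fun P' hP' y hy => (hQ y).2 ⟨P', hP', hy⟩
    obtain ⟨y, hy, hyQ⟩ := hup x (hcolon_le hxP) Q (hxP.trans (hCQ P hPC))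
    obtain ⟨P', hP'⟩ := hex _ hy
    have hxy : N.colon {x} ≤ N.colon {x * y} := by
      rw [← colon_singleton_colon_singleton]
      exact le_colon_singleton _ y
    exact hyQ (hP'.1.2.trans (hCQ P' ⟨hmem _ P' hP', hx P' (hxy.trans hP'.1.2)⟩))
  obtain ⟨P, hP⟩ := hex 1 hNtop
  exact (hS ▸ hmem 1 P hP : P ∈ (∅ : Set (PrimeSpectrum D)))

/-- If ρ₂(P) = ∞, there is nothing to prove. Otherwise ℓ₂, and hence ℓ₁, has slope zero at all
primes above P. So ℓ₁ does not distinguish I from its saturation at P, where the comparison is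
local. -/
theorem idx_le_of_forall_le (hD : IsPruferDomain D) {ℓ₁ ℓ₂ : LengthFunction D}
    (hmin : ∀ I : Ideal D, I.minimalPrimes.Finite)
    (hr : ∀ P, ℓ₁.residueLength P ≤ ℓ₂.residueLength P) (hs : ∀ P, ℓ₁.slope P ≤ ℓ₂.slope P)
    {P : PrimeSpectrum D} {I : Ideal D} (hI : I ≤ P.asIdeal)
    (hP : ∀ Q : PrimeSpectrum D, I ≤ Q.asIdeal → P ≤ Q) : ℓ₁.idx I ≤ ℓ₂.idx I := by
  by_cases htop : ℓ₂.residueLength P = ⊤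
  · exact le_trans (le_top.trans htop.ge) (ℓ₂.idx_anti hI)
  have h1 : ℓ₁.idx I = ℓ₁.idx (P.sat I) := by
    refine ℓ₁.idx_eq_of_le (P.le_sat I) fun x hx => ?_
    obtain ⟨t, ht, htx⟩ := mem_sat.1 hx
    refine idx_eq_zero_of_slope hD hmin fun Q hQ => ?_
    have hPQ : P < Q := by
      refine lt_of_le_of_ne (hP Q ((le_colon_singleton I x).trans hQ)) ?_
      rintro rfl
      exact ht (hQ (Submodule.mem_colon_singleton.2 htx))
    by_contra hne
    refine htop (residueLength_eq_top hD hPQ fun h0 => hne ?_)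
    exact le_antisymm (h0 ▸ hs Q) zero_le
  rw [h1]
  exact (idx_sat_le hD ⟨hI, fun Q _ hQ => hP Q hQ⟩ (hr P) (hs P)).trans (ℓ₂.idx_anti (P.le_sat I))

theorem le_of_forall_le (hD : IsPruferDomain D) (hmin : ∀ I : Ideal D, I.minimalPrimes.Finite)
    {ℓ₁ ℓ₂ : LengthFunction D} (hr : ∀ P, ℓ₁.residueLength P ≤ ℓ₂.residueLength P)
    (hs : ∀ P, ℓ₁.slope P ≤ ℓ₂.slope P) : ℓ₁ ≤ ℓ₂ := by
  rw [le_iff_idx]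
  intro I
  induction hn : I.minimalPrimes.ncard using Nat.strong_induction_on generalizing I with
  | _ n ih =>
    by_cases htop : I = ⊤
    · rw [htop, ℓ₁.idx_top]
      exact zero_le
    obtain ⟨p, hp⟩ := Ideal.nonempty_minimalPrimes htop
    let P : PrimeSpectrum D := ⟨p, hp.1.1⟩
    obtain ⟨e, he, heP, hsub⟩ := hD.exists_split (P := P) (hmin I) hp
    rw [ℓ₁.idx_eq_colon_add I e, ℓ₂.idx_eq_colon_add I e]
    refine add_le_add (idx_le_of_forall_le hD hmin hr hs (P := P) (fun r hr => ?_) heP)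
      (ih _ ?_ _ rfl)
    · rw [Submodule.mem_colon_singleton] at hr
      exact (P.2.mem_or_mem (hp.1.2 hr)).resolve_right he
    · rw [← hn]
      exact (Set.ncard_le_ncard hsub ((hmin I).subset Set.sdiff_subset)).trans_lt
        (Set.ncard_sdiff_singleton_lt_of_mem hp (hmin I))

end LengthFunction

end

/-! ### Point weights: the functions t, i and rk as chain functions -/

section

open IsLocalRing

section PointWeight

variable {V : Type u} [CommRing V] [IsLocalRing V]

open Classical in
/-- The weight which is `r` at the maximal ideal and infinite on smaller ideals. -/
noncomputable def pointWeight (r : ℝ≥0∞) (I : Ideal V) : ℝ≥0∞ :=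
  if I = ⊤ then 0 else if I = maximalIdeal V then r else ⊤

theorem pointWeight_top (r : ℝ≥0∞) : pointWeight r (⊤ : Ideal V) = 0 := if_pos rfl

theorem pointWeight_maximalIdeal (r : ℝ≥0∞) : pointWeight r (maximalIdeal V) = r := by
  rw [pointWeight, if_neg (maximalIdeal.isMaximal V).ne_top, if_pos rfl]

theorem pointWeight_of_lt (r : ℝ≥0∞) {I : Ideal V} (h : I < maximalIdeal V) :
    pointWeight r I = ⊤ := by
  rw [pointWeight, if_neg fun h' => (h.trans_le le_top).ne h', if_neg h.ne]

theorem Ideal.eq_top_or_eq_or_lt_maximalIdeal (I : Ideal V) :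
    I = ⊤ ∨ I = maximalIdeal V ∨ I < maximalIdeal V := by
  by_cases h : I = ⊤
  · exact Or.inl h
  · exact Or.inr (le_maximalIdeal h).eq_or_lt

theorem pointWeight_anti (r : ℝ≥0∞) {I J : Ideal V} (h : I ≤ J) :
    pointWeight r J ≤ pointWeight r I := by
  rcases J.eq_top_or_eq_or_lt_maximalIdeal with rfl | rfl | hJ
  · rw [pointWeight_top]; exact zero_le
  · rcases h.eq_or_lt with rfl | hlt
    · exact le_rfl
    · rw [pointWeight_of_lt r hlt]; exact le_top
  · rw [pointWeight_of_lt r (h.trans_lt hJ)]; exact le_top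

/-- The hypothesis is what `mul_le` demands at I = J = 𝔪: if 𝔪² < 𝔪, then 𝔪² has weight ∞, which
must not exceed 2r. -/
theorem isWeight_pointWeight {r : ℝ≥0∞} (h : IsIdempotentElem (maximalIdeal V) ∨ r = ⊤) :
    IsWeight (pointWeight r : Ideal V → ℝ≥0∞) where
  top := pointWeight_top r
  anti := pointWeight_anti r
  mul_le I J := by
    rcases I.eq_top_or_eq_or_lt_maximalIdeal with rfl | rfl | hI
    · rw [Ideal.top_mul]; exact le_add_self
    · rcases J.eq_top_or_eq_or_lt_maximalIdeal with rfl | rfl | hJ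
      · rw [Ideal.mul_top]; exact le_self_add
      · rcases h with h | rfl
        · rw [h.eq]; exact le_self_add
        · simp [pointWeight_maximalIdeal]
      · simp [pointWeight_of_lt r hJ]
    · simp [pointWeight_of_lt r hI]
  colon_add_le {I J} hJI := by
    have hself : ∀ K : Ideal V, K.colon (K : Set V) = ⊤ := fun K => by
      rw [Ideal.eq_top_iff_one, Submodule.mem_colon]
      intro x hx
      simpa using hx
    have htop : ∀ K : Ideal V, K.colon ((⊤ : Ideal V) : Set V) = K := fun K => by
      ext x
      rw [Submodule.mem_colon]
      exact ⟨fun h => by simpa using h 1 trivial, fun h y _ => K.mul_mem_right y h⟩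
    rcases J.eq_top_or_eq_or_lt_maximalIdeal with rfl | rfl | hJ
    · rw [top_le_iff.1 hJI, hself, pointWeight_top, add_zero]
    · rcases I.eq_top_or_eq_or_lt_maximalIdeal with rfl | rfl | hI
      · rw [htop, pointWeight_top, add_zero]
      · rw [hself, pointWeight_top, zero_add]
      · exact absurd hJI (not_le_of_gt hI)
    · rw [pointWeight_of_lt r hJ]; exact le_top
  iInf_le {ι} I := by
    rcases (⨅ i, I i).eq_top_or_eq_or_lt_maximalIdeal with h | h | h
    · rw [h, pointWeight_top]; exact zero_le
    · have : ∃ i, I i ≤ maximalIdeal V := by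
        by_contra! hall
        have htop : ∀ i, I i = ⊤ := fun i => by
          by_contra hi
          exact hall i (le_maximalIdeal hi)
        simp only [htop, iInf_top] at h
        exact (maximalIdeal.isMaximal V).ne_top h.symm
      obtain ⟨i, hi⟩ := this
      refine le_iSup_of_le i ?_
      rw [h]
      exact pointWeight_anti r hi
    · obtain ⟨i, hi⟩ : ∃ i, ¬ maximalIdeal V ≤ I i := by
        by_contra! hall
        exact h.not_ge (le_iInf hall)
      refine le_iSup_of_le i ?_
      rcases (I i).eq_top_or_eq_or_lt_maximalIdeal with h' | h' | h'
      · exact absurd (h' ▸ le_top) hi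
      · exact absurd h'.ge hi
      · rw [pointWeight_of_lt r h']; exact le_top

theorem isWeight_zero {R : Type u} [CommRing R] : IsWeight (fun _ : Ideal R => 0) where
  top := rfl
  anti _ := le_rfl
  mul_le _ _ := by simp
  colon_add_le _ := by simp
  iInf_le _ := zero_le

variable {M : Type u} [AddCommGroup M] [Module V M]

theorem chainFunction_pointWeight_eq_top {r : ℝ≥0∞}
    (h : IsIdempotentElem (maximalIdeal V) ∨ r = ⊤)
    (hM : ¬ Module.IsTorsionBySet V M (maximalIdeal V : Set V)) :
    chainFunction (pointWeight r : Ideal V → ℝ≥0∞) M = ⊤ := by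
  simp only [Module.IsTorsionBySet, not_forall] at hM
  obtain ⟨x, ⟨a, ha⟩, hax⟩ := hM
  have hlt : Ideal.torsionOf V M x < maximalIdeal V := by
    rcases (Ideal.torsionOf V M x).eq_top_or_eq_or_lt_maximalIdeal with h' | h' | h'
    · exact absurd ((Ideal.mem_torsionOf_iff x a).1 (h' ▸ trivial)) hax
    · exact absurd ((Ideal.mem_torsionOf_iff x a).1 (h' ▸ ha)) hax
    · exact h'
  have hx : (isWeight_pointWeight h).lengthFunction.toFun (Submodule.span V {x}) = ⊤ := by
    rw [LengthFunction.span_singleton_eq_idx, (isWeight_pointWeight h).idx_lengthFunction,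
      pointWeight_of_lt r hlt]
  refine top_le_iff.1 (hx.ge.trans ?_)
  exact (isWeight_pointWeight h).lengthFunction.le_of_injective (Submodule.span V {x}).subtype
    (Submodule.injective_subtype _)

/-- V/𝔪 is a field, so a torsion V/𝔪-module is zero. Both sides are therefore infinite on every
nonzero module. -/
theorem torsionSingular_eq :
    torsionSingular (maximalIdeal V) = chainFunction (pointWeight ⊤ : Ideal V → ℝ≥0∞) := by
  funext M _ _
  have hw : IsWeight (pointWeight ⊤ : Ideal V → ℝ≥0∞) := isWeight_pointWeight (Or.inr rfl)
  unfold torsionSingular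
  split_ifs with h
  · obtain ⟨h, ht⟩ := h
    let _ : Module (V ⧸ maximalIdeal V) M := h.module
    have : Subsingleton M := by
      refine subsingleton_of_forall_eq 0 fun x => ?_
      obtain ⟨a, ha⟩ := @ht x
      have hne : (a : V ⧸ maximalIdeal V) ≠ 0 := nonZeroDivisors.ne_zero a.2
      let _ := Ideal.Quotient.field (maximalIdeal V)
      exact (smul_eq_zero.1 (show (a : V ⧸ maximalIdeal V) • x = 0 from ha)).resolve_left hne
    exact (hw.lengthFunction.map_zero M this).symm
  · symm
    by_cases hM : Module.IsTorsionBySet V M (maximalIdeal V : Set V)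
    · have hne : ∃ x : M, x ≠ 0 := by
        by_contra! h0
        refine h ⟨hM, ?_⟩
        let _ : Module (V ⧸ maximalIdeal V) M := hM.module
        intro x
        exact ⟨1, (h0 _).trans rfl⟩
      obtain ⟨x, hx⟩ := hne
      have hxm : Ideal.torsionOf V M x = maximalIdeal V := by
        refine ((maximalIdeal.isMaximal V).eq_of_le ?_ fun a ha => ?_).symm
        · rw [Ne, Ideal.torsionOf_eq_top_iff]
          exact hx
        · rw [Ideal.mem_torsionOf_iff]
          exact @hM x ⟨a, ha⟩
      have hx' : hw.lengthFunction.toFun (Submodule.span V {x}) = ⊤ := by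
        rw [LengthFunction.span_singleton_eq_idx, hw.idx_lengthFunction, hxm,
          pointWeight_maximalIdeal]
      refine top_le_iff.1 (hx'.ge.trans ?_)
      exact hw.lengthFunction.le_of_injective (Submodule.span V {x}).subtype
        (Submodule.injective_subtype _)
    · exact chainFunction_pointWeight_eq_top (Or.inr rfl) hM

theorem idempotentSingular_eq (hid : IsIdempotentElem (maximalIdeal V)) :
    idempotentSingular (maximalIdeal V) = chainFunction (pointWeight 0 : Ideal V → ℝ≥0∞) := by
  funext M _ _
  have hw : IsWeight (pointWeight 0 : Ideal V → ℝ≥0∞) := isWeight_pointWeight (Or.inl hid)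
  unfold idempotentSingular
  split_ifs with h
  · refine (hw.lengthFunction.toFun_eq_zero fun x => ?_).symm
    rw [hw.idx_lengthFunction]
    refine le_antisymm ((pointWeight_anti 0 fun a ha => ?_).trans
      (pointWeight_maximalIdeal 0).le) zero_le
    rw [Ideal.mem_torsionOf_iff]
    exact @h x ⟨a, ha⟩
  · exact (chainFunction_pointWeight_eq_top (Or.inl hid) h).symm

theorem LengthFunction.toFun_fin {k : Type u} [CommRing k] (ℓ : LengthFunction k) (n : ℕ) :
    ℓ.toFun (Fin n → k) = n * ℓ.toFun k := by
  induction n with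
  | zero => rw [ℓ.map_zero _ inferInstance]; simp
  | succ n ih =>
    rw [ℓ.additive k (Fin (n + 1) → k) (Fin n → k) (LinearMap.single k (fun _ => k) 0)
      (LinearMap.funLeft k k Fin.succ) (Pi.single_injective (M := fun _ : Fin (n + 1) => k) 0) ?_
      (LinearMap.funLeft_surjective_of_injective k k _ (Fin.succ_injective n)), ih]
    · push_cast; ring
    · intro x
      constructor
      · intro hx
        refine ⟨x 0, funext fun i => ?_⟩
        refine Fin.cases (by simp) (fun i => ?_) i
        have := congrFun hx i
        simpa using this.symm
      · rintro ⟨y, rfl⟩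
        ext i
        simp [LinearMap.funLeft_apply]

theorem LengthFunction.toFun_eq_mul_rank {k : Type u} [Field k] (ℓ : LengthFunction k)
    (M : Type u) [AddCommGroup M] [Module k M] (h0 : ℓ.toFun k ≠ 0) :
    ℓ.toFun M = ℓ.toFun k * ((Module.rank k M).toENat : ℝ≥0∞) := by
  rcases lt_or_ge (Module.rank k M) Cardinal.aleph0 with h | h
  · have : Module.Finite k M := Module.rank_lt_aleph0_iff.1 h
    rw [ℓ.congr (Module.finBasis k M).equivFun, ℓ.toFun_fin, mul_comm,
      ← Module.finrank_eq_rank, Cardinal.toENat_nat, ENat.toENNReal_coe]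
  · rw [Cardinal.toENat_eq_top.2 h, ENat.toENNReal_top, ENNReal.mul_top h0]
    refine ENNReal.eq_top_of_forall_nnreal_le fun r => ?_
    obtain ⟨n, hn⟩ := ENNReal.exists_nat_mul_gt h0 (ENNReal.coe_ne_top (r := r))
    obtain ⟨f, hf⟩ := Module.le_rank_iff_exists_linearMap.1
      ((Cardinal.natCast_le_aleph0 (n := n)).trans h)
    exact hn.le.trans ((ℓ.toFun_fin n).ge.trans (ℓ.le_of_injective f hf))

/-- On V/𝔪-modules the chain function restricts to a length function over a field, so it is α times
the dimension. Elsewhere both sides are infinite, since α · ∞ = ∞ for α > 0. -/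
theorem scale_rankFunction_eq (hid : IsIdempotentElem (maximalIdeal V)) {α : ℝ≥0} (hα : 0 < α) :
    scale α (rankFunction (maximalIdeal V)) =
      chainFunction (pointWeight α : Ideal V → ℝ≥0∞) := by
  funext M _ _
  have hw : IsWeight (pointWeight α : Ideal V → ℝ≥0∞) := isWeight_pointWeight (Or.inl hid)
  have hα' : (α : ℝ≥0∞) ≠ 0 := ENNReal.coe_ne_zero.2 hα.ne'
  unfold scale rankFunction
  split_ifs with h
  · let _ : Module (V ⧸ maximalIdeal V) M := h.module
    have : IsScalarTower V (V ⧸ maximalIdeal V) M := h.isScalarTower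
    let _ := Ideal.Quotient.field (maximalIdeal V)
    let ℓ := hw.lengthFunction.restrictScalars (V ⧸ maximalIdeal V)
    have hk : ℓ.toFun (V ⧸ maximalIdeal V) = α :=
      (hw.lengthFunction.restrict_eq _ (V ⧸ maximalIdeal V)).trans
        ((hw.idx_lengthFunction _).trans (pointWeight_maximalIdeal _))
    have hM : ℓ.toFun M = chainFunction (pointWeight α) M := hw.lengthFunction.restrict_eq _ M
    rw [← hM, ℓ.toFun_eq_mul_rank M (by rw [hk]; exact hα'), hk, Module.rank_baseChange,
      Cardinal.lift_id]
  · rw [ENNReal.mul_top hα']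
    exact (chainFunction_pointWeight_eq_top (Or.inl hid) h).symm

end PointWeight

end

/-! ### Weights given by real valuations -/

section

open IsLocalRing

section Value

variable {V : Type u} [CommRing V]

/-- A function `V → [0, ∞]` induced by a real valuation on a quotient of the valuation ring `V`. -/
structure IsValue (f : V → ℝ≥0∞) : Prop where
  map_zero : f 0 = ⊤
  map_one : f 1 = 0
  map_mul : ∀ x y, f (x * y) = f x + f y
  dvd : ∀ {x y}, f x ≤ f y → f x ≠ ⊤ → x ∣ y

/-- The infimum of the values of the elements of an ideal. -/
noncomputable def valueWeight (f : V → ℝ≥0∞) (I : Ideal V) : ℝ≥0∞ := ⨅ a ∈ I, f a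

theorem valueWeight_le {f : V → ℝ≥0∞} {I : Ideal V} {a : V} (ha : a ∈ I) :
    valueWeight f I ≤ f a := iInf₂_le a ha

namespace IsValue

variable {f : V → ℝ≥0∞} (hf : IsValue f)
include hf

theorem mono {x y : V} (h : x ∣ y) : f x ≤ f y := by
  obtain ⟨z, rfl⟩ := h
  rw [hf.map_mul]
  exact le_self_add

theorem map_pow (x : V) (n : ℕ) : f (x ^ n) = n * f x := by
  induction n with
  | zero => simp [hf.map_one]
  | succ n ih => rw [pow_succ, hf.map_mul, ih]; push_cast; ring

theorem weight_span (a : V) : valueWeight f (Ideal.span {a}) = f a :=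
  le_antisymm (valueWeight_le (Ideal.mem_span_singleton_self a))
    (le_iInf₂ fun _ hb => hf.mono (Ideal.mem_span_singleton.1 hb))

theorem weight_top : valueWeight f ⊤ = 0 := by
  rw [← Ideal.span_singleton_one, hf.weight_span, hf.map_one]

omit hf in
theorem weight_anti {I J : Ideal V} (h : I ≤ J) : valueWeight f J ≤ valueWeight f I :=
  le_iInf₂ fun _ ha => valueWeight_le (h ha)

theorem isUnit_of_eq_zero {x : V} (h : f x = 0) : IsUnit x :=
  isUnit_of_dvd_one (hf.dvd (by rw [h, hf.map_one]) (by simp [h]))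

theorem mem_of_lt {I : Ideal V} {x : V} (h : valueWeight f I < f x) : x ∈ I := by
  obtain ⟨a, hax⟩ := iInf_lt_iff.1 h
  obtain ⟨ha, hax⟩ := iInf_lt_iff.1 hax
  exact I.mem_of_dvd (hf.dvd hax.le hax.ne_top) ha

theorem weight_mul_le (I J : Ideal V) :
    valueWeight f (I * J) ≤ valueWeight f I + valueWeight f J := by
  unfold valueWeight
  refine ENNReal.le_of_forall_pos_le_add fun ε hε hlt => ?_
  have hε2 : (ε / 2 : ℝ≥0) ≠ 0 := (half_pos hε).ne'
  have h1 := (ENNReal.add_lt_top.1 hlt).1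
  have h2 := (ENNReal.add_lt_top.1 hlt).2
  obtain ⟨a, ha'⟩ := iInf_lt_iff.1 (ENNReal.lt_add_right h1.ne (ENNReal.coe_ne_zero.2 hε2))
  obtain ⟨ha, ha'⟩ := iInf_lt_iff.1 ha'
  obtain ⟨b, hb'⟩ := iInf_lt_iff.1 (ENNReal.lt_add_right h2.ne (ENNReal.coe_ne_zero.2 hε2))
  obtain ⟨hb, hb'⟩ := iInf_lt_iff.1 hb'
  refine (iInf₂_le (a * b) (Ideal.mul_mem_mul ha hb)).trans ?_
  rw [hf.map_mul]
  refine (add_le_add ha'.le hb'.le).trans (le_of_eq ?_)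
  rw [add_add_add_comm, ← ENNReal.coe_add, add_halves]

theorem weight_le_of_pow_mem {I : Ideal V} {c : V} {n : ℕ} (h : c ^ n ∈ I) :
    valueWeight f I ≤ n * f c := by
  rw [← hf.map_pow]
  exact valueWeight_le h

variable [IsDomain V] [ValuationRing V]

theorem ne_zero_of_mem {x : V} (h : x ∈ maximalIdeal V) : f x ≠ 0 :=
  fun h0 => (mem_maximalIdeal x).1 h (hf.isUnit_of_eq_zero h0)

theorem exists_pow_boundary {I : Ideal V} (hI : I ≠ ⊤) (h : valueWeight f I ≠ ⊤) {c : V}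
    (hc : c ∈ maximalIdeal V) : ∃ n, c ^ n ∉ I ∧ c ^ (n + 1) ∈ I := by
  obtain ⟨k, hk⟩ := ENNReal.exists_nat_mul_gt (hf.ne_zero_of_mem hc) h
  exact Ideal.exists_pow_mem_boundary hI (hf.mem_of_lt (by rwa [hf.map_pow]))

theorem le_weight_of_pow_notMem {I : Ideal V} {c : V} {n : ℕ} (h : c ^ n ∉ I) :
    n * f c ≤ valueWeight f I := by
  rw [← hf.map_pow, ← hf.weight_span]
  exact weight_anti (le_span_singleton_of_notMem h)

theorem exists_lt (hid : IsIdempotentElem (maximalIdeal V)) {c : V} (hc : c ∈ maximalIdeal V)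
    (hc' : f c ≠ ⊤) {ε : ℝ≥0∞} (hε : ε ≠ 0) : ∃ x ∈ maximalIdeal V, f x < ε := by
  have hlt : Ideal.span {c} < maximalIdeal V := by
    refine lt_of_le_of_ne ((Ideal.span_singleton_le_iff_mem _).2 hc) fun h => hc' ?_
    rw [hid.eq_zero_of_maximalIdeal_eq_span h.symm, hf.map_zero]
  obtain ⟨N, hN⟩ := ENNReal.exists_nat_mul_gt hε hc'
  obtain ⟨x, hx, hxN⟩ := exists_pow_notMem hid hlt N
  refine ⟨x, hx, ?_⟩
  have h1 := hf.le_weight_of_pow_notMem hxN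
  rw [hf.weight_span] at h1
  by_contra! hle
  exact absurd (hN.trans_le ((mul_le_mul_right hle _).trans h1)) (lt_irrefl _)

theorem weight_maximalIdeal_of_isIdempotentElem (hid : IsIdempotentElem (maximalIdeal V)) {c : V}
    (hc : c ∈ maximalIdeal V) (hc' : f c ≠ ⊤) : valueWeight f (maximalIdeal V) = 0 := by
  by_contra h0
  obtain ⟨x, hx, hlt⟩ := hf.exists_lt hid hc hc' h0
  exact absurd (valueWeight_le hx) (not_le.2 hlt)

/-- Measure both ideals by powers of x in 𝔪: if x^n is the last power outside I and x^(n+d) the last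
outside J, then x^(d+1) carries I into J. This gives the inequality up to 2f(x), which is
arbitrarily small for idempotent 𝔪. Otherwise x = π generates 𝔪, and π^d already carries I into J,
without error. -/
theorem weight_colon_add_le {c : V} (hc : c ∈ maximalIdeal V) (hc' : f c ≠ ⊤) {I J : Ideal V}
    (hJI : J ≤ I) : valueWeight f (J.colon (I : Set V)) + valueWeight f I ≤ valueWeight f J := by
  by_cases hJ : valueWeight f J = ⊤
  · rw [hJ]; exact le_top
  rcases eq_or_ne I ⊤ with rfl | hI
  · rw [hf.weight_top, add_zero]
    refine weight_anti fun x hx => Submodule.mem_colon.2 fun y _ => J.mul_mem_right y hx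
  have hI' : valueWeight f I ≠ ⊤ := ne_top_of_le_ne_top hJ (weight_anti hJI)
  have hJt : J ≠ ⊤ := fun h => hI (top_le_iff.1 (h ▸ hJI))
  have key : ∀ {c : V} {n k : ℕ}, c ^ n ∉ I → c ^ (n + 1) ∈ I → c ^ k ∉ J → c ^ (k + 1) ∈ J →
      n ≤ k := by
    intro c n k hn hn' hk hk'
    by_contra! hlt
    exact hn (hJI (J.pow_mem_of_pow_mem hk' (by omega)))
  by_cases hid : IsIdempotentElem (maximalIdeal V)
  · refine ENNReal.le_of_forall_pos_le_add fun ε hε _ => ?_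
    have hε2 : ((ε / 2 : ℝ≥0) : ℝ≥0∞) ≠ 0 := ENNReal.coe_ne_zero.2 (half_pos hε).ne'
    obtain ⟨x, hx, hxε⟩ := hf.exists_lt hid hc hc' hε2
    obtain ⟨n, hn, hn'⟩ := hf.exists_pow_boundary hI hI' hx
    obtain ⟨k, hk, hk'⟩ := hf.exists_pow_boundary hJt hJ hx
    obtain ⟨d, rfl⟩ := Nat.exists_eq_add_of_le (key hn hn' hk hk')
    have hcol : x ^ (d + 1) ∈ J.colon (I : Set V) := by
      rw [Submodule.mem_colon]
      intro y hy
      obtain ⟨z, rfl⟩ := Ideal.mem_span_singleton.1 (le_span_singleton_of_notMem hn hy)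
      rw [smul_eq_mul, ← mul_assoc, ← pow_add, show d + 1 + n = n + d + 1 by ring]
      exact J.mul_mem_right z hk'
    calc valueWeight f (J.colon (I : Set V)) + valueWeight f I
        ≤ (d + 1 : ℕ) * f x + (n + 1 : ℕ) * f x :=
          add_le_add (hf.weight_le_of_pow_mem hcol) (hf.weight_le_of_pow_mem hn')
      _ = (n + d : ℕ) * f x + (f x + f x) := by push_cast; ring
      _ ≤ valueWeight f J + (((ε / 2 : ℝ≥0) : ℝ≥0∞) + ((ε / 2 : ℝ≥0) : ℝ≥0∞)) :=
          add_le_add (hf.le_weight_of_pow_notMem hk) (add_le_add hxε.le hxε.le)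
      _ = valueWeight f J + ε := by rw [← ENNReal.coe_add, add_halves]
  · obtain ⟨π, -, hπ⟩ := exists_maximalIdeal_eq_span hid
    have hx : π ∈ maximalIdeal V := hπ ▸ Ideal.mem_span_singleton_self π
    obtain ⟨n, hn, hn'⟩ := hf.exists_pow_boundary hI hI' hx
    obtain ⟨k, hk, hk'⟩ := hf.exists_pow_boundary hJt hJ hx
    obtain ⟨d, rfl⟩ := Nat.exists_eq_add_of_le (key hn hn' hk hk')
    have hcol : π ^ d ∈ J.colon (I : Set V) := by
      rw [Submodule.mem_colon, eq_span_pow_of_pow_mem hπ hn hn']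
      intro y hy
      obtain ⟨z, rfl⟩ := Ideal.mem_span_singleton.1 hy
      rw [smul_eq_mul, ← mul_assoc, ← pow_add, show d + (n + 1) = n + d + 1 by ring]
      exact J.mul_mem_right z hk'
    calc valueWeight f (J.colon (I : Set V)) + valueWeight f I
        ≤ d * f π + (n + 1 : ℕ) * f π :=
          add_le_add (hf.weight_le_of_pow_mem hcol) (hf.weight_le_of_pow_mem hn')
      _ = f (π ^ (n + d + 1)) := by rw [hf.map_pow]; push_cast; ring
      _ = valueWeight f J := by rw [eq_span_pow_of_pow_mem hπ hk hk', hf.weight_span]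

/-- The last power of x outside the intersection is already outside one I i, so the two weights
differ by at most f(x), and by nothing when x = π generates 𝔪. -/
theorem weight_iInf_le {c : V} (hc : c ∈ maximalIdeal V) (hc' : f c ≠ ⊤) {ι : Type*}
    (I : ι → Ideal V) : valueWeight f (⨅ i, I i) ≤ ⨆ i, valueWeight f (I i) := by
  by_cases hC : ⨆ i, valueWeight f (I i) = ⊤
  · rw [hC]; exact le_top
  rcases eq_or_ne (⨅ i, I i) ⊤ with h | htop
  · rw [h, hf.weight_top]; exact zero_le
  have key : ∀ x ∈ maximalIdeal V, ∃ n i, x ^ n ∉ I i ∧ x ^ (n + 1) ∈ ⨅ i, I i := by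
    intro x hx
    obtain ⟨k, hk⟩ := ENNReal.exists_nat_mul_gt (hf.ne_zero_of_mem hx) hC
    have hmem : x ^ k ∈ ⨅ i, I i := by
      rw [Ideal.mem_iInf]
      intro i
      refine hf.mem_of_lt ?_
      rw [hf.map_pow]
      exact (le_iSup (fun i => valueWeight f (I i)) i).trans_lt hk
    obtain ⟨n, hn, hn'⟩ := Ideal.exists_pow_mem_boundary htop hmem
    rw [Ideal.mem_iInf, not_forall] at hn
    obtain ⟨i, hi⟩ := hn
    exact ⟨n, i, hi, hn'⟩
  by_cases hid : IsIdempotentElem (maximalIdeal V)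
  · refine ENNReal.le_of_forall_pos_le_add fun ε hε _ => ?_
    obtain ⟨x, hx, hxε⟩ := hf.exists_lt hid hc hc' (ENNReal.coe_ne_zero.2 hε.ne')
    obtain ⟨n, i, hi, hn'⟩ := key x hx
    calc valueWeight f (⨅ i, I i) ≤ (n + 1 : ℕ) * f x := hf.weight_le_of_pow_mem hn'
      _ = n * f x + f x := by push_cast; ring
      _ ≤ (⨆ i, valueWeight f (I i)) + ε :=
          add_le_add ((hf.le_weight_of_pow_notMem hi).trans
            (le_iSup (fun i => valueWeight f (I i)) i)) hxε.le
  · obtain ⟨π, -, hπ⟩ := exists_maximalIdeal_eq_span hid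
    obtain ⟨n, i, hi, hn'⟩ := key π (hπ ▸ Ideal.mem_span_singleton_self π)
    refine le_trans (le_of_eq ?_) (le_iSup (fun i => valueWeight f (I i)) i)
    rw [eq_span_pow_of_pow_mem hπ hi ((Ideal.mem_iInf.1 hn') i),
      eq_span_pow_of_pow_mem hπ (fun h => hi (Ideal.mem_iInf.1 h i)) hn']

theorem isWeight {c : V} (hc : c ∈ maximalIdeal V) (hc' : f c ≠ ⊤) : IsWeight (valueWeight f) where
  top := hf.weight_top
  anti := weight_anti
  mul_le := hf.weight_mul_le
  colon_add_le := hf.weight_colon_add_le hc hc'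
  iInf_le := hf.weight_iInf_le hc hc'

end IsValue

/-- Truncation of a real number, or `⊤`, to `[0, ∞]`. -/
noncomputable def truncate (z : WithTop ℝ) : ℝ≥0∞ := (WithTop.map Real.toNNReal z : WithTop ℝ≥0)

theorem truncate_top : truncate ⊤ = ⊤ := rfl

theorem truncate_coe (r : ℝ) : truncate r = ENNReal.ofReal r := rfl

theorem truncate_zero : truncate 0 = 0 := ENNReal.ofReal_zero

theorem truncate_eq_top_iff {z : WithTop ℝ} : truncate z = ⊤ ↔ z = ⊤ := by
  induction z with
  | top => simp [truncate_top]
  | coe r => simp [truncate_coe]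

theorem truncate_add {y z : WithTop ℝ} (hy : 0 ≤ y) (hz : 0 ≤ z) :
    truncate (y + z) = truncate y + truncate z := by
  induction y with
  | top => simp [truncate_top]
  | coe r =>
  induction z with
  | top => simp [truncate_top]
  | coe t =>
  rw [← WithTop.coe_add, truncate_coe, truncate_coe, truncate_coe,
    ENNReal.ofReal_add (WithTop.coe_le_coe.1 hy) (WithTop.coe_le_coe.1 hz)]

theorem le_of_truncate_le {y z : WithTop ℝ} (hz : 0 ≤ z) (h : truncate y ≤ truncate z)
    (hy : y ≠ ⊤) : y ≤ z := by
  lift y to ℝ using hy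
  induction z with
  | top => exact le_top
  | coe t =>
  rw [truncate_coe, truncate_coe, ENNReal.ofReal_le_ofReal_iff (WithTop.coe_le_coe.1 hz)] at h
  exact WithTop.coe_le_coe.2 h

section Valuation

variable {Q : Ideal V} [Q.IsPrime] (v : AddValuation (FractionRing (V ⧸ Q)) (WithTop ℝ))

theorem valueAt_eq_truncate (a : V) : valueAt v a =
    truncate (v (algebraMap (V ⧸ Q) (FractionRing (V ⧸ Q)) (Ideal.Quotient.mk Q a))) := rfl

theorem valueAt_eq_top_iff {a : V} : valueAt v a = ⊤ ↔ a ∈ Q := by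
  rw [valueAt_eq_truncate, truncate_eq_top_iff,
    AddValuation.top_iff, map_eq_zero_iff _ (IsFractionRing.injective (V ⧸ Q) _),
    Ideal.Quotient.eq_zero_iff_mem]

theorem isValue_valueAt [IsDomain V] [ValuationRing V]
    (hv : ∀ x, 0 ≤ v x ↔ x ∈ (algebraMap (V ⧸ Q) (FractionRing (V ⧸ Q))).range) :
    IsValue (valueAt v) := by
  have hpos : ∀ a : V ⧸ Q, 0 ≤ v (algebraMap _ _ a) := fun a => (hv _).2 ⟨a, rfl⟩
  refine ⟨(valueAt_eq_top_iff v).2 Q.zero_mem, ?_, fun x y => ?_, fun {x y} h hx => ?_⟩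
  · rw [valueAt_eq_truncate, _root_.map_one, _root_.map_one, AddValuation.map_one, truncate_zero]
  · rw [valueAt_eq_truncate, _root_.map_mul, _root_.map_mul, AddValuation.map_mul,
      truncate_add (hpos _) (hpos _)]
    rfl
  · have hxQ : x ∉ Q := fun h' => hx ((valueAt_eq_top_iff v).2 h')
    have hx0 : algebraMap (V ⧸ Q) (FractionRing (V ⧸ Q)) (Ideal.Quotient.mk Q x) ≠ 0 := by
      rwa [Ne, map_eq_zero_iff _ (IsFractionRing.injective (V ⧸ Q) _),
        Ideal.Quotient.eq_zero_iff_mem]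
    have hle : v (algebraMap _ _ (Ideal.Quotient.mk Q x)) ≤
        v (algebraMap _ _ (Ideal.Quotient.mk Q y)) :=
      le_of_truncate_le (hpos _) h (mt (AddValuation.top_iff _).1 hx0)
    obtain ⟨q, hq⟩ := Ideal.Quotient.mk_surjective.exists.1 ((hv
      (algebraMap _ _ (Ideal.Quotient.mk Q y) / algebraMap _ _ (Ideal.Quotient.mk Q x))).1 (by
        have h3 : v (algebraMap _ _ (Ideal.Quotient.mk Q x)) ≠ ⊤ := by
          rwa [Ne, AddValuation.top_iff]
        have h4 : v (algebraMap _ _ (Ideal.Quotient.mk Q y)) =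
            v (algebraMap _ _ (Ideal.Quotient.mk Q y) / algebraMap _ _ (Ideal.Quotient.mk Q x)) +
              v (algebraMap _ _ (Ideal.Quotient.mk Q x)) := by
          rw [← AddValuation.map_mul, div_mul_cancel₀ _ hx0]
        rw [h4] at hle
        generalize v (algebraMap _ _ (Ideal.Quotient.mk Q x)) = α at hle h3
        generalize v (algebraMap _ _ (Ideal.Quotient.mk Q y) /
          algebraMap _ _ (Ideal.Quotient.mk Q x)) = β at hle ⊢
        lift α to ℝ using h3
        induction β with
        | top => exact le_top
        | coe β =>
        rw [← WithTop.coe_add, WithTop.coe_le_coe] at hle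
        exact WithTop.coe_le_coe.2 (by linarith)))
    rw [eq_div_iff hx0, ← _root_.map_mul, ← _root_.map_mul] at hq
    -- So far `x` divides `y` only modulo `Q`. This lifts to `V` because `x ∉ Q` forces `Q ⊆ (x)`.
    have hmem : q * x - y ∈ Q :=
      Ideal.Quotient.eq.1 (IsFractionRing.injective (V ⧸ Q) (FractionRing (V ⧸ Q)) hq)
    have hdvd : x ∣ q * x - y :=
      Ideal.mem_span_singleton.1 (le_span_singleton_of_notMem hxQ hmem)
    exact (dvd_sub_right (dvd_mul_left x q)).1 hdvd

end Valuation

end Value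

end

/-! ### Existence of real valuations with a prescribed value -/

section

open IsLocalRing

section RankOne

theorem ValuationRing.mulArchimedean_valueGroup {W : Type u} [CommRing W] [IsDomain W]
    [ValuationRing W] (h : ∀ b ∈ maximalIdeal W, ∀ d ≠ 0, ∃ n, d ∣ b ^ n) :
    MulArchimedean (ValuationRing.ValueGroup W (FractionRing W)) where
  arch x y hy := by
    set K := FractionRing W
    obtain ⟨k, rfl⟩ : ∃ k : K, ValuationRing.valuation W K k = x := Quotient.exists_rep x
    obtain ⟨l, rfl⟩ : ∃ l : K, ValuationRing.valuation W K l = y := Quotient.exists_rep y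
    have hint : ∀ w : W, ValuationRing.valuation W K (algebraMap W K w) ≤ 1 := fun w =>
      (ValuationRing.mem_integer_iff W K _).2 ⟨w, rfl⟩
    have hl0 : l ≠ 0 := by
      rintro rfl
      rw [map_zero] at hy
      exact absurd hy (not_lt.2 zero_le)
    obtain ⟨b, hb⟩ := (ValuationRing.mem_integer_iff W K l⁻¹).1 (by
      rw [Valuation.mem_integer_iff, map_inv₀]
      exact inv_le_one_of_one_le₀ hy.le)
    have hbm : b ∈ maximalIdeal W := by
      rw [mem_maximalIdeal, mem_nonunits_iff]
      rintro ⟨e, rfl⟩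
      have h1 := hint (e⁻¹ : Wˣ)
      have h2 : algebraMap W K (e⁻¹ : Wˣ) = l := by
        rw [eq_comm, ← inv_inj, ← hb, eq_comm, inv_eq_iff_eq_inv]
        exact eq_inv_of_mul_eq_one_left (by rw [← map_mul, Units.inv_mul, map_one])
      rw [h2] at h1
      exact absurd hy (not_lt.2 h1)
    obtain ⟨r, d, hd, rfl⟩ := IsFractionRing.div_surjective (A := W) k
    obtain ⟨n, hn⟩ := h b hbm d (nonZeroDivisors.ne_zero hd)
    refine ⟨n, ?_⟩
    obtain ⟨e, he⟩ := hn
    have hd0 : algebraMap W K d ≠ 0 := by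
      rw [Ne, map_eq_zero_iff _ (IsFractionRing.injective W K)]
      exact nonZeroDivisors.ne_zero hd
    have hle : ValuationRing.valuation W K (algebraMap W K b) ^ n ≤
        ValuationRing.valuation W K (algebraMap W K d) := by
      rw [← map_pow, ← map_pow, he, map_mul, map_mul]
      exact mul_le_of_le_one_right' (hint e)
    have hl : ValuationRing.valuation W K l ≠ 0 := (Valuation.ne_zero_iff _).2 hl0
    have hd1 : ValuationRing.valuation W K (algebraMap W K d) ≠ 0 := (Valuation.ne_zero_iff _).2 hd0
    rw [hb, map_inv₀, inv_pow, inv_le_iff_one_le_mul₀ (pow_pos (zero_lt_iff.2 hl) n)] at hle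
    rw [map_div₀, div_le_iff₀ (zero_lt_iff.2 hd1)]
    exact (hint r).trans (by rwa [mul_comm])

/-- The value group is archimedean, so Hölder's theorem embeds it in ℝ. Rescaling the embedding
gives a the value s. -/
theorem ValuationRing.exists_addValuation {W : Type u} [CommRing W] [IsDomain W]
    [ValuationRing W] (h : ∀ b ∈ maximalIdeal W, ∀ d ≠ 0, ∃ n, d ∣ b ^ n) {a : W}
    (ha : a ∈ maximalIdeal W) (ha0 : a ≠ 0) {s : ℝ} (hs : 0 < s) :
    ∃ v : AddValuation (FractionRing W) (WithTop ℝ),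
      (∀ x, 0 ≤ v x ↔ x ∈ (algebraMap W (FractionRing W)).range) ∧ v (algebraMap _ _ a) = s := by
  set K := FractionRing W
  have hΓ := ValuationRing.mulArchimedean_valueGroup h
  obtain ⟨L, hLmul, hLle⟩ : ∃ L : K → ℝ, (∀ x y, x ≠ 0 → y ≠ 0 → L (x * y) = L x + L y) ∧
      ∀ x y, x ≠ 0 → y ≠ 0 →
        (L y ≤ L x ↔ ValuationRing.valuation W K x ≤ ValuationRing.valuation W K y) := by
    obtain ⟨f, hf⟩ := Archimedean.exists_orderAddMonoidHom_real_injective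
      (Additive (ValuationRing.ValueGroup W K)ˣ)
    have hf' : StrictMono f := f.monotone'.strictMono_of_injective hf
    have hne : ∀ {x}, x ≠ 0 → ValuationRing.valuation W K x ≠ 0 := fun hx =>
      (Valuation.ne_zero_iff _).2 hx
    classical
    refine ⟨fun x => if hx : x = 0 then 0 else -f (Additive.ofMul (Units.mk0 _ (hne hx))), ?_, ?_⟩
    · intro x y hx hy
      simp only [hx, hy, mul_ne_zero hx hy, dif_neg, not_false_eq_true]
      rw [← neg_add, ← map_add, ← ofMul_mul]
      congr 3
      ext
      simp
    · intro x y hx hy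
      simp only [hx, hy, dif_neg, not_false_eq_true, neg_le_neg_iff]
      rw [hf'.le_iff_le, Additive.ofMul_le, ← Units.val_le_val, Units.val_mk0, Units.val_mk0]
  have hL1 : L 1 = 0 := by
    have := hLmul 1 1 one_ne_zero one_ne_zero
    rw [one_mul] at this
    linarith
  have ha0' : algebraMap W K a ≠ 0 := by
    rwa [Ne, map_eq_zero_iff _ (IsFractionRing.injective W K)]
  have hLpos : ∀ x, x ≠ 0 → (0 ≤ L x ↔ x ∈ (algebraMap W K).range) := fun x hx => by
    rw [← hL1, hLle x 1 hx one_ne_zero, map_one, ← Valuation.mem_integer_iff,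
      ValuationRing.mem_integer_iff]
    rfl
  have hLa : 0 < L (algebraMap W K a) := by
    refine lt_of_le_of_ne ((hLpos _ ha0').2 ⟨a, rfl⟩) fun h0 => (mem_maximalIdeal a).1 ha ?_
    have h1 := hLmul _ _ ha0' (inv_ne_zero ha0')
    rw [mul_inv_cancel₀ ha0', hL1, ← h0, zero_add] at h1
    obtain ⟨b, hb⟩ := (hLpos _ (inv_ne_zero ha0')).1 h1.le
    refine IsUnit.of_mul_eq_one b (IsFractionRing.injective W K ?_)
    rw [map_mul, hb, mul_inv_cancel₀ ha0', map_one]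
  set c := s / L (algebraMap W K a)
  have hc : 0 < c := div_pos hs hLa
  classical
  let g : K → WithTop ℝ := fun x => if x = 0 then ⊤ else ((c * L x : ℝ) : WithTop ℝ)
  have hg : ∀ {x}, x ≠ 0 → g x = ((c * L x : ℝ) : WithTop ℝ) := fun hx => if_neg hx
  have hg0 : g 0 = ⊤ := if_pos rfl
  refine ⟨AddValuation.of g hg0 ?_ ?_ ?_, fun x => ?_, ?_⟩
  · rw [hg one_ne_zero, hL1, mul_zero, WithTop.coe_zero]
  · intro x y
    by_cases hxy : x + y = 0
    · rw [hxy, hg0]; exact le_top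
    by_cases hx : x = 0
    · rw [hx, zero_add]; exact min_le_right _ _
    by_cases hy : y = 0
    · rw [hy, add_zero]; exact min_le_left _ _
    rw [hg hxy, hg hx, hg hy, min_le_iff, WithTop.coe_le_coe, WithTop.coe_le_coe,
      mul_le_mul_iff_right₀ hc, mul_le_mul_iff_right₀ hc, hLle _ _ hxy hx, hLle _ _ hxy hy]
    exact le_max_iff.1 ((ValuationRing.valuation W K).map_add x y)
  · intro x y
    by_cases hx : x = 0
    · rw [hx, zero_mul, hg0, WithTop.top_add]
    by_cases hy : y = 0
    · rw [hy, mul_zero, hg0, WithTop.add_top]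
    rw [hg hx, hg hy, hg (mul_ne_zero hx hy), hLmul x y hx hy, mul_add, WithTop.coe_add]
  · rw [AddValuation.of_apply]
    by_cases hx : x = 0
    · rw [hx, hg0]
      exact ⟨fun _ => zero_mem _, fun _ => le_top⟩
    · rw [hg hx, ← hLpos x hx, ← WithTop.coe_zero, WithTop.coe_le_coe, mul_nonneg_iff_of_pos_left hc]
  · rw [AddValuation.of_apply, hg ha0', div_mul_cancel₀ _ hLa.ne']

end RankOne

section Existence

variable {V : Type u} [CommRing V] [IsDomain V] [ValuationRing V]

theorem exists_dvd_pow_of_isGreatest {Q : Ideal V}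
    (hQ : ∀ p : Ideal V, p.IsPrime → p < maximalIdeal V → p ≤ Q) {b d : V}
    (hb : b ∈ maximalIdeal V) (hd : d ∉ Q) : ∃ n, d ∣ b ^ n := by
  have h : b ∈ (Ideal.span {d}).radical := by
    rw [Ideal.radical_eq_sInf, Ideal.mem_sInf]
    rintro p ⟨hdp, hp⟩
    rcases (le_maximalIdeal hp.ne_top).eq_or_lt with heq | hlt
    · exact heq ▸ hb
    · exact absurd (hQ p hp hlt (hdp (Ideal.mem_span_singleton_self d))) hd
  obtain ⟨n, hn⟩ := h
  exact ⟨n, Ideal.mem_span_singleton.1 hn⟩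

theorem exists_addValuation_of_isGreatest {Q : Ideal V} [Q.IsPrime]
    (hQ : IsGreatest {p : Ideal V | p.IsPrime ∧ p < maximalIdeal V} Q) {a : V}
    (ha : a ∈ maximalIdeal V) (haQ : a ∉ Q) {s : ℝ≥0∞} (hs : s ≠ 0) (hs' : s ≠ ⊤) :
    ∃ v : AddValuation (FractionRing (V ⧸ Q)) (WithTop ℝ),
      (∀ x, 0 ≤ v x ↔ x ∈ (algebraMap (V ⧸ Q) (FractionRing (V ⧸ Q))).range) ∧
      valueAt v a = s := by
  have hsurj := Ideal.Quotient.mk_surjective (I := Q)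
  have : ValuationRing (V ⧸ Q) := Function.Surjective.valuationRing (Ideal.Quotient.mk Q) hsurj
  have hloc : IsLocalHom (Ideal.Quotient.mk Q) := hsurj.isLocalHom _
  have hm : ∀ b : V, Ideal.Quotient.mk Q b ∈ maximalIdeal (V ⧸ Q) ↔ b ∈ maximalIdeal V := fun b => by
    rw [mem_maximalIdeal, mem_maximalIdeal, mem_nonunits_iff, mem_nonunits_iff,
      isUnit_map_iff]
  obtain ⟨v, hv, hva⟩ := ValuationRing.exists_addValuation (W := V ⧸ Q)
    (fun b hb d hd => by
      obtain ⟨b, rfl⟩ := hsurj b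
      obtain ⟨d, rfl⟩ := hsurj d
      obtain ⟨n, hn⟩ := exists_dvd_pow_of_isGreatest (fun p hp hlt => hQ.2 ⟨hp, hlt⟩)
        ((hm b).1 hb) (fun h => hd (Ideal.Quotient.eq_zero_iff_mem.2 h))
      exact ⟨n, map_pow (Ideal.Quotient.mk Q) b n ▸ map_dvd _ hn⟩)
    ((hm a).2 ha) (fun h => haQ (Ideal.Quotient.eq_zero_iff_mem.1 h))
    (ENNReal.toReal_pos hs hs')
  refine ⟨v, hv, ?_⟩
  rw [valueAt_eq_truncate, hva, truncate_coe, ENNReal.ofReal_toReal hs']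

end Existence

end

/-! ### Weights on D_P with prescribed residue length and slope -/

section

open IsLocalRing

section Existence

variable {D : Type u} [CommRing D]

namespace PrimeSpectrum

theorem isPrime_map_of_le {P Q : PrimeSpectrum D} (h : Q ≤ P) :
    (Q.asIdeal.map (algebraMap D (Localization.AtPrime P.asIdeal))).IsPrime :=
  IsLocalization.isPrime_of_isPrime_disjoint P.asIdeal.primeCompl _ _ Q.2
    (Set.disjoint_left.2 fun _ hx hxQ => hx (h hxQ))

theorem under_map_of_le {P Q : PrimeSpectrum D} (h : Q ≤ P) :
    (Q.asIdeal.map (algebraMap D (Localization.AtPrime P.asIdeal))).under D = Q.asIdeal :=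
  sat_of_le h

theorem map_lt_maximalIdeal {P Q : PrimeSpectrum D} (h : Q < P) :
    Q.asIdeal.map (algebraMap D (Localization.AtPrime P.asIdeal)) <
      maximalIdeal (Localization.AtPrime P.asIdeal) := by
  refine lt_of_le_of_ne (map_le_maximalIdeal (le_of_lt h)) fun heq => ?_
  have h1 := under_map_of_le h.le
  rw [heq, Localization.AtPrime.under_maximalIdeal] at h1
  exact h.ne (PrimeSpectrum.ext h1.symm)

theorem under_lt {P : PrimeSpectrum D} {p : Ideal (Localization.AtPrime P.asIdeal)} [hp : p.IsPrime]
    (h : p < maximalIdeal (Localization.AtPrime P.asIdeal)) :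
    (⟨p.under D, inferInstance⟩ : PrimeSpectrum D) < P := by
  have hle : p.under D ≤ P.asIdeal :=
    (Ideal.comap_mono h.le).trans Localization.AtPrime.under_maximalIdeal.le
  refine lt_of_le_of_ne hle fun heq => h.ne ?_
  rw [← IsLocalization.map_under P.asIdeal.primeCompl _ p,
    show p.under D = P.asIdeal from congrArg asIdeal heq, Localization.AtPrime.map_eq_maximalIdeal]

theorem isGreatest_map {P Q : PrimeSpectrum D} (h : IsGreatest (Set.Iio P) Q) :
    IsGreatest {p : Ideal (Localization.AtPrime P.asIdeal) | p.IsPrime ∧ p < maximalIdeal _}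
      (Q.asIdeal.map (algebraMap D (Localization.AtPrime P.asIdeal))) := by
  refine ⟨⟨isPrime_map_of_le (le_of_lt h.1), map_lt_maximalIdeal h.1⟩, fun p ⟨hp, hlt⟩ => ?_⟩
  rw [← IsLocalization.map_under P.asIdeal.primeCompl _ p]
  exact Ideal.map_mono (show p.under D ≤ Q.asIdeal from h.2 (under_lt hlt))

theorem isGreatest_under {P : PrimeSpectrum D} {p : Ideal (Localization.AtPrime P.asIdeal)}
    [hp : p.IsPrime] (h : IsGreatest {p : Ideal (Localization.AtPrime P.asIdeal) | p.IsPrime ∧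
      p < maximalIdeal _} p) :
    IsGreatest (Set.Iio P) ⟨p.under D, inferInstance⟩ := by
  refine ⟨under_lt h.1.2, fun Q hQ => ?_⟩
  have hle := h.2 ⟨isPrime_map_of_le (le_of_lt hQ), map_lt_maximalIdeal hQ⟩
  exact (under_map_of_le (le_of_lt hQ)).ge.trans (Ideal.comap_mono hle)

end PrimeSpectrum

theorem valueWeight_eq_top {V : Type u} [CommRing V] {Q : Ideal V} [Q.IsPrime]
    (v : AddValuation (FractionRing (V ⧸ Q)) (WithTop ℝ)) {I : Ideal V} (h : I ≤ Q) :
    valueWeight (valueAt v) I = ⊤ := by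
  simp only [valueWeight, iInf_eq_top]
  exact fun a ha => (valueAt_eq_top_iff v).2 (h ha)

variable [IsDomain D]

theorem IsPruferDomain.branched_of_not_isIdempotentElem (hD : IsPruferDomain D)
    {P : PrimeSpectrum D} (h : ¬ IsIdempotentElem P.asIdeal) : P.Branched := by
  refine hD.branched_of_isMinimalOver (I := P.asIdeal * P.asIdeal)
    ⟨Ideal.mul_le_left, fun Q _ h x hx => ?_⟩ ?_
  · exact (Q.2.mem_or_mem (h (Ideal.mul_mem_mul hx hx))).elim id id
  · rw [Ideal.map_mul, Localization.AtPrime.map_eq_maximalIdeal]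
    exact lt_of_le_of_ne Ideal.mul_le_left fun heq =>
      h ((hD.isIdempotentElem_maximalIdeal_iff P).1 heq)

/-- The valuation is normalised at the pivot when P is idempotent, and then its infimum on PD_P is
0. Otherwise it is normalised at a generator of PD_P. -/
theorem IsPruferDomain.exists_addValuation (hD : IsPruferDomain D) {P Q : PrimeSpectrum D}
    (hQ : IsGreatest (Set.Iio P) Q)
    [(Q.asIdeal.map (algebraMap D (Localization.AtPrime P.asIdeal))).IsPrime]
    {σ : ℝ≥0∞} (h0 : σ ≠ 0) (htop : σ ≠ ⊤) :
    ∃ v : AddValuation (FractionRing (_ ⧸ Q.asIdeal.map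
        (algebraMap D (Localization.AtPrime P.asIdeal)))) (WithTop ℝ),
      (∀ x, 0 ≤ v x ↔ x ∈ (algebraMap (_ ⧸ Q.asIdeal.map
        (algebraMap D (Localization.AtPrime P.asIdeal))) (FractionRing _)).range) ∧
      IsWeight (valueWeight (valueAt v)) ∧
      (P.BranchedIdempotent → valueWeight (valueAt v) (maximalIdeal _) = 0 ∧
        valueWeight (valueAt v) ((Ideal.span {P.pivot}).map (algebraMap D _)) = σ) ∧
      (¬ P.BranchedIdempotent → valueWeight (valueAt v) (maximalIdeal _) = σ) := by
  have hV := hD P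
  have hb : P.Branched := ⟨Q, hQ⟩
  have hG := PrimeSpectrum.isGreatest_map hQ
  by_cases hid : P.BranchedIdempotent
  · have hmem : algebraMap D (Localization.AtPrime P.asIdeal) P.pivot ∈
        maximalIdeal (Localization.AtPrime P.asIdeal) := by
      rw [← Localization.AtPrime.map_eq_maximalIdeal]
      exact Ideal.mem_map_of_mem _ hb.pivot_mem
    obtain ⟨v, hv, hva⟩ := exists_addValuation_of_isGreatest hG hmem
      (fun h => hb.pivot_notMem hQ.1 ((PrimeSpectrum.under_map_of_le (le_of_lt hQ.1)).le h)) h0 htop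
    have hf := isValue_valueAt v hv
    refine ⟨v, hv, hf.isWeight hmem (hva ▸ htop), fun _ => ⟨?_, ?_⟩, fun h => absurd hid h⟩
    · exact hf.weight_maximalIdeal_of_isIdempotentElem
        ((hD.isIdempotentElem_maximalIdeal_iff P).2 hid.2) hmem (hva ▸ htop)
    · rw [Ideal.map_span, Set.image_singleton, hf.weight_span, hva]
  · obtain ⟨π, -, hπ⟩ := exists_maximalIdeal_eq_span
      (mt (hD.isIdempotentElem_maximalIdeal_iff P).1 fun h => hid ⟨hb, h⟩)
    have hmem := hπ.ge (Ideal.mem_span_singleton_self π)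
    obtain ⟨v, hv, hva⟩ := exists_addValuation_of_isGreatest hG hmem
      (fun h => hG.1.2.not_ge (hπ.trans_le ((Ideal.span_singleton_le_iff_mem _).2 h))) h0 htop
    have hf := isValue_valueAt v hv
    refine ⟨v, hv, hf.isWeight hmem (hva ▸ htop), fun h => absurd h hid, fun _ => ?_⟩
    rw [hπ, hf.weight_span, hva]

/-- The zero weight serves for σ = 0, a valuation for P branched and 0 < σ < ∞, and a point weight
in the remaining cases. The last is legitimate because a non-idempotent prime is branched, so there
ρ = σ = ∞. -/
theorem IsPruferDomain.exists_weight (hD : IsPruferDomain D) (P : PrimeSpectrum D) {ρ σ : ℝ≥0∞}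
    (h₁ : P.BranchedIdempotent → ρ ≠ 0 → σ = ⊤) (h₂ : ¬ P.BranchedIdempotent → σ = ρ) :
    ∃ w : Ideal (Localization.AtPrime P.asIdeal) → ℝ≥0∞, IsWeight w ∧ w (maximalIdeal _) = ρ ∧
      (P.BranchedIdempotent → w ((Ideal.span {P.pivot}).map (algebraMap D _)) = σ) ∧
      (σ ≠ 0 → ∀ Q < P, w (Q.asIdeal.map (algebraMap D _)) = ⊤) ∧ (σ = 0 → ∀ I, w I = 0) := by
  by_cases h0 : σ = 0
  · subst h0
    refine ⟨_, isWeight_zero, ?_, fun _ => rfl, fun h => absurd rfl h, fun _ _ => rfl⟩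
    by_contra hne
    by_cases hb : P.BranchedIdempotent
    · exact ENNReal.zero_ne_top (h₁ hb (Ne.symm hne))
    · exact hne (h₂ hb)
  by_cases hcase : P.Branched → σ = ⊤
  · refine ⟨pointWeight ρ, isWeight_pointWeight ?_, pointWeight_maximalIdeal ρ, fun hb => ?_,
      fun _ Q hQ => pointWeight_of_lt ρ (PrimeSpectrum.map_lt_maximalIdeal hQ), fun h => absurd h h0⟩
    · rw [hD.isIdempotentElem_maximalIdeal_iff P, or_iff_not_imp_left]
      intro hid
      rw [← h₂ fun hb => hid hb.2]
      exact hcase (hD.branched_of_not_isIdempotentElem hid)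
    · rw [pointWeight_of_lt ρ (hD.map_pivot_lt hb), hcase hb.1]
  push Not at hcase
  obtain ⟨hb, htop⟩ := hcase
  obtain ⟨Q, hQ⟩ := id hb
  have := PrimeSpectrum.isPrime_map_of_le (le_of_lt hQ.1)
  obtain ⟨v, -, hw, hid, hnid⟩ := hD.exists_addValuation hQ h0 htop
  refine ⟨_, hw, ?_, fun h => (hid h).2, fun _ Q' hQ' =>
    valueWeight_eq_top v (Ideal.map_mono (hQ.2 hQ')), fun h => absurd h h0⟩
  by_cases hP : P.BranchedIdempotent
  · rw [(hid hP).1]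
    by_contra hne
    exact htop (h₁ hP (Ne.symm hne))
  · rw [hnid hP, h₂ hP]

end Existence

end

/-! ### Admissible data and the order isomorphism -/

section

open IsLocalRing

section OrderIso

/-- The conditions on the residue lengths `ρ` and the slopes `σ` of a length function. -/
structure IsAdmissible {X : Type*} [Preorder X] (b : X → Prop) (ρ σ : X → ℝ≥0∞) : Prop where
  slope_eq_top : ∀ P, b P → ρ P ≠ 0 → σ P = ⊤
  slope_eq : ∀ P, ¬ b P → σ P = ρ P
  residue_eq_top : ∀ Q P, Q < P → σ P ≠ 0 → ρ Q = ⊤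

variable {D : Type u} [CommRing D]

theorem PrimeSpectrum.map_sat (P : PrimeSpectrum D) (I : Ideal D) :
    (P.sat I).map (algebraMap D (Localization.AtPrime P.asIdeal)) =
      I.map (algebraMap D (Localization.AtPrime P.asIdeal)) :=
  IsLocalization.map_under P.asIdeal.primeCompl _ _

theorem PrimeSpectrum.map_sat_eq_top {P Q : PrimeSpectrum D} {I : Ideal D} (hI : Q.IsMinimalOver I)
    (h : ¬ Q ≤ P) : (Q.sat I).map (algebraMap D (Localization.AtPrime P.asIdeal)) = ⊤ := by
  obtain ⟨x, hxQ, hxP⟩ := SetLike.not_le_iff_exists.1 (show ¬ Q.asIdeal ≤ P.asIdeal from h)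
  obtain ⟨n, hn⟩ := hI.exists_pow_mem (algebraMap D _ x) (by
    rw [← Localization.AtPrime.map_eq_maximalIdeal]
    exact Ideal.mem_map_of_mem _ hxQ)
  rw [← map_pow] at hn
  refine Ideal.eq_top_of_isUnit_mem _ (Ideal.mem_map_of_mem _ (show x ^ n ∈ Q.sat I from hn)) ?_
  exact IsLocalization.map_units (Localization.AtPrime P.asIdeal)
    (⟨x ^ n, fun h' => hxP (P.2.mem_of_pow_mem n h')⟩ : P.asIdeal.primeCompl)

variable [IsDomain D]

theorem LengthFunction.isAdmissible (hD : IsPruferDomain D) (ℓ : LengthFunction D) :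
    IsAdmissible PrimeSpectrum.BranchedIdempotent ℓ.residueLength ℓ.slope where
  slope_eq_top _ hb h := slope_eq_top hD hb h
  slope_eq _ hb := if_neg hb
  residue_eq_top _ _ hlt h := residueLength_eq_top hD hlt h

/-- The sum over P of the pullbacks of the local functions has the prescribed data. A larger prime
can disturb the value at Q only by making it infinite, and admissibility requires ∞ in that case. -/
theorem LengthFunction.exists_of_isAdmissible (hD : IsPruferDomain D)
    {ρ σ : PrimeSpectrum D → ℝ≥0∞} (h : IsAdmissible PrimeSpectrum.BranchedIdempotent ρ σ) :
    ∃ ℓ : LengthFunction D, ℓ.residueLength = ρ ∧ ℓ.slope = σ := by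
  choose w hw hwm hwp hwt hw0 using fun P =>
    hD.exists_weight P (h.slope_eq_top P) (h.slope_eq P)
  let ℓ : LengthFunction D := .tsum fun P => (hw P).lengthFunction.pullback
  have hℓ : ∀ I, ℓ.idx I = ∑' P : PrimeSpectrum D, w P (I.map (algebraMap D _)) := fun I => by
    rw [idx_tsum]
    exact tsum_congr fun P => by rw [idx_pullback, (hw P).idx_lengthFunction]
  -- The terms with `P` not above `Q` vanish because the ideal becomes the unit ideal there. Those
  -- with `P > Q` are `0` or `⊤` according to `σ P`, and the term `P = Q` gives the stated value.
  have key : ∀ (Q : PrimeSpectrum D) (I : Ideal D), Q.IsMinimalOver I →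
      ((∃ P, Q < P ∧ σ P ≠ 0) → w Q (I.map (algebraMap D _)) = ⊤) →
      ℓ.idx (Q.sat I) = w Q (I.map (algebraMap D _)) := by
    intro Q I hI hlt
    rw [hℓ]
    by_cases hex : ∃ P, Q < P ∧ σ P ≠ 0
    · rw [hlt hex]
      obtain ⟨P, hP, hσ⟩ := hex
      refine top_le_iff.1 (le_trans ?_ (ENNReal.le_tsum P))
      rw [← hwt P hσ Q hP]
      exact (hw P).anti (Ideal.map_mono (PrimeSpectrum.sat_le hI.1))
    · rw [tsum_eq_single Q fun P hP => ?_, Q.map_sat]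
      by_cases hle : Q ≤ P
      · refine hw0 P ?_ _
        by_contra hσ
        exact hex ⟨P, lt_of_le_of_ne hle (Ne.symm hP), hσ⟩
      · rw [PrimeSpectrum.map_sat_eq_top hI hle, (hw P).top]
  have hρ : ∀ Q, ℓ.residueLength Q = ρ Q := fun Q => by
    have hI : Q.IsMinimalOver Q.asIdeal := ⟨le_rfl, fun _ _ h => h⟩
    rw [residueLength, ← PrimeSpectrum.sat_of_le (le_refl Q), key Q _ hI,
      Localization.AtPrime.map_eq_maximalIdeal, hwm]
    rintro ⟨P, hP, hσ⟩
    rw [Localization.AtPrime.map_eq_maximalIdeal, hwm]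
    exact h.residue_eq_top Q P hP hσ
  refine ⟨ℓ, funext hρ, funext fun Q => ?_⟩
  unfold slope
  split_ifs with hb
  · rw [key Q _ hb.1.isMinimalOver_pivot, hwp Q hb]
    rintro ⟨P, hP, hσ⟩
    rw [hwp Q hb, h.slope_eq_top Q hb]
    rw [h.residue_eq_top Q P hP hσ]
    exact ENNReal.top_ne_zero
  · rw [hρ, h.slope_eq Q hb]

theorem IsAdmissible.comp {X Y : Type*} [Preorder X] [Preorder Y] {b : X → Prop} {c : Y → Prop}
    {ρ σ : X → ℝ≥0∞} (h : IsAdmissible b ρ σ) (e : Y ≃o X) (he : ∀ y, c y ↔ b (e y)) :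
    IsAdmissible c (ρ ∘ e) (σ ∘ e) where
  slope_eq_top y hy := h.slope_eq_top (e y) ((he y).1 hy)
  slope_eq y hy := h.slope_eq (e y) (mt (he y).2 hy)
  residue_eq_top y z hlt := h.residue_eq_top (e y) (e z) (e.lt_iff_lt.2 hlt)

theorem PrimeSpectrum.Branched.map {A : Type u} {B : Type v} [CommRing A] [CommRing B]
    (e : PrimeSpectrum A ≃o PrimeSpectrum B) {P : PrimeSpectrum A} (h : P.Branched) :
    (e P).Branched := by
  obtain ⟨Q, hQ, hle⟩ := h
  exact ⟨e Q, e.lt_iff_lt.2 hQ, fun Q' hQ' => e.symm_apply_le.1 (hle (e.symm_apply_lt.2 hQ'))⟩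

theorem PrimeSpectrum.branched_apply_iff {A : Type u} {B : Type v} [CommRing A] [CommRing B]
    (e : PrimeSpectrum A ≃o PrimeSpectrum B) {P : PrimeSpectrum A} :
    (e P).Branched ↔ P.Branched :=
  ⟨fun h => by simpa using h.map e.symm, Branched.map e⟩

theorem LengthFunction.le_iff_residueLength_slope (hD : IsPruferDomain D)
    (hmin : ∀ I : Ideal D, I.minimalPrimes.Finite) {ℓ₁ ℓ₂ : LengthFunction D} :
    ℓ₁ ≤ ℓ₂ ↔ ℓ₁.residueLength ≤ ℓ₂.residueLength ∧ ℓ₁.slope ≤ ℓ₂.slope :=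
  ⟨fun h => ⟨fun _ => residueLength_mono h, fun _ => slope_mono h⟩,
    fun h => le_of_forall_le hD hmin h.1 h.2⟩

theorem LengthFunction.ext_residueLength_slope (hD : IsPruferDomain D)
    (hmin : ∀ I : Ideal D, I.minimalPrimes.Finite) {ℓ₁ ℓ₂ : LengthFunction D}
    (hr : ℓ₁.residueLength = ℓ₂.residueLength) (hs : ℓ₁.slope = ℓ₂.slope) : ℓ₁ = ℓ₂ :=
  le_antisymm ((le_iff_residueLength_slope hD hmin).2 ⟨hr.le, hs.le⟩)
    ((le_iff_residueLength_slope hD hmin).2 ⟨hr.ge, hs.ge⟩)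

/-- Admissibility is expressed by the order of Spec and the branched idempotent primes, both
preserved by e. Length functions therefore correspond through their data, which also determine the
order. -/
theorem LengthFunction.exists_orderIso {A : Type u} {B : Type v} [CommRing A] [IsDomain A]
    [CommRing B] [IsDomain B] (hA : IsPruferDomain A) (hB : IsPruferDomain B)
    (hA_min : ∀ I : Ideal A, I.minimalPrimes.Finite)
    (hB_min : ∀ I : Ideal B, I.minimalPrimes.Finite)
    (e : PrimeSpectrum A ≃o PrimeSpectrum B)
    (he : ∀ P, IsIdempotentElem P.asIdeal ↔ IsIdempotentElem (e P).asIdeal) :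
    ∃ Φ : LengthFunction A ≃o LengthFunction B, ∀ ℓ P,
      (Φ ℓ).residueLength (e P) = ℓ.residueLength P ∧ (Φ ℓ).slope (e P) = ℓ.slope P := by
  have hb : ∀ P, P.BranchedIdempotent ↔ (e P).BranchedIdempotent := fun P =>
    and_congr (PrimeSpectrum.branched_apply_iff e).symm (he P)
  choose F hFr hFs using fun ℓ : LengthFunction A =>
    exists_of_isAdmissible hB ((ℓ.isAdmissible hA).comp e.symm fun P => by
      rw [hb, e.apply_symm_apply])
  choose G hGr hGs using fun ℓ : LengthFunction B =>
    exists_of_isAdmissible hA ((ℓ.isAdmissible hB).comp e hb)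
  refine ⟨⟨⟨F, G, fun ℓ => ext_residueLength_slope hA hA_min ?_ ?_,
    fun ℓ => ext_residueLength_slope hB hB_min ?_ ?_⟩, fun {ℓ₁ ℓ₂} => ?_⟩, fun ℓ P => ⟨?_, ?_⟩⟩
  · rw [hGr, hFr]; ext P; simp
  · rw [hGs, hFs]; ext P; simp
  · rw [hFr, hGr]; ext P; simp
  · rw [hFs, hGs]; ext P; simp
  · change F ℓ₁ ≤ F ℓ₂ ↔ _
    rw [le_iff_residueLength_slope hB hB_min, le_iff_residueLength_slope hA hA_min, hFr, hFr, hFs,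
      hFs]
    simp only [Pi.le_def, Function.comp_apply, e.symm.surjective.forall]
  · change (F ℓ).residueLength _ = _
    simp [hFr]
  · change (F ℓ).slope _ = _
    simp [hFs]

end OrderIso

end

/-! ### The sets Σ read off from residue lengths and slopes -/

section

open IsLocalRing

section Sigma

theorem LengthFunction.forall_idx_eq_pointWeight_iff {V : Type u} [CommRing V] [IsLocalRing V]
    (ℓ : LengthFunction V) (r : ℝ≥0∞) :
    (∀ I, ℓ.idx I = pointWeight r I) ↔
      ℓ.idx (maximalIdeal V) = r ∧ ∀ I < maximalIdeal V, ℓ.idx I = ⊤ := by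
  constructor
  · intro h
    exact ⟨by rw [h, pointWeight_maximalIdeal], fun I hI => by rw [h, pointWeight_of_lt r hI]⟩
  · rintro ⟨h₁, h₂⟩ I
    rcases I.eq_top_or_eq_or_lt_maximalIdeal with rfl | rfl | hI
    · rw [ℓ.idx_top, pointWeight_top]
    · rw [h₁, pointWeight_maximalIdeal]
    · rw [h₂ I hI, pointWeight_of_lt r hI]

variable {D : Type u} [CommRing D] {ℓ : LengthFunction D} {P : PrimeSpectrum D}

theorem PrimeSpectrum.isMinimalOver_or_exists_lt (P : PrimeSpectrum D)
    {I : Ideal (Localization.AtPrime P.asIdeal)} (hI : I ≤ maximalIdeal _) :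
    P.IsMinimalOver (I.under D) ∨ ∃ Q < P, I.under D ≤ Q.asIdeal := by
  rw [or_iff_not_imp_left]
  intro h
  have hle : I.under D ≤ P.asIdeal :=
    (Ideal.comap_mono hI).trans Localization.AtPrime.under_maximalIdeal.le
  simp only [IsMinimalOver, hle, true_and, not_forall] at h
  obtain ⟨Q, hQ, hIQ, hne⟩ := h
  exact ⟨Q, lt_of_le_not_ge hQ hne, hIQ⟩

namespace LengthFunction

theorem idx_atPrime_map_of_le {Q : PrimeSpectrum D} (h : Q ≤ P) :
    (ℓ.atPrime P).idx (Q.asIdeal.map (algebraMap D _)) = ℓ.residueLength Q := by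
  rw [idx_atPrime_map, PrimeSpectrum.sat_of_le h]
  rfl

theorem slope_eq_idx_atPrime (hb : P.BranchedIdempotent) :
    ℓ.slope P = (ℓ.atPrime P).idx ((Ideal.span {P.pivot}).map (algebraMap D _)) := by
  rw [slope, if_pos hb, idx_atPrime_map]

theorem mem_sigmaT_iff : P ∈ ℓ.sigmaT ↔ ℓ.residueLength P = ⊤ := by
  have h : P ∈ ℓ.sigmaT ↔ (ℓ.atPrime P).toFun =
    torsionSingular (maximalIdeal (Localization.AtPrime P.asIdeal)) := Iff.rfl
  rw [h, torsionSingular_eq, (isWeight_pointWeight (Or.inr rfl)).toFun_eq_iff,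
    forall_idx_eq_pointWeight_iff, idx_atPrime_maximalIdeal]
  refine and_iff_left_of_imp fun htop I hI => top_le_iff.1 ?_
  rw [← htop, ← idx_atPrime_maximalIdeal]
  exact (ℓ.atPrime P).idx_anti hI.le

variable [IsDomain D] (hD : IsPruferDomain D)
include hD

/-- An ideal I < PD_P either lies over an ideal inside some Q < P or has radical PD_P. In the second
case P is branched, and x in PD_P outside I has a power in the ideal of the pivot. An infinite slope
then makes D_P/x infinite, and I ⊆ (x). -/
theorem forall_idx_atPrime_eq_top_iff (hid : IsIdempotentElem P.asIdeal) :
    (∀ I < maximalIdeal (Localization.AtPrime P.asIdeal), (ℓ.atPrime P).idx I = ⊤) ↔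
      (P.BranchedIdempotent → ℓ.slope P = ⊤) ∧ ∀ Q < P, ℓ.residueLength Q = ⊤ := by
  have hV := hD P
  constructor
  · refine fun h => ⟨fun hb => ?_, fun Q hQ => ?_⟩
    · rw [slope_eq_idx_atPrime hb]
      exact h _ (hD.map_pivot_lt hb)
    · rw [← idx_atPrime_map_of_le (le_of_lt hQ)]
      exact h _ (PrimeSpectrum.map_lt_maximalIdeal hQ)
  · rintro ⟨h₁, h₂⟩ I hI
    rcases P.isMinimalOver_or_exists_lt hI.le with hmin | ⟨Q, hQ, hIQ⟩
    · have hb : P.BranchedIdempotent := by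
        refine ⟨hD.branched_of_isMinimalOver hmin ?_, hid⟩
        rwa [IsLocalization.map_under P.asIdeal.primeCompl _ I]
      obtain ⟨x, hx, hxI⟩ := SetLike.exists_of_lt hI
      obtain ⟨n, hn⟩ := hb.1.isMinimalOver_pivot.exists_pow_mem x hx
      have hx0 : x ≠ 0 := by
        rintro rfl
        exact hxI I.zero_mem
      have hle := (ℓ.atPrime P).idx_le_of_pow_mem hx0 hn
      rw [← slope_eq_idx_atPrime hb, h₁ hb, top_le_iff, ENNReal.mul_eq_top] at hle
      have hxt : (ℓ.atPrime P).idx (Ideal.span {x}) = ⊤ :=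
        hle.elim And.right fun h => absurd h.1 (ENNReal.natCast_ne_top n)
      rw [← top_le_iff, ← hxt]
      exact (ℓ.atPrime P).idx_anti (le_span_singleton_of_notMem hxI)
    · rw [← top_le_iff, ← h₂ Q hQ, idx_atPrime]
      exact ℓ.idx_anti hIQ

theorem mem_sigmaI_iff : P ∈ ℓ.sigmaI ↔ IsIdempotentElem P.asIdeal ∧ ℓ.residueLength P = 0 ∧
    (P.BranchedIdempotent → ℓ.slope P = ⊤) ∧ ∀ Q < P, ℓ.residueLength Q = ⊤ := by
  have h : P ∈ ℓ.sigmaI ↔ IsIdempotentElem (maximalIdeal (Localization.AtPrime P.asIdeal)) ∧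
    (ℓ.atPrime P).toFun =
      idempotentSingular (maximalIdeal (Localization.AtPrime P.asIdeal)) := Iff.rfl
  rw [h, ← hD.isIdempotentElem_maximalIdeal_iff P]
  refine and_congr_right fun hid => ?_
  rw [idempotentSingular_eq hid, (isWeight_pointWeight (Or.inl hid)).toFun_eq_iff,
    forall_idx_eq_pointWeight_iff, idx_atPrime_maximalIdeal,
    forall_idx_atPrime_eq_top_iff hD ((hD.isIdempotentElem_maximalIdeal_iff P).1 hid)]

/-- Infinite values on the ideals below PD_P need not be required: they follow from ρ(P) ≠ 0 by
`slope_eq_top` and `residueLength_eq_top`. -/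
theorem mem_sigmaR_iff : P ∈ ℓ.sigmaR ↔ IsIdempotentElem P.asIdeal ∧ ℓ.residueLength P ≠ 0 ∧
    ℓ.residueLength P ≠ ⊤ := by
  have h : P ∈ ℓ.sigmaR ↔ IsIdempotentElem (maximalIdeal (Localization.AtPrime P.asIdeal)) ∧
    ∃ α : ℝ≥0, 0 < α ∧ (ℓ.atPrime P).toFun =
      scale α (rankFunction (maximalIdeal (Localization.AtPrime P.asIdeal))) := Iff.rfl
  rw [h, ← hD.isIdempotentElem_maximalIdeal_iff P]
  refine and_congr_right fun hid => ?_
  have key : ∀ α : ℝ≥0, 0 < α → ((ℓ.atPrime P).toFun =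
      scale α (rankFunction (maximalIdeal (Localization.AtPrime P.asIdeal))) ↔
        ℓ.residueLength P = α ∧
        (P.BranchedIdempotent → ℓ.slope P = ⊤) ∧ ∀ Q < P, ℓ.residueLength Q = ⊤) := fun α hα => by
    rw [scale_rankFunction_eq hid hα, (isWeight_pointWeight (Or.inl hid)).toFun_eq_iff,
      forall_idx_eq_pointWeight_iff, idx_atPrime_maximalIdeal,
      forall_idx_atPrime_eq_top_iff hD ((hD.isIdempotentElem_maximalIdeal_iff P).1 hid)]
  constructor
  · rintro ⟨α, hα, h⟩
    rw [((key α hα).1 h).1]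
    exact ⟨ENNReal.coe_ne_zero.2 hα.ne', ENNReal.coe_ne_top⟩
  · rintro ⟨h0, htop⟩
    have hα := ENNReal.toNNReal_pos h0 htop
    refine ⟨_, hα, (key _ hα).2 ⟨(ENNReal.coe_toNNReal htop).symm, fun hb => slope_eq_top hD hb h0,
      fun Q hQ => residueLength_eq_top hD hQ fun hs => h0 ?_⟩⟩
    exact le_antisymm (residueLength_le_slope.trans hs.le) zero_le

theorem branched_and_slope_of_mem_sigmaV (h : P ∈ ℓ.sigmaV) :
    P.Branched ∧ ℓ.slope P ≠ 0 ∧ ℓ.slope P ≠ ⊤ := by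
  have hV := hD P
  obtain ⟨q, hq, v, hG, hv, hℓ⟩ := h
  have hf := isValue_valueAt v hv
  have hQ := PrimeSpectrum.isGreatest_under hG
  obtain ⟨c, hc, hcq⟩ := SetLike.exists_of_lt hG.1.2
  have hw := hf.isWeight hc (mt (valueAt_eq_top_iff v).1 hcq)
  have hidx := (hw.toFun_eq_iff (ℓ.atPrime P)).1 hℓ
  have hb : P.Branched := ⟨_, hQ⟩
  refine ⟨hb, ?_⟩
  have key : ∀ a ∈ maximalIdeal (Localization.AtPrime P.asIdeal), a ∉ q →
      (ℓ.atPrime P).idx (Ideal.span {a}) ≠ 0 ∧ (ℓ.atPrime P).idx (Ideal.span {a}) ≠ ⊤ := by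
    intro a ha haq
    rw [hidx, hf.weight_span]
    exact ⟨hf.ne_zero_of_mem ha, mt (valueAt_eq_top_iff v).1 haq⟩
  by_cases hbi : P.BranchedIdempotent
  · rw [slope_eq_idx_atPrime hbi, Ideal.map_span, Set.image_singleton]
    refine key _ ?_ fun h => hb.pivot_notMem hQ.1 h
    rw [← Localization.AtPrime.map_eq_maximalIdeal]
    exact Ideal.mem_map_of_mem _ hb.pivot_mem
  · obtain ⟨π, -, hπ⟩ := exists_maximalIdeal_eq_span
      (mt (hD.isIdempotentElem_maximalIdeal_iff P).1 fun h => hbi ⟨hb, h⟩)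
    rw [slope, if_neg hbi, ← idx_atPrime_maximalIdeal, hπ]
    exact key π (hπ.ge (Ideal.mem_span_singleton_self π)) fun h =>
      hG.1.2.not_ge (hπ.trans_le ((Ideal.span_singleton_le_iff_mem _).2 h))

/-- Normalise v by the slope. Then ℓ and L_v agree at PD_P and, if P is idempotent, at the pivot, so
they agree on all ideals with radical PD_P by comparison in both directions. On smaller ideals both
are infinite. -/
theorem mem_sigmaV_of_branched (hb : P.Branched) (h0 : ℓ.slope P ≠ 0) (htop : ℓ.slope P ≠ ⊤) :
    P ∈ ℓ.sigmaV := by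
  have hV := hD P
  obtain ⟨Q, hQ⟩ := hb
  have hG := PrimeSpectrum.isGreatest_map hQ
  have hp := hG.1.1
  obtain ⟨v, hv, hw, hbi, hnbi⟩ := hD.exists_addValuation hQ h0 htop
  refine ⟨_, hp, v, hG, hv, (hw.toFun_eq_iff (ℓ.atPrime P)).2 fun I => ?_⟩
  have hm : (ℓ.atPrime P).idx (maximalIdeal _) = hw.lengthFunction.idx (maximalIdeal _) := by
    rw [idx_atPrime_maximalIdeal, hw.idx_lengthFunction]
    by_cases h : P.BranchedIdempotent
    · rw [(hbi h).1]
      by_contra hne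
      exact htop (slope_eq_top hD h hne)
    · rw [hnbi h, slope, if_neg h]
  rcases eq_or_ne I ⊤ with rfl | hI
  · rw [idx_top, hw.top]
  have hIm := le_maximalIdeal hI
  rcases P.isMinimalOver_or_exists_lt hIm with hmin | ⟨Q', hQ', hIQ⟩
  · have hrad := hmin.exists_pow_mem
    rw [IsLocalization.map_under P.asIdeal.primeCompl _ I] at hrad
    have hpiv : IsIdempotentElem (maximalIdeal (Localization.AtPrime P.asIdeal)) →
        ∃ a < maximalIdeal (Localization.AtPrime P.asIdeal),
          (∀ x ∈ maximalIdeal (Localization.AtPrime P.asIdeal), ∃ n, x ^ n ∈ a) ∧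
          (ℓ.atPrime P).idx a = hw.lengthFunction.idx a := fun hid => by
      have h : P.BranchedIdempotent := ⟨⟨Q, hQ⟩, (hD.isIdempotentElem_maximalIdeal_iff P).1 hid⟩
      refine ⟨_, hD.map_pivot_lt h, h.1.isMinimalOver_pivot.exists_pow_mem, ?_⟩
      rw [hw.idx_lengthFunction, (hbi h).2, slope_eq_idx_atPrime h]
    rw [← hw.idx_lengthFunction]
    refine le_antisymm (idx_le_idx_of_radical hIm hrad hm.le fun _ hid => ?_)
      (idx_le_idx_of_radical hIm hrad hm.ge fun _ hid => ?_)
    · obtain ⟨a, ha, har, h⟩ := hpiv hid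
      exact ⟨a, ha, har, h.le⟩
    · obtain ⟨a, ha, har, h⟩ := hpiv hid
      exact ⟨a, ha, har, h.ge⟩
  · have hle : I ≤ Q.asIdeal.map (algebraMap D _) := by
      rw [← IsLocalization.map_under P.asIdeal.primeCompl _ I]
      exact Ideal.map_mono (hIQ.trans (hQ.2 hQ'))
    rw [valueWeight_eq_top v hle, ← top_le_iff, ← residueLength_eq_top hD hQ' h0, idx_atPrime]
    exact ℓ.idx_anti hIQ

theorem mem_sigmaV_iff : P ∈ ℓ.sigmaV ↔ P.Branched ∧ ℓ.slope P ≠ 0 ∧ ℓ.slope P ≠ ⊤ :=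
  ⟨branched_and_slope_of_mem_sigmaV hD, fun h => mem_sigmaV_of_branched hD h.1 h.2.1 h.2.2⟩

end LengthFunction

end Sigma

end

/-! ### Transport along the homeomorphism -/

theorem mainTheorem4 (A : Type u) (B : Type v) [CommRing A] [IsDomain A] [CommRing B] [IsDomain B]
    (hA : IsPruferDomain A) (hB : IsPruferDomain B)
    (hA_min : ∀ I : Ideal A, I.minimalPrimes.Finite)
    (hB_min : ∀ I : Ideal B, I.minimalPrimes.Finite)
    (φ : PrimeSpectrum A ≃ₜ PrimeSpectrum B)
    (hφ : ∀ P : PrimeSpectrum A, IsIdempotentElem P.asIdeal ↔ IsIdempotentElem (φ P).asIdeal) :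
    ∃ Φ : LengthFunction A ≃o LengthFunction B, ∀ ℓ : LengthFunction A,
      φ '' ℓ.sigmaT = (Φ ℓ).sigmaT ∧ φ '' ℓ.sigmaI = (Φ ℓ).sigmaI ∧
      φ '' ℓ.sigmaR = (Φ ℓ).sigmaR ∧ φ '' ℓ.sigmaV = (Φ ℓ).sigmaV := by
  -- Inclusion of primes is specialization in the Zariski topology, so a homeomorphism is an order
  -- isomorphism.
  let e : PrimeSpectrum A ≃o PrimeSpectrum B := ⟨φ.toEquiv, fun {P Q} => by
    rw [PrimeSpectrum.le_iff_specializes, PrimeSpectrum.le_iff_specializes]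
    exact φ.isInducing.specializes_iff⟩
  obtain ⟨Φ, hΦ⟩ := LengthFunction.exists_orderIso hA hB hA_min hB_min e hφ
  have hb : ∀ P, (φ P).Branched ↔ P.Branched := fun P => PrimeSpectrum.branched_apply_iff e
  have hbi : ∀ P, (φ P).BranchedIdempotent ↔ P.BranchedIdempotent := fun P =>
    and_congr (hb P) (hφ P).symm
  have himage : ∀ {S : Set (PrimeSpectrum A)} {T : Set (PrimeSpectrum B)},
      (∀ P, P ∈ S ↔ φ P ∈ T) → φ '' S = T := fun {S T} h => by
    have hS : S = φ ⁻¹' T := Set.ext h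
    rw [hS, Set.image_preimage_eq T φ.surjective]
  have hr : ∀ ℓ P, (Φ ℓ).residueLength (φ P) = ℓ.residueLength P := fun ℓ P => (hΦ ℓ P).1
  have hs : ∀ ℓ P, (Φ ℓ).slope (φ P) = ℓ.slope P := fun ℓ P => (hΦ ℓ P).2
  have hlt : ∀ ℓ P, (∀ Q < φ P, (Φ ℓ).residueLength Q = ⊤) ↔
      ∀ Q < P, ℓ.residueLength Q = ⊤ := fun ℓ P => by
    rw [φ.surjective.forall]
    refine forall_congr' fun Q => ?_
    rw [hr]
    exact imp_congr e.lt_iff_lt Iff.rfl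
  refine ⟨Φ, fun ℓ => ⟨himage fun P => ?_, himage fun P => ?_, himage fun P => ?_,
    himage fun P => ?_⟩⟩
  · rw [LengthFunction.mem_sigmaT_iff, LengthFunction.mem_sigmaT_iff, hr]
  · rw [LengthFunction.mem_sigmaI_iff hA, LengthFunction.mem_sigmaI_iff hB, hr, hs, hbi, hlt,
      ← hφ P]
  · rw [LengthFunction.mem_sigmaR_iff hA, LengthFunction.mem_sigmaR_iff hB, hr, ← hφ P]
  · rw [LengthFunction.mem_sigmaV_iff hA, LengthFunction.mem_sigmaV_iff hB, hs, hb]
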